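/- Let Minkowski space have signature $(+,-,-,-)$, let $r\ge 1$, and consider the bosonic Fock space over the massless one-particle space of the helicities $\pm r$, with invariant measure $d^3p/((2\pi)^3\,2|\vec p|)$ on the forward light cone, realised by symmetric, transverse, traceless tensor wave functions $\varphi_{\mu_1\dots\mu_r}(p)$ modulo longitudinal ones, with scalar product $(-1)^r\int \frac{d^3p}{(2\pi)^3 2|\vec p|}\,\overline{\varphi_{\mu_1\dots\mu_r}}\,\psi^{\mu_1\dots\mu_r}$. Let $F^{(r)}_{[\mu_1\nu_1]\dots[\mu_r\nu_r]}(x)$ be the associated hermitean point-localized field strength, whose annihilation part is the curl in each index of $\int\frac{d^3p}{(2\pi)^32|\vec p|}e^{-ipx}\varphi_{\mu_1\dots\mu_r}(p)$, and for spacelike $e$ let $$A^{(r)}_{\mu_1\dots\mu_r}(x,e)=\big(I_e^rF^{(r)}_{[\mu_1\nu_1]\dots[\mu_r\nu_r]}\big)(x)\,e^{\nu_1}\cdots e^{\nu_r},\qquad (I_ef)(x)=\int_0^\infty f(x+se)\,ds,$$ be the string-localized potential (it depends only on the direction of $e$). Put $X\overset{\leftrightarrow}{\partial_\sigma}Y=X\partial_\sigma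 Y-(\partial_\sigma X)Y$, let $\times$ stand for $r-1$ contracted indices, and let all products be Wick ordered and understood through their matrix elements between finite-particle vectors with wave functions that are smooth and compactly supported away from $p=0$. Define $$T^{(r)}_{\rho\sigma}(x,e,e')=(-1)^r\Big[-\tfrac14A^{(r)}_{\mu\times}(x,e)\overset{\leftrightarrow}{\partial_\rho}\overset{\leftrightarrow}{\partial_\sigma}A^{(r)\mu\times}(x,e')-\tfrac r4\,\partial^\mu B_{\mu\rho\sigma}(x,e,e')\Big],$$ where $B_{\mu\rho\sigma}$ is the sum of the four terms obtained from $A^{(r)}_{\rho\times}(x,e)\overset{\leftrightarrow}{\partial_\sigma}A^{(r)}_\mu{}^{\times}(x,e')$ by the exchanges $e\leftrightarrow e'$ and $\rho\leftrightarrow\sigma$. Then $T^{(r)}$ is a stress-energy tensor for the helicities $\pm r$: (1) The string integrals converge; $A^{(r)}(x,e)$ and $T^{(r)}_{\rho\sigma}(x,e,e')$ are smooth in $x$ and in the spacelike $e,e'$; and for all spacelike $e,e'$ one has $T^{(r)}_{\rho\sigma}=T^{(r)}_{\sigma\rho}$ and $\partial^\rho T^{(r)}_{\rho\sigma}=0$.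 (2) In the sense of distributions in $e,e'$, i.e. after averaging each of the two string directions with an arbitrary test function $c(e)$, $c'(e')$ supported in the spacelike directions, the following integrals converge absolutely at every time $t$, and $$\int_{x^0=t}d^3\vec x\;T^{(r)}_{0\sigma}=P^{(r)}_\sigma,\qquad \int_{x^0=t}d^3\vec x\,\big(x_\sigma T^{(r)}_{0\tau}-x_\tau T^{(r)}_{0\sigma}\big)=M^{(r)}_{\sigma\tau},$$ where $$P^{(r)}_\sigma=(-1)^r\int d^3\vec x\Big[-\tfrac14A^{(r)}_{\mu\times}(x,e)\overset{\leftrightarrow}{\partial_0}\overset{\leftrightarrow}{\partial_\sigma}A^{(r)\mu\times}(x,e')\Big],$$ $$M^{(r)}_{\sigma\tau}=(-1)^r\int d^3\vec x\Big[-\tfrac14x_\sigma A^{(r)}_{\mu\times}(x,e)\overset{\leftrightarrow}{\partial_0}\overset{\leftrightarrow}{\partial_\tau}A^{(r)\mu\times}(x,e')-\tfrac r2A^{(r)}_{\sigma\times}(x,e)\overset{\leftrightarrow}{\partial_0}A^{(r)}_\tau{}^{\times}(x,e')\Big]-(\sigma\leftrightarrow\tau).$$ Moreover, these are the Poincaré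 generators: they equal $\int c\cdot\int c'$ times the second quantizations of the one-particle generators $p_\sigma$, respectively $i(p_\sigma\partial_{p^\tau}-p_\tau\partial_{p^\sigma})$ plus the spin part, which maps $\varphi_{\mu_1\dots\mu_r}$ to $i\sum_i\big(\eta_{\sigma\mu_i}\varphi_{\dots\tau\dots}-\eta_{\tau\mu_i}\varphi_{\dots\sigma\dots}\big)$; in particular they do not depend on $t$ and depend on $c,c'$ only through $\int c\cdot\int c'$. Hence there are string-localized massless stress-energy tensors for every helicity $r\ge1$. -/

import Mathlib

open MeasureTheory Set
open scoped ContDiff ComplexConjugate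

noncomputable section

namespace StringField

/-! ### Minkowski space, signature `(+,-,-,-)` -/

/-- Minkowski spacetime; the coordinates are the contravariant ones, `x 0` is the time. -/
abbrev Spacetime := Fin 4 → ℝ

/-- Euclidean three-space, used both for positions and for momenta. -/
abbrev Space := EuclideanSpace ℝ (Fin 3)

/-- The diagonal entry `η_{μμ} = η^{μμ}` of the metric. -/
def metric (μ : Fin 4) : ℝ := if μ = 0 then 1 else -1

/-- The Minkowski product `x · y`. -/
def minkowski (x y : Spacetime) : ℝ := ∑ μ, metric μ * x μ * y μ

/-- The covariant component `x_μ = η_{μμ} x^μ`. -/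
def lower (x : Spacetime) (μ : Fin 4) : ℝ := metric μ * x μ

/-- The matrix `η_{μν}`. -/
def eta (μ ν : Fin 4) : ℝ := if μ = ν then metric μ else 0

/-- The four-vector with time component `t` and space part `x`. -/
def fourVector (t : ℝ) (x : Space) : Spacetime := Fin.cons t (fun i => x i)

/-- The point of the forward light cone over the three-momentum `p`. -/
def onShell (p : Space) : Spacetime := fourVector ‖p‖ p

/-- The density of the invariant measure `d³p / ((2π)³ 2|p|)` of the forward light cone. -/
def invariantDensity (p : Space) : ℝ := ((2 * Real.pi) ^ 3 * (2 * ‖p‖))⁻¹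

/-- Multi-indices `(μ₁, …, μ_r)` of rank-`r` tensors. -/
abbrev Index (r : ℕ) := Fin r → Fin 4

/-- The sign `η^{μ₁μ₁} ⋯ η^{μ_rμ_r}` by which the indices of a covariant tensor are raised. -/
def raise {r : ℕ} (μ : Index r) : ℝ := ∏ i, metric (μ i)

/-! ### The one-particle space of the helicities `± r` -/

/-- Smooth one-particle vectors of the massless Wigner representation with helicities `± r`,
realised as symmetric, transverse, traceless (covariant) tensor functions on the light cone,
smooth and compactly supported away from the tip. Two such functions which differ by a
longitudinal tensor (symmetrisation of `p_μ χ`) are the same vector: their difference is a null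
vector of the (positive semidefinite) scalar product below. -/
@[ext]
structure WaveFunction (r : ℕ) where
  toFun : Space → Index r → ℂ
  smooth : ContDiff ℝ ∞ toFun
  compact : HasCompactSupport toFun
  off_tip : (0 : Space) ∉ tsupport toFun
  symm : ∀ (p : Space) (π : Equiv.Perm (Fin r)) (μ : Index r), toFun p (μ ∘ π) = toFun p μ
  transverse : ∀ (p : Space) (i : Fin r) (μ : Index r),
    ∑ κ, (onShell p κ : ℂ) * toFun p (Function.update μ i κ) = 0
  traceless : ∀ (p : Space) (i j : Fin r), i ≠ j → ∀ μ : Index r,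
    ∑ κ, (metric κ : ℂ) * toFun p (Function.update (Function.update μ i κ) j κ) = 0

variable {r : ℕ}

/-- The scalar product of the one-particle space, antilinear in the first argument. -/
def oneParticleInner (φ ψ : WaveFunction r) : ℂ :=
  (-1) ^ r * ∫ p : Space, (invariantDensity p : ℂ) *
    ∑ μ : Index r, (raise μ : ℂ) * (conj (φ.toFun p μ) * ψ.toFun p μ)

/-! #### The Poincaré generators on the one-particle space -/

lemma tsupport_sub_of_zero {φ : WaveFunction r} {f : Space → Index r → ℂ}
    (hf : ∀ p, p ∉ tsupport φ.toFun → f p = 0) : tsupport f ⊆ tsupport φ.toFun := by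
  refine closure_minimal ?_ (isClosed_tsupport _)
  intro p hp
  by_contra h
  exact hp (hf p h)

lemma contDiff_of_zero {φ : WaveFunction r} {f : Space → Index r → ℂ}
    (hf : ∀ p, p ∉ tsupport φ.toFun → f p = 0)
    (hs : ∀ p, p ≠ 0 → ContDiffAt ℝ ∞ f p) : ContDiff ℝ ∞ f := by
  rw [contDiff_iff_contDiffAt]
  intro p
  by_cases hp : p ∈ tsupport φ.toFun
  · exact hs p (fun h => φ.off_tip (h ▸ hp))
  · have : f =ᶠ[nhds p] fun _ => 0 := by
      filter_upwards [(isClosed_tsupport φ.toFun).isOpen_compl.mem_nhds hp] with q hq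
      exact hf q hq
    exact contDiffAt_const.congr_of_eventuallyEq this

lemma contDiffAt_onShell (κ : Fin 4) {p : Space} (hp : p ≠ 0) :
    ContDiffAt ℝ ∞ (fun q : Space => onShell q κ) p := by
  refine Fin.cases ?_ (fun j => ?_) κ
  · exact contDiffAt_norm ℝ hp
  · simp only [onShell, fourVector, Fin.cons_succ]
    fun_prop

/-- Multiplication by the covariant component `p_σ` of the four-momentum: the one-particle
generator of the translations. -/
def momentum (σ : Fin 4) (φ : WaveFunction r) : WaveFunction r where
  toFun p μ := (lower (onShell p) σ : ℂ) * φ.toFun p μ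
  smooth := by
    refine contDiff_of_zero (φ := φ) (fun p hp => ?_) (fun p hp => ?_)
    · ext μ
      simp [image_eq_zero_of_notMem_tsupport hp]
    · rw [contDiffAt_pi]
      intro μ
      have h1 := (contDiffAt_onShell σ hp).const_smul (metric σ)
      have h2 := (contDiff_pi.1 φ.smooth μ).contDiffAt (x := p)
      exact (Complex.ofRealCLM.contDiff.contDiffAt.comp p h1).mul h2
  compact := φ.compact.of_isClosed_subset (isClosed_tsupport _)
    (tsupport_sub_of_zero (fun p hp => by
      ext μ
      simp [image_eq_zero_of_notMem_tsupport hp]))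
  off_tip := fun h => φ.off_tip (tsupport_sub_of_zero (φ := φ) (fun p hp => by
      ext μ
      simp [image_eq_zero_of_notMem_tsupport hp]) h)
  symm p π μ := by rw [φ.symm]
  transverse p i μ := by
    have := φ.transverse p i μ
    simp only [mul_left_comm _ (lower (onShell p) σ : ℂ)]
    rw [← Finset.mul_sum, this, mul_zero]
  traceless p i j hij μ := by
    have := φ.traceless p i j hij μ
    simp only [mul_left_comm _ (lower (onShell p) σ : ℂ)]
    rw [← Finset.mul_sum, this, mul_zero]

/-- The derivative `∂φ_μ/∂p^τ` of a wave function, which depends on the space part of the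
momentum only (so that it vanishes for `τ = 0`). -/
def momentumDeriv (φ : WaveFunction r) (τ : Fin 4) (p : Space) (μ : Index r) : ℂ :=
  Fin.cases 0 (fun j => fderiv ℝ (fun q => φ.toFun q μ) p (EuclideanSpace.single j 1)) τ

/-- The action of the Lorentz generator `M_{στ}` on tensor wave functions,
`i (p_σ ∂/∂p^τ - p_τ ∂/∂p^σ) φ_{μ₁…μ_r} + i ∑ᵢ (η_{σμᵢ} φ_{…τ…} - η_{τμᵢ} φ_{…σ…})`
with `τ` resp. `σ` in the place of `μᵢ`. The differential operator is tangent to the cone. -/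
def lorentzFun (σ τ : Fin 4) (φ : WaveFunction r) (p : Space) (μ : Index r) : ℂ :=
  Complex.I *
    ((lower (onShell p) σ : ℂ) * momentumDeriv φ τ p μ
      - (lower (onShell p) τ : ℂ) * momentumDeriv φ σ p μ
      + ∑ i, ((eta σ (μ i) : ℂ) * φ.toFun p (Function.update μ i τ)
          - (eta τ (μ i) : ℂ) * φ.toFun p (Function.update μ i σ)))

lemma metric_mul_self (κ : Fin 4) : metric κ * metric κ = 1 := by
  unfold metric; split_ifs <;> norm_num

lemma fun_zero {φ : WaveFunction r} {p : Space} (hp : p ∉ tsupport φ.toFun) :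
    φ.toFun p = 0 := image_eq_zero_of_notMem_tsupport hp

lemma differentiable_comp (φ : WaveFunction r) (μ : Index r) :
    Differentiable ℝ (fun q => φ.toFun q μ) :=
  (contDiff_pi.1 φ.smooth μ).differentiable (by simp)

lemma momentumDeriv_zero {φ : WaveFunction r} {p : Space} (hp : p ∉ tsupport φ.toFun)
    (τ : Fin 4) (μ : Index r) : momentumDeriv φ τ p μ = 0 := by
  refine Fin.cases rfl (fun j => ?_) τ
  have : (fun q => φ.toFun q μ) =ᶠ[nhds p] fun _ => 0 := by
    filter_upwards [(isClosed_tsupport φ.toFun).isOpen_compl.mem_nhds hp] with q hq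
    rw [fun_zero hq]; rfl
  simp [momentumDeriv, this.fderiv_eq]

lemma lorentzFun_zero {φ : WaveFunction r} (σ τ : Fin 4) {p : Space}
    (hp : p ∉ tsupport φ.toFun) : lorentzFun σ τ φ p = 0 := by
  ext μ
  simp [lorentzFun, momentumDeriv_zero hp, fun_zero hp]

lemma contDiff_momentumDeriv (φ : WaveFunction r) (τ : Fin 4) (μ : Index r) :
    ContDiff ℝ ∞ (fun p => momentumDeriv φ τ p μ) := by
  refine Fin.cases ?_ (fun j => ?_) τ
  · exact contDiff_const
  · have h : ContDiff ℝ ∞ (fun q => φ.toFun q μ) := contDiff_pi.1 φ.smooth μ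
    exact (h.fderiv_right (m := ∞) (by simp)).clm_apply contDiff_const

lemma contDiffAt_lower (κ : Fin 4) {p : Space} (hp : p ≠ 0) :
    ContDiffAt ℝ ∞ (fun q : Space => (lower (onShell q) κ : ℂ)) p :=
  Complex.ofRealCLM.contDiff.contDiffAt.comp p
    ((contDiffAt_onShell κ hp).const_smul (metric κ))

lemma momentumDeriv_sum (φ : WaveFunction r) (ι : Fin 4 → Index r)
    (h : ∀ q, ∑ κ, (metric κ : ℂ) * φ.toFun q (ι κ) = 0) (τ : Fin 4) (p : Space) :
    ∑ κ, (metric κ : ℂ) * momentumDeriv φ τ p (ι κ) = 0 := by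
  refine Fin.cases (by simp [momentumDeriv]) (fun j => ?_) τ
  have h2 : HasFDerivAt (fun q => ∑ κ, (metric κ : ℂ) * φ.toFun q (ι κ))
      (∑ κ, (metric κ : ℂ) • fderiv ℝ (fun q => φ.toFun q (ι κ)) p) p :=
    HasFDerivAt.fun_sum fun κ _ =>
      ((differentiable_comp φ (ι κ)).differentiableAt.hasFDerivAt).const_mul _
  have h3 : HasFDerivAt (fun q => ∑ κ, (metric κ : ℂ) * φ.toFun q (ι κ))
      (0 : Space →L[ℝ] ℂ) p := by
    simp only [h]; exact hasFDerivAt_const _ _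
  have h4 := congrArg (fun L : Space →L[ℝ] ℂ => L (EuclideanSpace.single j 1)) (h2.unique h3)
  simpa [momentumDeriv] using h4

lemma hasFDerivAt_onShell_apply (κ : Fin 4) {p : Space} (hp : p ≠ 0) (j : Fin 3) :
    ∃ L : Space →L[ℝ] ℂ, HasFDerivAt (fun q : Space => (onShell q κ : ℂ)) L p ∧
      L (EuclideanSpace.single j 1) =
        (if κ = j.succ then 1 else 0) + (if κ = 0 then ((p j / ‖p‖ : ℝ) : ℂ) else 0) := by
  refine Fin.cases ?_ (fun k => ?_) κ
  · have h := (hasStrictFDerivAt_norm_sq p).hasFDerivAt.sqrt (by simpa using hp)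
    simp only [Real.sqrt_sq (norm_nonneg _)] at h
    refine ⟨_, Complex.ofRealCLM.hasFDerivAt.comp p h, ?_⟩
    have : (0 : Fin 4) ≠ j.succ := (Fin.succ_ne_zero j).symm
    simp [this, EuclideanSpace.inner_single_right]
    field_simp
  · have h : HasFDerivAt (fun q : Space => q k) (EuclideanSpace.proj k : Space →L[ℝ] ℝ) p :=
      (EuclideanSpace.proj k : Space →L[ℝ] ℝ).hasFDerivAt
    refine ⟨_, Complex.ofRealCLM.hasFDerivAt.comp p h, ?_⟩
    simp only [Fin.succ_inj, Fin.succ_ne_zero]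
    simp [apply_ite (fun x : ℝ => (x : ℂ))]

lemma momentumDeriv_transverse (φ : WaveFunction r) (ι : Fin 4 → Index r)
    (h : ∀ q, ∑ κ, (onShell q κ : ℂ) * φ.toFun q (ι κ) = 0) (τ : Fin 4) {p : Space}
    (hp : p ≠ 0) :
    ∑ κ, (onShell p κ : ℂ) * momentumDeriv φ τ p (ι κ) =
      -(φ.toFun p (ι τ) - (lower (onShell p) τ : ℂ) / (‖p‖ : ℂ) * φ.toFun p (ι 0)) := by
  have hp' : (‖p‖ : ℂ) ≠ 0 := by simpa using hp
  refine Fin.cases ?_ (fun j => ?_) τ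
  · simp [momentumDeriv, lower, metric, onShell, fourVector, hp']
  choose L hL hL1 using fun κ => hasFDerivAt_onShell_apply κ hp j
  have h2 := HasFDerivAt.fun_sum (u := Finset.univ) fun κ _ =>
      (hL κ).mul ((differentiable_comp φ (ι κ)).differentiableAt.hasFDerivAt (x := p))
  have h3 : HasFDerivAt (fun q => ∑ κ, (onShell q κ : ℂ) * φ.toFun q (ι κ))
      (0 : Space →L[ℝ] ℂ) p := by
    simp only [h]; exact hasFDerivAt_const _ _
  have h4 := congrArg (fun L : Space →L[ℝ] ℂ => L (EuclideanSpace.single j 1)) (h2.unique h3)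
  simp [hL1, Finset.sum_add_distrib, mul_add] at h4
  simp only [momentumDeriv, Fin.cases_succ]
  rw [eq_neg_iff_add_eq_zero, ← h4]
  simp [lower, metric, onShell, fourVector]
  ring

/-- The Lorentz generator `M_{στ}` on the one-particle space. -/
def lorentz (σ τ : Fin 4) (φ : WaveFunction r) : WaveFunction r where
  toFun := lorentzFun σ τ φ
  smooth := by
    refine contDiff_of_zero (φ := φ) (fun p hp => lorentzFun_zero σ τ hp) (fun p hp => ?_)
    rw [contDiffAt_pi]
    intro μ
    have h0 : ∀ ν, ContDiffAt ℝ ∞ (fun q => φ.toFun q ν) p := fun ν =>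
      (contDiff_pi.1 φ.smooth ν).contDiffAt
    have h1 := fun κ => contDiffAt_lower κ hp
    have h2 := fun κ => (contDiff_momentumDeriv φ κ μ).contDiffAt (x := p)
    refine contDiffAt_const.mul (((h1 σ).mul (h2 τ)).sub ((h1 τ).mul (h2 σ)) |>.add ?_)
    exact ContDiffAt.sum fun i _ =>
      (contDiffAt_const.mul (h0 _)).sub (contDiffAt_const.mul (h0 _))
  compact := φ.compact.of_isClosed_subset (isClosed_tsupport _)
    (tsupport_sub_of_zero (fun p hp => lorentzFun_zero σ τ hp))
  off_tip := fun h => φ.off_tip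
    (tsupport_sub_of_zero (φ := φ) (fun p hp => lorentzFun_zero σ τ hp) h)
  symm p π μ := by
    have hD : ∀ κ, momentumDeriv φ κ p (μ ∘ π) = momentumDeriv φ κ p μ := fun κ => by
      simp only [momentumDeriv, φ.symm]
    have hu : ∀ κ i, Function.update (μ ∘ π) i κ = Function.update μ (π i) κ ∘ π := fun κ i =>
      (Function.update_comp_eq_of_injective μ π.injective i κ).symm
    simp only [lorentzFun, hD, hu, φ.symm, Function.comp_apply]
    congr 2
    exact Equiv.sum_comp π (fun i => (eta σ (μ i) : ℂ) * φ.toFun p (Function.update μ i τ)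
          - (eta τ (μ i) : ℂ) * φ.toFun p (Function.update μ i σ))
  transverse p i μ := by
    by_cases hp : p = 0
    · subst hp
      simp [lorentzFun_zero σ τ φ.off_tip]
    have hD := fun κ => momentumDeriv_transverse φ (fun κ => Function.update μ i κ)
      (fun q => φ.transverse q i μ) κ hp
    have hS : ∀ l, ∑ κ, (onShell p κ : ℂ) *
        ((eta σ (Function.update μ i κ l) : ℂ) *
            φ.toFun p (Function.update (Function.update μ i κ) l τ)
          - (eta τ (Function.update μ i κ l) : ℂ) *
            φ.toFun p (Function.update (Function.update μ i κ) l σ)) =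
        if l = i then (lower (onShell p) σ : ℂ) * φ.toFun p (Function.update μ i τ)
          - (lower (onShell p) τ : ℂ) * φ.toFun p (Function.update μ i σ) else 0 := by
      intro l
      by_cases hl : l = i
      · subst hl
        simp only [Function.update_self, Function.update_idem, if_true, eta, mul_sub,
          Finset.sum_sub_distrib, apply_ite (fun x : ℝ => (x : ℂ)), Complex.ofReal_zero,
          ite_mul, zero_mul, mul_ite, mul_zero, Finset.sum_ite_eq, Finset.mem_univ, lower,
          Complex.ofReal_mul]
        ring
      · have h1 := fun ν => φ.transverse p i (Function.update μ l ν)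
        simp only [Function.update_of_ne hl, Function.update_comm (Ne.symm hl), if_neg hl, mul_sub,
          Finset.sum_sub_distrib, mul_left_comm (onShell p _ : ℂ)]
        simp only [Function.update_comm hl] at h1
        rw [← Finset.mul_sum, ← Finset.mul_sum]
        simp only [Function.update_comm hl, h1]
        simp
    have hT : ∑ l, ∑ κ, (onShell p κ : ℂ) *
        ((eta σ (Function.update μ i κ l) : ℂ) *
            φ.toFun p (Function.update (Function.update μ i κ) l τ)
          - (eta τ (Function.update μ i κ l) : ℂ) *
            φ.toFun p (Function.update (Function.update μ i κ) l σ)) =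
        (lower (onShell p) σ : ℂ) * φ.toFun p (Function.update μ i τ)
          - (lower (onShell p) τ : ℂ) * φ.toFun p (Function.update μ i σ) := by
      simp only [hS, Finset.sum_ite_eq', Finset.mem_univ, if_true]
    rw [Finset.sum_comm] at hT
    simp only [← Finset.mul_sum] at hT
    have hp' : (‖p‖ : ℂ) ≠ 0 := by simpa using hp
    calc _ = Complex.I * ((lower (onShell p) σ : ℂ) *
            (∑ κ, (onShell p κ : ℂ) * momentumDeriv φ τ p (Function.update μ i κ))
          - (lower (onShell p) τ : ℂ) *
            (∑ κ, (onShell p κ : ℂ) * momentumDeriv φ σ p (Function.update μ i κ))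
          + ((lower (onShell p) σ : ℂ) * φ.toFun p (Function.update μ i τ)
          - (lower (onShell p) τ : ℂ) * φ.toFun p (Function.update μ i σ))) := by
            rw [← hT]
            simp only [lorentzFun, Finset.mul_sum, ← Finset.sum_sub_distrib,
              ← Finset.sum_add_distrib]
            refine Finset.sum_congr rfl fun κ _ => ?_
            simp only [← Finset.mul_sum]
            ring
      _ = 0 := by
            rw [hD τ, hD σ]
            field_simp
            ring
  traceless p i j hij μ := by
    have hD := fun κ => momentumDeriv_sum φ
      (fun κ => Function.update (Function.update μ i κ) j κ) (fun q => φ.traceless q i j hij μ) κ p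
    have hS : ∀ l, ∑ κ, (metric κ : ℂ) *
        ((eta σ (Function.update (Function.update μ i κ) j κ l) : ℂ) *
            φ.toFun p (Function.update (Function.update (Function.update μ i κ) j κ) l τ)
          - (eta τ (Function.update (Function.update μ i κ) j κ l) : ℂ) *
            φ.toFun p (Function.update (Function.update (Function.update μ i κ) j κ) l σ)) =
        (if l = i then φ.toFun p (Function.update (Function.update μ i τ) j σ)
            - φ.toFun p (Function.update (Function.update μ i σ) j τ) else 0)
        - (if l = j then φ.toFun p (Function.update (Function.update μ i τ) j σ)
            - φ.toFun p (Function.update (Function.update μ i σ) j τ) else 0) := by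
      have hm : ∀ κ : Fin 4, (metric κ : ℂ) * metric κ = 1 := fun κ => by
        exact_mod_cast metric_mul_self κ
      intro l
      by_cases hl : l = i
      · subst hl
        simp only [Function.update_of_ne hij, Function.update_self,
          Function.update_comm (Ne.symm hij), Function.update_idem, if_true, eta, mul_sub,
          Finset.sum_sub_distrib, apply_ite (fun x : ℝ => (x : ℂ)), Complex.ofReal_zero,
          ite_mul, zero_mul, mul_ite, mul_zero, Finset.sum_ite_eq, Finset.mem_univ, if_neg hij,
          ← mul_assoc, hm, one_mul, sub_zero]
      by_cases hl2 : l = j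
      · subst hl2
        simp only [Function.update_self,
          Function.update_idem, if_true, eta, mul_sub,
          Finset.sum_sub_distrib, apply_ite (fun x : ℝ => (x : ℂ)), Complex.ofReal_zero,
          ite_mul, zero_mul, mul_ite, mul_zero, Finset.sum_ite_eq, Finset.mem_univ, if_neg hl,
          ← mul_assoc, hm, one_mul]
        ring
      · have h1 := fun ν => φ.traceless p i j hij (Function.update μ l ν)
        have h2 : ∀ κ ν, Function.update (Function.update (Function.update μ i κ) j κ) l ν =
            Function.update (Function.update (Function.update μ l ν) i κ) j κ := fun κ ν => by
          rw [Function.update_comm (Ne.symm hl2), Function.update_comm (Ne.symm hl)]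
        simp only [Function.update_of_ne hl, Function.update_of_ne hl2, h2, if_neg hl,
          if_neg hl2, mul_sub, Finset.sum_sub_distrib, mul_left_comm (metric _ : ℂ)]
        rw [← Finset.mul_sum, ← Finset.mul_sum, h1, h1]
        simp
    have hT := Finset.sum_congr (rfl : (Finset.univ : Finset (Fin r)) = _) fun l _ => hS l
    rw [Finset.sum_comm, Finset.sum_sub_distrib] at hT
    simp only [Finset.sum_ite_eq', Finset.mem_univ, if_true, sub_self, ← Finset.mul_sum] at hT
    calc _ = Complex.I * ((lower (onShell p) σ : ℂ) *
            (∑ κ, (metric κ : ℂ) *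
              momentumDeriv φ τ p (Function.update (Function.update μ i κ) j κ))
          - (lower (onShell p) τ : ℂ) *
            (∑ κ, (metric κ : ℂ) *
              momentumDeriv φ σ p (Function.update (Function.update μ i κ) j κ))
          + 0) := by
            rw [← hT]
            simp only [lorentzFun, Finset.mul_sum, ← Finset.sum_sub_distrib,
              ← Finset.sum_add_distrib]
            refine Finset.sum_congr rfl fun κ _ => ?_
            simp only [← Finset.mul_sum]
            ring
      _ = 0 := by rw [hD τ, hD σ]; simp

/-! ### The Fock space -/

/-- Finite-particle vectors of the bosonic Fock space: the polynomial `∑ c φ₁⋯φ_k` stands for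
`∑ c a*(φ₁)⋯a*(φ_k) Ω`. As in the one-particle space, polynomials whose difference is a null
vector of the scalar product `fockInner` below are the same vector. -/
abbrev Fock (r : ℕ) := MvPolynomial (WaveFunction r) ℂ

/-- The annihilation operator belonging to a one-particle functional `f`: the derivation with
`a*(φ) Ω ↦ f(φ) Ω`. For `f = ⟨φ, ·⟩` it is the usual annihilation operator `a(φ)`. -/
def annihilate (f : WaveFunction r → ℂ) : Derivation ℂ (Fock r) (Fock r) :=
  MvPolynomial.mkDerivation ℂ (fun φ => MvPolynomial.C (f φ))

instance annihilate_leftCommutative :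
    LeftCommutative (fun (φ : WaveFunction r) (Ψ : Fock r) =>
      annihilate (oneParticleInner φ) Ψ) where
  left_comm φ ψ Ψ := by
    have h : ⁅annihilate (oneParticleInner φ), annihilate (oneParticleInner ψ)⁆ = 0 := by
      apply MvPolynomial.derivation_ext
      intro χ
      simp [Derivation.commutator_apply, annihilate]
    have h2 := congrArg (fun D : Derivation ℂ (Fock r) (Fock r) => D Ψ) h
    simpa [Derivation.commutator_apply, sub_eq_zero] using h2

/-- The scalar product of the Fock space, antilinear in the first argument:
`⟨a*(φ₁)⋯a*(φ_k) Ω, Φ⟩ = ⟨Ω, a(φ₁)⋯a(φ_k) Φ⟩`. -/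
def fockInner (Ψ Φ : Fock r) : ℂ :=
  ∑ m ∈ Ψ.support, conj (Ψ.coeff m) * MvPolynomial.constantCoeff
    (Multiset.foldr (fun φ Θ => annihilate (oneParticleInner φ) Θ) Φ (Finsupp.toMultiset m))

/-- The second quantisation `dΓ(L)` of a one-particle operator `L`: the derivation with
`a*(φ) Ω ↦ a*(L φ) Ω`. -/
def secondQuantize (L : WaveFunction r → WaveFunction r) : Derivation ℂ (Fock r) (Fock r) :=
  MvPolynomial.mkDerivation ℂ (fun φ => MvPolynomial.X (L φ))

/-- Matrix element `⟨Ψ, :A B: Φ⟩` of the Wick product of the two hermitean fields `A`, `B`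
whose annihilation parts are `annihilate f` and `annihilate g`, and whose creation parts are the
(formal) adjoints of these. -/
def wick (f g : WaveFunction r → ℂ) (Ψ Φ : Fock r) : ℂ :=
  fockInner Ψ (annihilate f (annihilate g Φ)) + fockInner (annihilate f Ψ) (annihilate g Φ)
    + fockInner (annihilate g Ψ) (annihilate f Φ) + fockInner (annihilate f (annihilate g Ψ)) Φ

/-! ### Field strengths and string-localised potentials -/

/-- The one-particle matrix element `⟨Ω, F_{[μ₁ν₁]…[μ_rν_r]}(x) a*(φ) Ω⟩` of the point-localised
field strength, which is the curl of `∫ d³p / ((2π)³ 2|p|) e^{-ipx} φ(p)` in every index. -/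
def fieldStrength (φ : WaveFunction r) (μ ν : Index r) (x : Spacetime) : ℂ :=
  ∫ p : Space, (invariantDensity p : ℂ) *
    Complex.exp (-Complex.I * (minkowski (onShell p) x : ℂ)) *
      ((-Complex.I) ^ r * ∑ S : Finset (Fin r), (-1) ^ S.card *
        (∏ i, (lower (onShell p) (if i ∈ S then ν i else μ i) : ℂ)) *
          φ.toFun p (fun i => if i ∈ S then μ i else ν i))

/-- The string integration `(I_e f)(x) = ∫₀^∞ f(x + s e) ds`. -/
def stringIntegral (e : Spacetime) (f : Spacetime → ℂ) (x : Spacetime) : ℂ :=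
  ∫ s in Ioi (0 : ℝ), f (x + s • e)

/-- The contraction `F_{[μ₁ν₁]…[μ_rν_r]}(x) e^{ν₁}⋯e^{ν_r}`. -/
def contractedFieldStrength (φ : WaveFunction r) (e : Spacetime) (μ : Index r)
    (x : Spacetime) : ℂ :=
  ∑ ν : Index r, fieldStrength φ μ ν x * ∏ i, (e (ν i) : ℂ)

/-- A hermitean scalar field, given by its one-particle matrix elements
`⟨Ω, A(x) a*(φ) Ω⟩`, i.e. by its annihilation part. -/
abbrev Field (r : ℕ) := Spacetime → WaveFunction r → ℂ

/-- The string-localised massless potential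
`A_{μ₁…μ_r}(x,e) = (I_e^r F_{[μ₁ν₁]…[μ_rν_r]})(x) e^{ν₁}⋯e^{ν_r}` of helicity `± r`. -/
def potential (e : Spacetime) (μ : Index r) : Field r := fun x φ =>
  (stringIntegral e)^[r] (contractedFieldStrength φ e μ) x

/-- Spacelike string directions. As `A(x, λ e) = A(x, e)` for `λ > 0`, they need not be
normalised to `e² = -1`. -/
def spacelike : Set Spacetime := {e | minkowski e e < 0}

/-! ### Wick bilinears -/

/-- The partial derivative `∂_μ f = ∂f/∂x^μ`. -/
def partialDeriv (μ : Fin 4) (f : Spacetime → ℂ) (x : Spacetime) : ℂ :=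
  fderiv ℝ f x (Pi.single μ 1)

/-- The field `∂_μ A`. -/
def fieldDeriv (μ : Fin 4) (A : Field r) : Field r := fun x φ =>
  partialDeriv μ (fun y => A y φ) x

/-- Matrix elements of `:A B:(x)`. -/
def wickProduct (A B : Field r) (Ψ Φ : Fock r) (x : Spacetime) : ℂ := wick (A x) (B x) Ψ Φ

/-- Matrix elements of `:A ∂↔_σ B: = :A ∂_σ B: - :∂_σ A B:`. -/
def arrow (σ : Fin 4) (A B : Field r) (Ψ Φ : Fock r) (x : Spacetime) : ℂ :=
  wickProduct A (fieldDeriv σ B) Ψ Φ x - wickProduct (fieldDeriv σ A) B Ψ Φ x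

/-- Matrix elements of `:A ∂↔_ρ ∂↔_σ B:`. -/
def arrowArrow (ρ σ : Fin 4) (A B : Field r) (Ψ Φ : Fock r) (x : Spacetime) : ℂ :=
  wickProduct A (fieldDeriv ρ (fieldDeriv σ B)) Ψ Φ x
    - wickProduct (fieldDeriv ρ A) (fieldDeriv σ B) Ψ Φ x
    - wickProduct (fieldDeriv σ A) (fieldDeriv ρ B) Ψ Φ x
    + wickProduct (fieldDeriv ρ (fieldDeriv σ A)) B Ψ Φ x

/-! ### The stress-energy tensor and the generators, for helicity `r = n + 1` -/

variable {n : ℕ}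

/-- `A_{μ×}(x,e) ∂↔_ρ ∂↔_σ A^{μ×}(x,e')`, contracted in all `n + 1` indices. -/
def fullBilinear (e e' : Spacetime) (ρ σ : Fin 4) (Ψ Φ : Fock (n + 1)) (x : Spacetime) : ℂ :=
  ∑ μ : Index (n + 1), (raise μ : ℂ) *
    arrowArrow ρ σ (potential e μ) (potential e' μ) Ψ Φ x

/-- `A_{α×}(x,e) ∂↔_σ A_β^×(x,e')`, contracted in the last `n` indices. -/
def openBilinear (e e' : Spacetime) (α β σ : Fin 4) (Ψ Φ : Fock (n + 1)) (x : Spacetime) : ℂ :=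
  ∑ ν : Index n, (raise ν : ℂ) *
    arrow σ (potential e (Fin.cons α ν : Index (n + 1)))
      (potential e' (Fin.cons β ν : Index (n + 1))) Ψ Φ x

/-- The matrix elements `⟨Ψ, T_{ρσ}(x,e,e') Φ⟩` of the string-localised massless stress-energy
tensor of helicity `r = n + 1`,
`(-1)^r [ -1/4 A_{μ×}(x,e) ∂↔_ρ ∂↔_σ A^{μ×}(x,e')
  - r/4 ∂^μ ( A_{ρ×}(x,e) ∂↔_σ A_μ^×(x,e') + (e ↔ e') + (ρ ↔ σ) ) ]`,
where the bracket is symmetrised in both pairs, so that it has four terms. -/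
def stressTensor (e e' : Spacetime) (ρ σ : Fin 4) (Ψ Φ : Fock (n + 1)) (x : Spacetime) : ℂ :=
  (-1) ^ (n + 1) * (-(1 / 4) * fullBilinear e e' ρ σ Ψ Φ x
    - ((n + 1 : ℕ) : ℂ) / 4 * ∑ κ, (metric κ : ℂ) * partialDeriv κ (fun y =>
        openBilinear e e' ρ κ σ Ψ Φ y + openBilinear e' e ρ κ σ Ψ Φ y
          + openBilinear e e' σ κ ρ Ψ Φ y + openBilinear e' e σ κ ρ Ψ Φ y) x)

/-- The density `(-1)^r [ -1/4 A_{μ×}(x,e) ∂↔_0 ∂↔_σ A^{μ×}(x,e') ]` of `P_σ`. -/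
def momentumDensity (e e' : Spacetime) (σ : Fin 4) (Ψ Φ : Fock (n + 1)) (x : Spacetime) : ℂ :=
  (-1) ^ (n + 1) * (-(1 / 4) * fullBilinear e e' 0 σ Ψ Φ x)

/-- The density
`(-1)^r [ -1/4 x_σ A_{μ×}(x,e) ∂↔_0 ∂↔_τ A^{μ×}(x,e') - r/2 A_{σ×}(x,e) ∂↔_0 A_τ^×(x,e') ]
  - (σ ↔ τ)` of `M_{στ}`. -/
def lorentzDensity (e e' : Spacetime) (σ τ : Fin 4) (Ψ Φ : Fock (n + 1)) (x : Spacetime) : ℂ :=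
  (-1) ^ (n + 1) *
    ((-(1 / 4) * (lower x σ : ℂ) * fullBilinear e e' 0 τ Ψ Φ x
        - ((n + 1 : ℕ) : ℂ) / 2 * openBilinear e e' σ τ 0 Ψ Φ x)
      - (-(1 / 4) * (lower x τ : ℂ) * fullBilinear e e' 0 σ Ψ Φ x
        - ((n + 1 : ℕ) : ℂ) / 2 * openBilinear e e' τ σ 0 Ψ Φ x))

/-! ### Averaging over the string directions -/

/-- Test functions on the set of spacelike string directions. -/
def IsStringTest (c : Spacetime → ℂ) : Prop :=
  ContDiff ℝ ∞ c ∧ HasCompactSupport c ∧ tsupport c ⊆ spacelike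

/-- The average `∫∫ c(e) c'(e') G(e,e') d⁴e d⁴e'` over the string directions. -/
def average (c c' : Spacetime → ℂ) (G : Spacetime → Spacetime → ℂ) : ℂ :=
  ∫ e, ∫ e', c e * c' e' * G e e'

/-- The matrix elements of `T_{ρσ}(x, c, c') = ∫∫ c(e) c'(e') T_{ρσ}(x,e,e')`. -/
def averagedStressTensor (c c' : Spacetime → ℂ) (ρ σ : Fin 4) (Ψ Φ : Fock (n + 1))
    (x : Spacetime) : ℂ :=
  average c c' (fun e e' => stressTensor e e' ρ σ Ψ Φ x)

/-- The averaged density of `P_σ`. -/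
def averagedMomentumDensity (c c' : Spacetime → ℂ) (σ : Fin 4) (Ψ Φ : Fock (n + 1))
    (x : Spacetime) : ℂ :=
  average c c' (fun e e' => momentumDensity e e' σ Ψ Φ x)

/-- The averaged density of `M_{στ}`. -/
def averagedLorentzDensity (c c' : Spacetime → ℂ) (σ τ : Fin 4) (Ψ Φ : Fock (n + 1))
    (x : Spacetime) : ℂ :=
  average c c' (fun e e' => lorentzDensity e e' σ τ Ψ Φ x)

end StringField

end

open StringField

/-!
The proof reduces every matrix element to integrals over the light cone.

In a one-particle vector the field strength is a wave packet `∫ K(p) e^{-ipx} d³p` whose amplitude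
`K` is smooth and compactly supported away from the tip of the cone. Integration by parts on the
cone exchanges multiplication by `x` with differentiation of `K`; iterated, this makes wave packets
decrease rapidly in spacelike directions, locally uniformly (`IsAmplitude.rapidDecayOn`). Hence the
moments `∫₀^∞ sᵐ W(x + s e) ds` of a wave packet `W` converge and are smooth in `(x, e)`, and the
`n + 1`-fold string integral is the moment with `m = n` divided by `n!` (`iterate_stringIntegral`).

A matrix element of a Wick product between polynomial Fock vectors is a finite combination of
products of one-particle matrix elements and their conjugates (`wick_eq_indices`). The
stress-energy tensor thus becomes a combination of values of one explicit bilinear form in the jets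
of two tensor fields which solve the wave equation (`stressTensor_eq`). The form is symmetric, and
it is conserved: the first term by the wave equation, and the improvement term because, after the
symmetrisation in the two strings, it is a divergence of currents which are antisymmetric in two
indices and conserved in the third (`jetStress_symm`, `IsWaveJet.sum_stressD`).

Averaging the string direction with `c` replaces `e^{-is p·e}` by the Fourier transform of `c` at
`s p`, so the averaged potential is again a wave packet whose amplitude is smooth away from the tip
(`integral_mul_potentialJet`); in particular all densities are integrable over time slices. There
the improvement term does not contribute to the momentum, being a sum of spatial derivatives
(`integral_jetImprovement`), while in its first moments these derivatives hit the coordinates and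
leave the spin term of the Lorentz generators (`integral_moment_jetImprovement`). Plancherel's
theorem evaluates what remains in momentum space: two parts of equal frequency contribute nothing
(`integral_jetMomentum_same`, `integral_jetLorentz_same`), and each of the two orderings of opposite
frequencies contributes half of a matrix element of the one-particle generator
(`integral_jetMomentum_opposite`, `integral_jetLorentz_opposite`).

Finally, the averaged amplitude is `(∫ c) φ` plus terms with a factor `p_{μᵢ}` (`stringTerm_univ`,
`exists_isLongitudinal_stringTerm`). It is transverse and symmetric, the generators map
longitudinal tensors to longitudinal ones (`isLongitudinal_lorentzOp`), and these are orthogonal to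
transverse tensors. So only `(∫ c) (∫ c') ⟨φ, L ψ⟩` survives (`pairing_eq_oneParticleInner`).
-/

open MeasureTheory Set
open scoped ContDiff ComplexConjugate

noncomputable section

namespace StringField

section

/-! ### Fock space: Wick products and second quantisations in terms of one-particle data -/

section FockSpace

variable {r : ℕ}

lemma annihilate_X (f : WaveFunction r → ℂ) (φ : WaveFunction r) :
    annihilate f (MvPolynomial.X φ) = MvPolynomial.C (f φ) :=
  MvPolynomial.mkDerivation_X _ _ _

/-- The iterated annihilation `Φ ↦ ⟨Ω, a(φ₁)⋯a(φ_k) Φ⟩` in the definition of `fockInner`. -/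
def annihilateAll (m : WaveFunction r →₀ ℕ) : Fock r →ₗ[ℂ] ℂ where
  toFun Φ := MvPolynomial.constantCoeff
    (Multiset.foldr (fun φ Θ => annihilate (oneParticleInner φ) Θ) Φ (Finsupp.toMultiset m))
  map_add' Φ Θ := by
    rw [← map_add]
    congr 1
    refine Multiset.induction_on (Finsupp.toMultiset m) (by simp) fun a s ih => ?_
    simp only [Multiset.foldr_cons, ih, map_add]
  map_smul' c Φ := by
    have : Multiset.foldr (fun φ Θ => annihilate (oneParticleInner φ) Θ) (c • Φ)
        (Finsupp.toMultiset m) = c • Multiset.foldr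
          (fun φ Θ => annihilate (oneParticleInner φ) Θ) Φ (Finsupp.toMultiset m) := by
      refine Multiset.induction_on (Finsupp.toMultiset m) (by simp) fun a s ih => ?_
      simp only [Multiset.foldr_cons, ih, Derivation.map_smul]
    rw [this, MvPolynomial.smul_eq_C_mul]
    simp

lemma annihilateAll_zero (Φ : Fock r) :
    annihilateAll 0 Φ = MvPolynomial.constantCoeff Φ := by
  simp [annihilateAll]

/-- The scalar product of the Fock space is linear in its second argument. -/
def fockInnerLinear (Ψ : Fock r) : Fock r →ₗ[ℂ] ℂ :=
  ∑ m ∈ Ψ.support, conj (Ψ.coeff m) • annihilateAll m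

lemma fockInner_eq_linear (Ψ Φ : Fock r) : fockInner Ψ Φ = fockInnerLinear Ψ Φ := by
  simp [fockInner, fockInnerLinear, LinearMap.sum_apply, annihilateAll]

lemma fockInner_eq_finsuppSum (Ψ Φ : Fock r) :
    fockInner Ψ Φ = Finsupp.sum (M := ℂ) (AddMonoidAlgebra.coeff Ψ)
      fun m c => conj c * annihilateAll m Φ := rfl

lemma fockInner_add_left (Ψ Ψ' Φ : Fock r) :
    fockInner (Ψ + Ψ') Φ = fockInner Ψ Φ + fockInner Ψ' Φ := by
  simp only [fockInner_eq_finsuppSum]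
  exact Finsupp.sum_add_index' (by simp) (by simp [add_mul])

lemma fockInner_monomial (m : WaveFunction r →₀ ℕ) (c : ℂ) (Φ : Fock r) :
    fockInner (MvPolynomial.monomial m c) Φ = conj c * annihilateAll m Φ := by
  simp only [fockInner_eq_finsuppSum]
  exact Finsupp.sum_single_index (by simp)

lemma fockInner_zero_left (Φ : Fock r) : fockInner 0 Φ = 0 := by simp [fockInner]

lemma fockInner_C_mul_left (c : ℂ) (Ψ Φ : Fock r) :
    fockInner (MvPolynomial.C c * Ψ) Φ = conj c * fockInner Ψ Φ := by
  induction Ψ using MvPolynomial.induction_on' with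
  | monomial m a => rw [MvPolynomial.C_mul_monomial, fockInner_monomial, fockInner_monomial,
      map_mul, mul_assoc]
  | add p q hp hq => rw [mul_add, fockInner_add_left, fockInner_add_left, hp, hq, mul_add]

lemma fockInner_sum_left {ι : Type*} (s : Finset ι) (Ψ : ι → Fock r) (Φ : Fock r) :
    fockInner (∑ i ∈ s, Ψ i) Φ = ∑ i ∈ s, fockInner (Ψ i) Φ := by
  classical
  induction s using Finset.induction_on with
  | empty => simp [fockInner_zero_left]
  | insert a s ha ih => rw [Finset.sum_insert ha, Finset.sum_insert ha, fockInner_add_left, ih]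

lemma fockInner_add_right (Ψ Φ Φ' : Fock r) :
    fockInner Ψ (Φ + Φ') = fockInner Ψ Φ + fockInner Ψ Φ' := by
  simp only [fockInner_eq_linear, map_add]

lemma fockInner_C_mul_right (c : ℂ) (Ψ Φ : Fock r) :
    fockInner Ψ (MvPolynomial.C c * Φ) = c * fockInner Ψ Φ := by
  simp only [fockInner_eq_linear, ← MvPolynomial.smul_eq_C_mul, map_smul, smul_eq_mul]

lemma fockInner_sum_right {ι : Type*} (s : Finset ι) (Ψ : Fock r) (Φ : ι → Fock r) :
    fockInner Ψ (∑ i ∈ s, Φ i) = ∑ i ∈ s, fockInner Ψ (Φ i) := by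
  simp only [fockInner_eq_linear, map_sum]

/-- `a*(φ)` is the adjoint of `a(φ)`, the creator being on the left. -/
lemma fockInner_mul_X_left (Ψ Φ : Fock r) (φ : WaveFunction r) :
    fockInner (Ψ * MvPolynomial.X φ) Φ = fockInner Ψ (annihilate (oneParticleInner φ) Φ) := by
  induction Ψ using MvPolynomial.induction_on' with
  | monomial m a =>
    rw [← pow_one (MvPolynomial.X φ), ← MvPolynomial.monomial_add_single, fockInner_monomial,
      fockInner_monomial]
    congr 1
    simp only [annihilateAll, LinearMap.coe_mk, AddHom.coe_mk, map_add,
      Finsupp.toMultiset_single, one_smul, Multiset.foldr_add, Multiset.foldr_singleton]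
  | add p q hp hq => rw [add_mul, fockInner_add_left, fockInner_add_left, hp, hq]

/-- The creator on the right is the adjoint of the annihilator on the left. -/
lemma fockInner_X_mul_right (Ψ Φ : Fock r) (χ : WaveFunction r) :
    fockInner Ψ (MvPolynomial.X χ * Φ) =
      fockInner (annihilate (fun φ => conj (oneParticleInner φ χ)) Ψ) Φ := by
  induction Ψ using MvPolynomial.induction_on generalizing Φ with
  | C c =>
    rw [← mul_one (MvPolynomial.C c), fockInner_C_mul_left, mul_one]
    have h1 : annihilate (fun φ => conj (oneParticleInner φ χ)) (MvPolynomial.C c) = 0 := by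
      rw [← MvPolynomial.algebraMap_eq]; exact Derivation.map_algebraMap _ _
    rw [h1, fockInner_zero_left]
    have h2 : (1 : Fock r) = MvPolynomial.monomial 0 1 := rfl
    rw [h2, fockInner_monomial, annihilateAll_zero]
    simp
  | add p q hp hq => rw [fockInner_add_left, hp, hq, map_add, fockInner_add_left]
  | mul_X p ψ hp =>
    rw [fockInner_mul_X_left, Derivation.leibniz, Derivation.leibniz, annihilate_X, annihilate_X,
      smul_eq_mul, smul_eq_mul, smul_eq_mul, smul_eq_mul, fockInner_add_right,
      fockInner_add_left, hp, mul_comm Φ, mul_comm p, fockInner_C_mul_right,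
      fockInner_C_mul_left, mul_comm (MvPolynomial.X ψ), fockInner_mul_X_left]
    simp only [Complex.conj_conj]
    ring

lemma derivation_sum_apply {ι : Type*} (s : Finset ι)
    (D : ι → Derivation ℂ (Fock r) (Fock r)) (Φ : Fock r) :
    (∑ i ∈ s, D i) Φ = ∑ i ∈ s, D i Φ := by
  classical
  induction s using Finset.induction_on with
  | empty => simp
  | insert a s ha ih => rw [Finset.sum_insert ha, Finset.sum_insert ha, Derivation.add_apply, ih]

/-- An annihilation operator in terms of the partial derivatives in the creators. -/
lemma annihilate_eq_sum (f : WaveFunction r → ℂ) (V : Finset (WaveFunction r)) {Φ : Fock r}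
    (hΦ : Φ ∈ MvPolynomial.supported ℂ (V : Set (WaveFunction r))) :
    annihilate f Φ = ∑ φ ∈ V, MvPolynomial.C (f φ) * MvPolynomial.pderiv φ Φ := by
  classical
  have h : annihilate f Φ = (∑ φ ∈ V, f φ • MvPolynomial.pderiv (R := ℂ) φ) Φ := by
    refine MvPolynomial.derivation_eqOn_supported (fun φ hφ => ?_) hΦ
    simp only [Function.comp_apply, annihilate_X, derivation_sum_apply,
      Derivation.coe_smul, Pi.smul_apply, MvPolynomial.pderiv_X]
    rw [Finset.sum_eq_single φ]
    · simp [MvPolynomial.smul_eq_C_mul]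
    · intro b _ hb
      simp [hb.symm]
    · intro h; exact absurd hφ h
  simp [h, derivation_sum_apply, MvPolynomial.smul_eq_C_mul]

lemma pderiv_mem_supported {V : Set (WaveFunction r)} (φ : WaveFunction r) {Φ : Fock r}
    (hΦ : Φ ∈ MvPolynomial.supported ℂ V) :
    MvPolynomial.pderiv φ Φ ∈ MvPolynomial.supported ℂ V := by
  classical
  induction hΦ using Algebra.adjoin_induction with
  | mem x hx =>
    obtain ⟨ψ, -, rfl⟩ := hx
    rw [MvPolynomial.pderiv_X, Pi.single_apply]
    split_ifs
    · exact one_mem _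
    · exact zero_mem _
  | algebraMap c => rw [Derivation.map_algebraMap]; exact zero_mem _
  | add x y hx hy ihx ihy => rw [map_add]; exact add_mem ihx ihy
  | mul x y hx hy ihx ihy =>
    rw [Derivation.leibniz]; exact add_mem (mul_mem hx ihy) (mul_mem hy ihx)

/-- The wave functions occurring in two Fock vectors. -/
def particles (Ψ Φ : Fock r) : Finset (WaveFunction r) :=
  open Classical in Ψ.vars ∪ Φ.vars

lemma mem_supported_left (Ψ Φ : Fock r) :
    Ψ ∈ MvPolynomial.supported ℂ (particles Ψ Φ : Set (WaveFunction r)) := by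
  rw [MvPolynomial.mem_supported, particles]
  simp

lemma mem_supported_right (Ψ Φ : Fock r) :
    Φ ∈ MvPolynomial.supported ℂ (particles Ψ Φ : Set (WaveFunction r)) := by
  rw [MvPolynomial.mem_supported, particles]
  simp

/-- The coefficient in the expansion of a Wick product with one particle removed on each side. -/
def coeffMixed (Ψ Φ : Fock r) (φ ψ : WaveFunction r) : ℂ :=
  fockInner (MvPolynomial.pderiv φ Ψ) (MvPolynomial.pderiv ψ Φ)

/-- The coefficient with two particles removed on the right. -/
def coeffAnnihilation (Ψ Φ : Fock r) (φ ψ : WaveFunction r) : ℂ :=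
  fockInner Ψ (MvPolynomial.pderiv φ (MvPolynomial.pderiv ψ Φ))

/-- The coefficient with two particles removed on the left. -/
def coeffCreation (Ψ Φ : Fock r) (φ ψ : WaveFunction r) : ℂ :=
  fockInner (MvPolynomial.pderiv φ (MvPolynomial.pderiv ψ Ψ)) Φ

lemma annihilate_annihilate_eq_sum (f g : WaveFunction r → ℂ) (V : Finset (WaveFunction r))
    {Φ : Fock r} (hΦ : Φ ∈ MvPolynomial.supported ℂ (V : Set (WaveFunction r))) :
    annihilate f (annihilate g Φ) = ∑ φ ∈ V, ∑ ψ ∈ V,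
      MvPolynomial.C (f φ) * (MvPolynomial.C (g ψ) *
        MvPolynomial.pderiv φ (MvPolynomial.pderiv ψ Φ)) := by
  rw [annihilate_eq_sum g V hΦ, map_sum, Finset.sum_comm]
  refine Finset.sum_congr rfl fun ψ _ => ?_
  rw [← MvPolynomial.smul_eq_C_mul, Derivation.map_smul,
    annihilate_eq_sum f V (pderiv_mem_supported ψ hΦ), MvPolynomial.smul_eq_C_mul, Finset.mul_sum]
  exact Finset.sum_congr rfl fun φ _ => by ring

/-- A matrix element of a Wick product is a finite combination of products of one-particle
matrix elements and their complex conjugates. -/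
lemma wick_eq_sum (f g : WaveFunction r → ℂ) (Ψ Φ : Fock r) :
    wick f g Ψ Φ = ∑ φ ∈ particles Ψ Φ, ∑ ψ ∈ particles Ψ Φ,
      (coeffAnnihilation Ψ Φ φ ψ * (f φ * g ψ)
        + coeffMixed Ψ Φ φ ψ * (conj (f φ) * g ψ)
        + coeffMixed Ψ Φ φ ψ * (f ψ * conj (g φ))
        + coeffCreation Ψ Φ φ ψ * (conj (f φ) * conj (g ψ))) := by
  have hΨ := mem_supported_left Ψ Φ
  have hΦ := mem_supported_right Ψ Φ
  rw [wick, annihilate_annihilate_eq_sum f g _ hΦ, annihilate_annihilate_eq_sum f g _ hΨ,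
    annihilate_eq_sum f _ hΨ, annihilate_eq_sum g _ hΦ, annihilate_eq_sum f _ hΦ,
    annihilate_eq_sum g _ hΨ]
  simp only [fockInner_sum_left, fockInner_sum_right, fockInner_C_mul_left,
    fockInner_C_mul_right, Finset.sum_add_distrib, Finset.mul_sum, coeffMixed, coeffAnnihilation, coeffCreation]
  congr 1
  · congr 1
    · congr 1
      · exact Finset.sum_congr rfl fun φ _ => Finset.sum_congr rfl fun ψ _ => by ring
      · rw [Finset.sum_comm]
        exact Finset.sum_congr rfl fun φ _ => Finset.sum_congr rfl fun ψ _ => by ring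
    · rw [Finset.sum_comm]
      exact Finset.sum_congr rfl fun φ _ => Finset.sum_congr rfl fun ψ _ => by ring
  · exact Finset.sum_congr rfl fun φ _ => Finset.sum_congr rfl fun ψ _ => by ring

/-- A matrix element of a second quantised one-particle operator. -/
lemma fockInner_secondQuantize (L : WaveFunction r → WaveFunction r) (Ψ Φ : Fock r) :
    fockInner Ψ (secondQuantize L Φ) = ∑ φ ∈ particles Ψ Φ, ∑ ψ ∈ particles Ψ Φ,
      coeffMixed Ψ Φ φ ψ * oneParticleInner φ (L ψ) := by
  classical
  have h : secondQuantize L Φ =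
      (∑ ψ ∈ particles Ψ Φ, (MvPolynomial.X (L ψ) : Fock r) • MvPolynomial.pderiv (R := ℂ) ψ) Φ := by
    refine MvPolynomial.derivation_eqOn_supported (fun φ hφ => ?_) (mem_supported_right Ψ Φ)
    simp only [Function.comp_apply, secondQuantize, MvPolynomial.mkDerivation_X,
      derivation_sum_apply, Derivation.coe_smul, Pi.smul_apply,
      MvPolynomial.pderiv_X]
    rw [Finset.sum_eq_single φ]
    · simp
    · intro b _ hb
      simp [hb.symm]
    · intro h; exact absurd hφ h
  rw [h, derivation_sum_apply, fockInner_sum_right, Finset.sum_comm]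
  refine Finset.sum_congr rfl fun ψ _ => ?_
  rw [Derivation.coe_smul, Pi.smul_apply, smul_eq_mul, fockInner_X_mul_right,
    annihilate_eq_sum _ _ (mem_supported_left Ψ Φ), fockInner_sum_left]
  refine Finset.sum_congr rfl fun φ _ => ?_
  rw [fockInner_C_mul_left, Complex.conj_conj, coeffMixed, mul_comm]

end FockSpace

end

section

/-! ### Amplitudes on the light cone -/

/-- An amplitude: a smooth function of the momentum, compactly supported away from the tip of the
light cone. -/
structure IsAmplitude (K : Space → ℂ) : Prop where
  smooth : ContDiff ℝ ∞ K
  compact : HasCompactSupport K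
  off_tip : (0 : Space) ∉ tsupport K

/-- A function of the momentum which is smooth away from the tip of the light cone. -/
def SmoothOffTip (m : Space → ℂ) : Prop := ∀ p, p ≠ 0 → ContDiffAt ℝ ∞ m p

/-- The partial derivative `∂/∂p^l` on the light cone, which is zero for `l = 0` because the
space part of the momentum is the coordinate. -/
def momentumPartial (l : Fin 4) (K : Space → ℂ) (p : Space) : ℂ :=
  Fin.cases 0 (fun j => fderiv ℝ K p (EuclideanSpace.single j 1)) l

lemma SmoothOffTip.mul {m m' : Space → ℂ} (h : SmoothOffTip m) (h' : SmoothOffTip m') :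
    SmoothOffTip (fun p => m p * m' p) := fun p hp => (h p hp).mul (h' p hp)

lemma SmoothOffTip.sum {ι : Type*} {s : Finset ι} {m : ι → Space → ℂ}
    (h : ∀ i ∈ s, SmoothOffTip (m i)) : SmoothOffTip (fun p => ∑ i ∈ s, m i p) :=
  fun p hp => ContDiffAt.sum fun i hi => h i hi p hp

lemma SmoothOffTip.prod {ι : Type*} {s : Finset ι} {m : ι → Space → ℂ}
    (h : ∀ i ∈ s, SmoothOffTip (m i)) : SmoothOffTip (fun p => ∏ i ∈ s, m i p) :=
  fun p hp => contDiffAt_prod fun i hi => h i hi p hp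

lemma smoothOffTip_const (c : ℂ) : SmoothOffTip (fun _ => c) := fun _ _ => contDiffAt_const

lemma SmoothOffTip.conj {m : Space → ℂ} (h : SmoothOffTip m) :
    SmoothOffTip (fun p => conj (m p)) := fun p hp =>
  Complex.conjCLE.contDiff.contDiffAt.comp p (h p hp)

lemma smoothOffTip_lower (κ : Fin 4) : SmoothOffTip (fun p => (lower (onShell p) κ : ℂ)) :=
  fun _ hp => contDiffAt_lower κ hp

lemma smoothOffTip_onShell (κ : Fin 4) : SmoothOffTip (fun p => (onShell p κ : ℂ)) :=
  fun p hp => Complex.ofRealCLM.contDiff.contDiffAt.comp p (contDiffAt_onShell κ hp)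

lemma SmoothOffTip.inv {m : Space → ℂ} (h : SmoothOffTip m) (h0 : ∀ p, p ≠ 0 → m p ≠ 0) :
    SmoothOffTip (fun p => (m p)⁻¹) := fun p hp => (h p hp).inv (h0 p hp)

lemma smoothOffTip_norm : SmoothOffTip (fun p => (‖p‖ : ℂ)) := smoothOffTip_onShell 0

lemma smoothOffTip_invariantDensity : SmoothOffTip (fun p => (invariantDensity p : ℂ)) := by
  have : SmoothOffTip fun p => (((2 * Real.pi) ^ 3 : ℝ) * (2 * (‖p‖ : ℂ)))⁻¹ := by
    refine (SmoothOffTip.mul (smoothOffTip_const _) (.mul (smoothOffTip_const _) smoothOffTip_norm)).inv fun p hp => ?_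
    have : (‖p‖ : ℂ) ≠ 0 := by simpa using hp
    have h2 : (((2 * Real.pi) ^ 3 : ℝ) : ℂ) ≠ 0 := by
      exact_mod_cast (by positivity : (2 * Real.pi) ^ 3 ≠ 0)
    exact mul_ne_zero h2 (mul_ne_zero two_ne_zero this)
  convert this using 2
  simp [StringField.invariantDensity]

lemma isAmplitude_of_zero {K K' : Space → ℂ} (hK : IsAmplitude K)
    (h0 : ∀ p, p ∉ tsupport K → K' p = 0) (hs : SmoothOffTip K') : IsAmplitude K' := by
  have hsub : tsupport K' ⊆ tsupport K := closure_minimal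
    (fun p hp => by by_contra h; exact hp (h0 p h)) (isClosed_tsupport _)
  refine ⟨?_, hK.compact.of_isClosed_subset (isClosed_tsupport _) hsub, fun h => hK.off_tip (hsub h)⟩
  rw [contDiff_iff_contDiffAt]
  intro p
  by_cases hp : p ∈ tsupport K
  · exact hs p fun h => hK.off_tip (h ▸ hp)
  · have : K' =ᶠ[nhds p] fun _ => 0 := by
      filter_upwards [(isClosed_tsupport K).isOpen_compl.mem_nhds hp] with q hq using h0 q hq
    exact contDiffAt_const.congr_of_eventuallyEq this

lemma IsAmplitude.smoothOffTip {K : Space → ℂ} (hK : IsAmplitude K) : SmoothOffTip K :=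
  fun _ _ => hK.smooth.contDiffAt

lemma IsAmplitude.mul_left {m K : Space → ℂ} (hK : IsAmplitude K) (hm : SmoothOffTip m) :
    IsAmplitude (fun p => m p * K p) :=
  isAmplitude_of_zero hK (fun p hp => by simp [image_eq_zero_of_notMem_tsupport hp])
    (hm.mul hK.smoothOffTip)

lemma isAmplitude_zero : IsAmplitude (fun _ => 0) :=
  ⟨contDiff_const, HasCompactSupport.zero, by simp [tsupport]⟩

lemma IsAmplitude.add {K K' : Space → ℂ} (hK : IsAmplitude K) (hK' : IsAmplitude K') :
    IsAmplitude (fun p => K p + K' p) := by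
  refine ⟨hK.smooth.add hK'.smooth, hK.compact.add hK'.compact, fun h => ?_⟩
  rcases tsupport_add K K' h with h | h
  · exact hK.off_tip h
  · exact hK'.off_tip h

lemma IsAmplitude.sum {ι : Type*} {s : Finset ι} {K : ι → Space → ℂ}
    (h : ∀ i ∈ s, IsAmplitude (K i)) : IsAmplitude (fun p => ∑ i ∈ s, K i p) := by
  classical
  induction s using Finset.induction_on with
  | empty => simpa using isAmplitude_zero
  | insert a s ha ih =>
    simp only [Finset.sum_insert ha]
    exact (h a (Finset.mem_insert_self _ _)).add
      (ih fun i hi => h i (Finset.mem_insert_of_mem hi))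

lemma IsAmplitude.conj {K : Space → ℂ} (hK : IsAmplitude K) :
    IsAmplitude (fun p => conj (K p)) :=
  isAmplitude_of_zero hK (fun p hp => by simp [image_eq_zero_of_notMem_tsupport hp])
    hK.smoothOffTip.conj

lemma SmoothOffTip.momentumPartial {K : Space → ℂ} (hK : SmoothOffTip K) (l : Fin 4) :
    SmoothOffTip (momentumPartial l K) := by
  refine Fin.cases (smoothOffTip_const 0) (fun j p hp => ?_) l
  exact ((hK p hp).fderiv_right (m := ∞) (by simp)).clm_apply contDiffAt_const

lemma IsAmplitude.momentumPartial {K : Space → ℂ} (hK : IsAmplitude K) (l : Fin 4) :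
    IsAmplitude (momentumPartial l K) := by
  refine isAmplitude_of_zero hK (fun p hp => ?_) (hK.smoothOffTip.momentumPartial l)
  refine Fin.cases rfl (fun j => ?_) l
  have : K =ᶠ[nhds p] fun _ => 0 := by
    filter_upwards [(isClosed_tsupport K).isOpen_compl.mem_nhds hp] with q hq
    exact image_eq_zero_of_notMem_tsupport hq
  simp [StringField.momentumPartial, this.fderiv_eq]

lemma IsAmplitude.continuous {K : Space → ℂ} (hK : IsAmplitude K) : Continuous K :=
  hK.smooth.continuous

lemma IsAmplitude.integrable {K : Space → ℂ} (hK : IsAmplitude K) : Integrable K :=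
  hK.continuous.integrable_of_hasCompactSupport hK.compact

lemma IsAmplitude.apply_zero {K : Space → ℂ} (hK : IsAmplitude K) : K 0 = 0 :=
  image_eq_zero_of_notMem_tsupport hK.off_tip

lemma IsAmplitude.differentiable {K : Space → ℂ} (hK : IsAmplitude K) : Differentiable ℝ K :=
  hK.smooth.differentiable (by simp)

/-- The integral of a derivative of an amplitude vanishes. -/
lemma IsAmplitude.integral_momentumPartial {K : Space → ℂ} (hK : IsAmplitude K) (l : Fin 4) :
    ∫ p, StringField.momentumPartial l K p = 0 := by
  have hl := (hK.momentumPartial l).integrable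
  induction l using Fin.cases with
  | zero => simp [StringField.momentumPartial]
  | succ j =>
    have h := integral_mul_fderiv_eq_neg_fderiv_mul_of_integrable (𝕜 := ℂ) (μ := volume)
      (f := K) (g := fun _ => (1 : ℂ)) (v := (EuclideanSpace.single j 1 : Space))
      (by simpa using! hl) (by simp) (by simpa using hK.integrable)
      (fun x _ => hK.differentiable x) (fun x _ => differentiableAt_const _)
    simpa [StringField.momentumPartial] using h

lemma momentumPartial_mul {f g : Space → ℂ} {p : Space} (hf : DifferentiableAt ℝ f p)
    (hg : DifferentiableAt ℝ g p) (l : Fin 4) :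
    momentumPartial l (fun q => f q * g q) p =
      momentumPartial l f p * g p + f p * momentumPartial l g p := by
  refine Fin.cases (by simp [momentumPartial]) (fun j => ?_) l
  simp only [momentumPartial, Fin.cases_succ, fderiv_fun_mul hf hg]
  simp
  ring

lemma momentumPartial_sum {ι : Type*} {s : Finset ι} {f : ι → Space → ℂ} {p : Space}
    (hf : ∀ i ∈ s, DifferentiableAt ℝ (f i) p) (l : Fin 4) :
    momentumPartial l (fun q => ∑ i ∈ s, f i q) p = ∑ i ∈ s, momentumPartial l (f i) p := by
  refine Fin.cases (by simp [momentumPartial]) (fun j => ?_) l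
  simp only [momentumPartial, Fin.cases_succ, fderiv_fun_sum hf]
  simp

lemma momentumPartial_const (c : ℂ) (p : Space) (l : Fin 4) :
    momentumPartial l (fun _ => c) p = 0 := by
  refine Fin.cases (by simp [momentumPartial]) (fun j => ?_) l
  simp [momentumPartial]

lemma SmoothOffTip.differentiableAt {m : Space → ℂ} (h : SmoothOffTip m) {p : Space}
    (hp : p ≠ 0) : DifferentiableAt ℝ m p := (h p hp).differentiableAt (by simp)

lemma onShell_zero (p : Space) : onShell p 0 = ‖p‖ := rfl

lemma lower_zero (x : Spacetime) : lower x 0 = x 0 := by simp [lower, metric]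

lemma lower_onShell_zero (p : Space) : lower (onShell p) 0 = ‖p‖ := by
  rw [lower_zero, onShell_zero]

/-- The derivative of `p_κ` on the light cone: the tangential part of `η_{lκ}`. -/
lemma momentumPartial_lower (l κ : Fin 4) {p : Space} (hp : p ≠ 0) :
    momentumPartial l (fun q => (lower (onShell q) κ : ℂ)) p =
      (eta l κ : ℂ) - (lower (onShell p) l : ℂ) / (‖p‖ : ℂ) * (eta 0 κ : ℂ) := by
  have hp' : (‖p‖ : ℂ) ≠ 0 := by simpa using hp
  refine Fin.cases ?_ (fun j => ?_) l
  · simp [momentumPartial, lower_onShell_zero, hp']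
  obtain ⟨L, hL, hL1⟩ := hasFDerivAt_onShell_apply κ hp j
  have h : HasFDerivAt (fun q => (lower (onShell q) κ : ℂ)) ((metric κ : ℂ) • L) p := by
    simp only [lower, Complex.ofReal_mul]
    exact hL.const_mul _
  simp only [momentumPartial, Fin.cases_succ, h.fderiv]
  simp only [smul_apply, hL1, smul_eq_mul, eta]
  refine Fin.cases ?_ (fun k => ?_) κ
  · have : ((0 : Fin 4) = j.succ) = False := by simpa using (Fin.succ_ne_zero j).symm
    simp [metric, lower, onShell, fourVector, Fin.succ_ne_zero, this]
    ring
  · have : ((0 : Fin 4) = k.succ) = False := by simpa using (Fin.succ_ne_zero k).symm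
    simp only [Fin.succ_ne_zero, this, if_false, Fin.succ_inj]
    by_cases hjk : j = k
    · simp [hjk]
    · simp [hjk, Ne.symm hjk]

lemma onShell_sq (p : Space) :
    ∑ κ, (metric κ : ℂ) * ((lower (onShell p) κ : ℂ) * (lower (onShell p) κ : ℂ)) = 0 := by
  have h : ‖p‖ ^ 2 = p 0 ^ 2 + p 1 ^ 2 + p 2 ^ 2 := by
    rw [EuclideanSpace.norm_sq_eq, Fin.sum_univ_three]; simp
  have h' : (‖p‖ : ℂ) ^ 2 = (p 0 : ℂ) ^ 2 + (p 1 : ℂ) ^ 2 + (p 2 : ℂ) ^ 2 := by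
    exact_mod_cast h
  rw [Fin.sum_univ_four]
  simp [lower, metric, onShell, fourVector, Fin.cons]
  have e1 : (Fin.cases ‖p‖ (fun i => p i) (1 : Fin 4) : ℝ) = p 0 := rfl
  have e2 : (Fin.cases ‖p‖ (fun i => p i) (2 : Fin 4) : ℝ) = p 1 := rfl
  have e3 : (Fin.cases ‖p‖ (fun i => p i) (3 : Fin 4) : ℝ) = p 2 := rfl
  rw [e1, e2, e3]
  linear_combination h'

end

section

/-! ### Wave packets -/

/-- The plane wave `e^{-iε q·x}`. -/
def phase (ε : ℝ) (q x : Spacetime) : ℂ := Complex.exp (-Complex.I * (ε * minkowski q x : ℝ))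

/-- The wave packet `∫ d³p K(p) e^{-iε p·x}` with momenta on the light cone. For `ε = 1` it has
positive frequencies, for `ε = -1` negative ones. -/
def wavePacket (ε : ℝ) (K : Space → ℂ) (x : Spacetime) : ℂ := ∫ p, K p * phase ε (onShell p) x

/-- The coordinate `x ↦ x^κ` as a complex valued linear form. -/
def coordForm (κ : Fin 4) : Spacetime →L[ℝ] ℂ :=
  Complex.ofRealCLM.comp (ContinuousLinearMap.proj κ)

lemma coordForm_single (κ μ : Fin 4) : coordForm κ (Pi.single μ 1) = if κ = μ then 1 else 0 := by
  simp [coordForm, Pi.single_apply, apply_ite (fun x : ℝ => (x : ℂ))]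

lemma minkowski_eq_lower (q x : Spacetime) : minkowski q x = ∑ κ, lower q κ * x κ := rfl

lemma minkowski_comm (q x : Spacetime) : minkowski q x = minkowski x q :=
  Finset.sum_congr rfl fun _ _ => by ring

lemma norm_phase (ε : ℝ) (q x : Spacetime) : ‖phase ε q x‖ = 1 := by
  rw [phase, neg_mul, ← mul_neg, ← Complex.ofReal_neg, mul_comm, Complex.norm_exp_ofReal_mul_I]

lemma conj_phase (ε : ℝ) (q x : Spacetime) : conj (phase ε q x) = phase (-ε) q x := by
  simp [phase, ← Complex.exp_conj]

lemma phase_add (ε : ℝ) (q x y : Spacetime) : phase ε q (x + y) = phase ε q x * phase ε q y := by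
  rw [phase, phase, phase, ← Complex.exp_add]
  congr 1
  have : minkowski q (x + y) = minkowski q x + minkowski q y := by
    simp only [minkowski_eq_lower, Pi.add_apply, mul_add, Finset.sum_add_distrib]
  rw [this]; push_cast; ring

lemma continuous_minkowski : Continuous fun z : Spacetime × Spacetime => minkowski z.1 z.2 := by
  unfold minkowski; fun_prop

lemma continuous_phase (ε : ℝ) : Continuous fun z : Spacetime × Spacetime => phase ε z.1 z.2 := by
  have := continuous_minkowski
  unfold phase; fun_prop

lemma continuous_onShell : Continuous onShell := by
  refine continuous_pi fun κ => ?_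
  refine Fin.cases ?_ (fun j => ?_) κ
  · exact continuous_norm
  · simp only [onShell, fourVector, Fin.cons_succ]; fun_prop

lemma continuous_phase_onShell (ε : ℝ) :
    Continuous fun z : Space × Spacetime => phase ε (onShell z.1) z.2 :=
  (continuous_phase ε).comp ((continuous_onShell.comp continuous_fst).prodMk continuous_snd)

lemma hasFDerivAt_phase (ε : ℝ) (q x : Spacetime) :
    HasFDerivAt (phase ε q)
      (∑ κ, (-Complex.I * ε * lower q κ * phase ε q x) • coordForm κ) x := by
  have h1 : HasFDerivAt (fun y : Spacetime => ((ε * minkowski q y : ℝ) : ℂ))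
      (∑ κ, ((ε * lower q κ : ℝ) : ℂ) • coordForm κ) x := by
    have : (fun y : Spacetime => ((ε * minkowski q y : ℝ) : ℂ)) =
        fun y => (∑ κ, ((ε * lower q κ : ℝ) : ℂ) • coordForm κ) y := by
      ext y
      simp [minkowski_eq_lower, coordForm, Finset.mul_sum, mul_assoc]
    rw [this]
    exact ContinuousLinearMap.hasFDerivAt _
  have h2 := (h1.const_mul (-Complex.I)).cexp
  refine h2.congr_fderiv ?_
  ext v
  simp only [smul_apply, sum_apply, smul_eq_mul, Finset.mul_sum, phase]
  refine Finset.sum_congr rfl fun κ _ => ?_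
  push_cast; ring

/-- Differentiation under the integral sign for a superposition of plane waves. -/
lemma hasFDerivAt_integral_phase {α : Type*} [MeasurableSpace α] {ν : Measure α} (ε : ℝ)
    {k : α → ℂ} {q : α → Spacetime} (hq : Measurable q) (hk : Integrable k ν)
    (hk' : ∀ κ, Integrable (fun v => (lower (q v) κ : ℂ) * k v) ν) (x : Spacetime) :
    HasFDerivAt (fun x => ∫ v, k v * phase ε (q v) x ∂ν)
      (∑ κ, (∫ v, (-Complex.I * ε * lower (q v) κ * k v) * phase ε (q v) x ∂ν) • coordForm κ)
      x := by
  have hph : ∀ x, Measurable fun v => phase ε (q v) x := fun x =>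
    ((continuous_phase ε).comp (Continuous.prodMk_left x)).measurable.comp hq
  have hint : ∀ {g : α → ℂ}, Integrable g ν → ∀ x, Integrable (fun v => g v * phase ε (q v) x) ν := by
    intro g hg x
    refine hg.mul_bdd (c := 1) (hph x).aestronglyMeasurable (.of_forall fun v => ?_)
    rw [norm_phase]
  have hk2 : ∀ κ, Integrable (fun v => -Complex.I * ε * lower (q v) κ * k v) ν := fun κ => by
    simpa only [mul_assoc] using ((hk' κ).const_mul (-Complex.I * ε))
  have key := hasFDerivAt_integral_of_dominated_of_fderiv_le (μ := ν) (𝕜 := ℝ) (x₀ := x)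
    (s := univ) (F := fun x v => k v * phase ε (q v) x)
    (F' := fun x v => ∑ κ, ((-Complex.I * ε * lower (q v) κ * k v) * phase ε (q v) x) • coordForm κ)
    (bound := fun v => ∑ κ, ‖-Complex.I * ε * lower (q v) κ * k v‖ * ‖coordForm κ‖)
    Filter.univ_mem (.of_forall fun y => (hint hk y).aestronglyMeasurable) (hint hk x) ?_ ?_ ?_ ?_
  · refine key.congr_fderiv ?_
    rw [integral_finsetSum]
    · simp_rw [integral_smul_const]
    · intro κ _
      exact (hint (hk2 κ) x).smul_const _
  · refine Finset.aestronglyMeasurable_fun_sum _ fun κ _ => ?_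
    exact ((hint (hk2 κ) x).smul_const _).aestronglyMeasurable
  · refine .of_forall fun v y _ => ?_
    refine (norm_sum_le _ _).trans (Finset.sum_le_sum fun κ _ => ?_)
    rw [norm_smul, norm_mul _ (phase _ _ _), norm_phase, mul_one]
  · exact integrable_finsetSum _ fun κ _ => (hk2 κ).norm.mul_const _
  · refine .of_forall fun v y _ => ?_
    refine ((hasFDerivAt_phase ε (q v) y).const_mul (k v)).congr_fderiv ?_
    rw [Finset.smul_sum]
    refine Finset.sum_congr rfl fun κ _ => ?_
    rw [smul_smul]
    congr 1; ring

variable {K K' : Space → ℂ}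

lemma IsAmplitude.integrable_phase (hK : IsAmplitude K) (ε : ℝ) (x : Spacetime) :
    Integrable fun p => K p * phase ε (onShell p) x := by
  refine hK.integrable.mul_bdd (c := 1) ?_ (.of_forall fun v => ?_)
  · exact ((continuous_phase_onShell ε).comp (Continuous.prodMk_left x)).aestronglyMeasurable
  · rw [norm_phase]

lemma wavePacket_add (hK : IsAmplitude K) (hK' : IsAmplitude K') (ε : ℝ) (x : Spacetime) :
    wavePacket ε (fun p => K p + K' p) x = wavePacket ε K x + wavePacket ε K' x := by
  simp only [wavePacket, add_mul]
  exact integral_add (hK.integrable_phase ε x) (hK'.integrable_phase ε x)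

lemma wavePacket_sum {ι : Type*} {s : Finset ι} {K : ι → Space → ℂ}
    (h : ∀ i ∈ s, IsAmplitude (K i)) (ε : ℝ) (x : Spacetime) :
    wavePacket ε (fun p => ∑ i ∈ s, K i p) x = ∑ i ∈ s, wavePacket ε (K i) x := by
  simp only [wavePacket, Finset.sum_mul]
  exact integral_finsetSum _ fun i hi => (h i hi).integrable_phase ε x

lemma wavePacket_const_mul (c : ℂ) (K : Space → ℂ) (ε : ℝ) (x : Spacetime) :
    wavePacket ε (fun p => c * K p) x = c * wavePacket ε K x := by
  simp only [wavePacket, mul_assoc]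
  exact integral_const_mul _ _

lemma conj_wavePacket (K : Space → ℂ) (ε : ℝ) (x : Spacetime) :
    conj (wavePacket ε K x) = wavePacket (-ε) (fun p => conj (K p)) x := by
  simp only [wavePacket, ← integral_conj, map_mul, conj_phase]

lemma norm_wavePacket_le (K : Space → ℂ) (ε : ℝ) (x : Spacetime) :
    ‖wavePacket ε K x‖ ≤ ∫ p, ‖K p‖ := by
  refine (norm_integral_le_integral_norm _).trans_eq ?_
  simp [norm_phase]

/-- The amplitude of the derivative `∂_κ` of a wave packet. -/
def derivAmplitude (ε : ℝ) (κ : Fin 4) (K : Space → ℂ) (p : Space) : ℂ :=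
  -Complex.I * ε * lower (onShell p) κ * K p

lemma smoothOffTip_derivFactor (ε : ℝ) (κ : Fin 4) :
    SmoothOffTip fun p => -Complex.I * ε * lower (onShell p) κ :=
  (smoothOffTip_const _).mul (smoothOffTip_lower κ)

lemma IsAmplitude.derivAmplitude (hK : IsAmplitude K) (ε : ℝ) (κ : Fin 4) :
    IsAmplitude (derivAmplitude ε κ K) := hK.mul_left (smoothOffTip_derivFactor ε κ)

lemma hasFDerivAt_wavePacket (hK : IsAmplitude K) (ε : ℝ) (x : Spacetime) :
    HasFDerivAt (wavePacket ε K)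
      (∑ κ, wavePacket ε (derivAmplitude ε κ K) x • coordForm κ) x :=
  hasFDerivAt_integral_phase ε continuous_onShell.measurable hK.integrable
    (fun κ => (hK.mul_left (smoothOffTip_lower κ)).integrable) x

lemma continuous_wavePacket (hK : IsAmplitude K) (ε : ℝ) : Continuous (wavePacket ε K) :=
  continuous_iff_continuousAt.2 fun x => (hasFDerivAt_wavePacket hK ε x).continuousAt

/-- The amplitude of `x_l` times a wave packet, at time `t`. -/
def positionAmplitude (ε t : ℝ) (l : Fin 4) (K : Space → ℂ) (p : Space) : ℂ :=
  t * (lower (onShell p) l / ‖p‖ * K p) + -Complex.I * ε * momentumPartial l K p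

lemma smoothOffTip_velocity (l : Fin 4) :
    SmoothOffTip fun p => (lower (onShell p) l : ℂ) / (‖p‖ : ℂ) := by
  simp only [div_eq_mul_inv]
  exact (smoothOffTip_lower l).mul (smoothOffTip_norm.inv fun p hp => by simpa using hp)

lemma IsAmplitude.positionAmplitude (hK : IsAmplitude K) (ε t : ℝ) (l : Fin 4) :
    IsAmplitude (positionAmplitude ε t l K) :=
  ((hK.mul_left (smoothOffTip_velocity l)).mul_left (smoothOffTip_const _)).add
    ((hK.momentumPartial l).mul_left (smoothOffTip_const _))

lemma smoothOffTip_phase (ε : ℝ) (x : Spacetime) :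
    SmoothOffTip fun p => phase ε (onShell p) x := by
  have h : SmoothOffTip fun p => ((∑ κ, lower (onShell p) κ * x κ : ℝ) : ℂ) := by
    push_cast
    exact .sum fun κ _ => (smoothOffTip_lower κ).mul (smoothOffTip_const _)
  intro p hp
  simp only [phase, minkowski_eq_lower, Complex.ofReal_mul]
  exact (contDiffAt_const.mul (contDiffAt_const.mul (h p hp))).cexp

lemma momentumPartial_phase (ε : ℝ) (x : Spacetime) (l : Fin 4) {p : Space} (hp : p ≠ 0) :
    momentumPartial l (fun q => phase ε (onShell q) x) p =
      -Complex.I * ε * (lower x l - x 0 * (lower (onShell p) l / ‖p‖)) *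
        phase ε (onShell p) x := by
  have hs : ∀ κ ∈ (Finset.univ : Finset (Fin 4)),
      DifferentiableAt ℝ (fun q => (lower (onShell q) κ : ℂ) * (x κ : ℂ)) p := fun κ _ =>
    ((smoothOffTip_lower κ).mul (smoothOffTip_const _)).differentiableAt hp
  have h1 : momentumPartial l (fun q => ∑ κ, (lower (onShell q) κ : ℂ) * (x κ : ℂ)) p =
      lower x l - x 0 * (lower (onShell p) l / ‖p‖) := by
    rw [momentumPartial_sum hs]
    have : ∀ κ, momentumPartial l (fun q => (lower (onShell q) κ : ℂ) * (x κ : ℂ)) p =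
        ((eta l κ : ℂ) - (lower (onShell p) l : ℂ) / (‖p‖ : ℂ) * (eta 0 κ : ℂ)) * x κ := fun κ => by
      rw [momentumPartial_mul ((smoothOffTip_lower κ).differentiableAt hp)
        (differentiableAt_const _), momentumPartial_const, momentumPartial_lower l κ hp]
      simp
    simp only [this, sub_mul, Finset.sum_sub_distrib]
    simp [eta, apply_ite (fun x : ℝ => (x : ℂ)), lower, metric]
    ring
  rw [← h1]
  refine Fin.cases (by simp [momentumPartial]) (fun j => ?_) l
  have hd : DifferentiableAt ℝ (fun q => ∑ κ, (lower (onShell q) κ : ℂ) * (x κ : ℂ)) p :=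
    DifferentiableAt.fun_sum hs
  have h2 := ((hd.hasFDerivAt.const_mul (-Complex.I * ε)).cexp).fderiv
  have h3 : (fun q => phase ε (onShell q) x) = fun q =>
      Complex.exp (-Complex.I * ε * ∑ κ, (lower (onShell q) κ : ℂ) * (x κ : ℂ)) := by
    ext q
    simp only [phase, minkowski_eq_lower]
    push_cast
    rw [mul_assoc]
  have h4 := congrFun h3 p
  simp only [momentumPartial, Fin.cases_succ]
  rw [h3, h2]
  rw [h4]
  simp only [smul_apply, smul_eq_mul]
  ring

/-- Multiplication of a wave packet by a coordinate: integration by parts on the light cone. -/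
lemma lower_mul_wavePacket (hK : IsAmplitude K) {ε : ℝ} (hε : ε * ε = 1) (x : Spacetime)
    (l : Fin 4) :
    (lower x l : ℂ) * wavePacket ε K x = wavePacket ε (positionAmplitude ε (x 0) l K) x := by
  have h1 : IsAmplitude fun p => phase ε (onShell p) x * K p := hK.mul_left (smoothOffTip_phase ε x)
  have h2 := h1.integral_momentumPartial l
  have hεc : (ε : ℂ) * ε = 1 := by exact_mod_cast hε
  have h3 : ∀ p, momentumPartial l (fun p => phase ε (onShell p) x * K p) p =
      Complex.I * ε * (positionAmplitude ε (x 0) l K p * phase ε (onShell p) x) -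
        Complex.I * ε * (lower x l * (K p * phase ε (onShell p) x)) := by
    intro p
    by_cases hp : p = 0
    · subst hp
      rw [(h1.momentumPartial l).apply_zero, (hK.positionAmplitude ε (x 0) l).apply_zero,
        hK.apply_zero]
      simp
    · rw [momentumPartial_mul ((smoothOffTip_phase ε x).differentiableAt hp)
        (hK.differentiable p), momentumPartial_phase ε x l hp, positionAmplitude]
      linear_combination
        (-phase ε (onShell p) x * momentumPartial l K p) * hεc
        + (phase ε (onShell p) x * momentumPartial l K p * ε * ε) * Complex.I_mul_I
  simp only [h3] at h2
  rw [integral_sub, integral_const_mul, integral_const_mul, integral_const_mul] at h2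
  · have h4 : Complex.I * ε ≠ 0 := by
      intro h
      have : (ε : ℂ) ≠ 0 := fun h0 => by simp [h0] at hεc
      simp [this] at h
    have h5 := mul_left_cancel₀ h4 (sub_eq_zero.1 h2)
    exact h5.symm
  · exact ((hK.positionAmplitude ε (x 0) l).integrable_phase ε x).const_mul _
  · exact ((hK.integrable_phase ε x).const_mul _).const_mul _

/-- A wave packet is small away from the light cone: `x·x` times a wave packet grows at most
linearly in time. -/
lemma exists_minkowski_mul_wavePacket (hK : IsAmplitude K) {ε : ℝ} (hε : ε * ε = 1) :
    ∃ L₁ L₂ : Space → ℂ, IsAmplitude L₁ ∧ IsAmplitude L₂ ∧ ∀ x,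
      (minkowski x x : ℂ) * wavePacket ε K x =
        x 0 * wavePacket ε L₁ x + wavePacket ε L₂ x := by
  set u : Fin 4 → Space → ℂ := fun l p => (lower (onShell p) l : ℂ) / (‖p‖ : ℂ) with hu
  have hA : ∀ l, IsAmplitude fun p => u l p * K p := fun l => hK.mul_left (smoothOffTip_velocity l)
  have hA1 : ∀ l, IsAmplitude fun p => -Complex.I * ε * momentumPartial l (fun p => u l p * K p) p :=
    fun l => ((hA l).momentumPartial l).mul_left (smoothOffTip_const _)
  have hA2 : ∀ l, IsAmplitude fun p => u l p * momentumPartial l K p :=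
    fun l => (hK.momentumPartial l).mul_left (smoothOffTip_velocity l)
  have hA3 : ∀ l, IsAmplitude fun p => -Complex.I * ε * momentumPartial l (momentumPartial l K) p :=
    fun l => ((hK.momentumPartial l).momentumPartial l).mul_left (smoothOffTip_const _)
  refine ⟨fun p => ∑ l, (metric l : ℂ) *
      (-Complex.I * ε * momentumPartial l (fun p => u l p * K p) p
        + -Complex.I * ε * (u l p * momentumPartial l K p)),
    fun p => ∑ l, (metric l : ℂ) *
      (-Complex.I * ε * (-Complex.I * ε * momentumPartial l (momentumPartial l K) p)), ?_, ?_, ?_⟩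
  · exact .sum fun l _ => ((hA1 l).add ((hA2 l).mul_left (smoothOffTip_const _))).mul_left (smoothOffTip_const _)
  · exact .sum fun l _ => ((hA3 l).mul_left (smoothOffTip_const _)).mul_left (smoothOffTip_const _)
  intro x
  have hx1 : ∀ {K : Space → ℂ}, IsAmplitude K → ∀ l, (lower x l : ℂ) * wavePacket ε K x =
      x 0 * wavePacket ε (fun p => u l p * K p) x
        + -Complex.I * ε * wavePacket ε (momentumPartial l K) x := by
    intro K hK l
    rw [lower_mul_wavePacket hK hε x l]
    have : positionAmplitude ε (x 0) l K = fun p => (x 0 : ℂ) * (u l p * K p) +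
        -Complex.I * ε * momentumPartial l K p := rfl
    rw [this, wavePacket_add ((hK.mul_left (smoothOffTip_velocity l)).mul_left (smoothOffTip_const _))
      ((hK.momentumPartial l).mul_left (smoothOffTip_const _)), wavePacket_const_mul, wavePacket_const_mul]
  have hnull : ∑ l, (metric l : ℂ) * wavePacket ε (fun p => u l p * (u l p * K p)) x = 0 := by
    simp only [← wavePacket_const_mul]
    rw [← wavePacket_sum (s := Finset.univ)]
    · have : (fun p => ∑ l, (metric l : ℂ) * (u l p * (u l p * K p))) = fun p => 0 := by
        ext p
        have h0 : ∑ l, (metric l : ℂ) * (u l p * (u l p * K p)) =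
            (∑ l, (metric l : ℂ) * ((lower (onShell p) l : ℂ) * (lower (onShell p) l : ℂ)))
              * ((‖p‖ : ℂ)⁻¹ * (‖p‖ : ℂ)⁻¹ * K p) := by
          rw [Finset.sum_mul]
          exact Finset.sum_congr rfl fun l _ => by simp only [hu, div_eq_mul_inv]; ring
        rw [h0, onShell_sq, zero_mul]
      rw [this]; simp [wavePacket]
    · exact fun l _ => ((hA l).mul_left (smoothOffTip_velocity l)).mul_left (smoothOffTip_const _)
  have hmm : (minkowski x x : ℂ) * wavePacket ε K x =
      ∑ l, (metric l : ℂ) * (lower x l * (lower x l * wavePacket ε K x)) := by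
    simp only [minkowski]
    push_cast
    rw [Finset.sum_mul]
    refine Finset.sum_congr rfl fun l _ => ?_
    have : (metric l : ℂ) * metric l = 1 := by exact_mod_cast metric_mul_self l
    simp only [lower]; push_cast
    linear_combination (-metric l * x l * x l * wavePacket ε K x) * this
  have hterm : ∀ l, (metric l : ℂ) * (lower x l * (lower x l * wavePacket ε K x)) =
      x 0 * x 0 * ((metric l : ℂ) * wavePacket ε (fun p => u l p * (u l p * K p)) x)
      + (x 0 * ((metric l : ℂ) * (-Complex.I * ε *
          wavePacket ε (momentumPartial l (fun p => u l p * K p)) x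
          + -Complex.I * ε * wavePacket ε (fun p => u l p * momentumPartial l K p) x))
      + (metric l : ℂ) * (-Complex.I * ε * (-Complex.I * ε *
          wavePacket ε (momentumPartial l (momentumPartial l K)) x))) := by
    intro l
    rw [hx1 hK l]
    have e1 := hx1 (hA l) l
    have e2 := hx1 (hK.momentumPartial l) l
    linear_combination (metric l * x 0 : ℂ) * e1 + (metric l * (-Complex.I * ε) : ℂ) * e2
  rw [hmm, Finset.sum_congr rfl fun l _ => hterm l, Finset.sum_add_distrib, ← Finset.mul_sum,
    hnull, mul_zero, zero_add, Finset.sum_add_distrib, ← Finset.mul_sum]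
  congr 1
  · congr 1
    rw [wavePacket_sum fun l _ => ((hA1 l).add ((hA2 l).mul_left (smoothOffTip_const _))).mul_left (smoothOffTip_const _)]
    refine Finset.sum_congr rfl fun l _ => ?_
    rw [wavePacket_const_mul, wavePacket_add (hA1 l) ((hA2 l).mul_left (smoothOffTip_const _)),
      wavePacket_const_mul, wavePacket_const_mul]
  · rw [wavePacket_sum fun l _ => ((hA3 l).mul_left (smoothOffTip_const _)).mul_left (smoothOffTip_const _)]
    refine Finset.sum_congr rfl fun l _ => ?_
    rw [wavePacket_const_mul, wavePacket_const_mul, wavePacket_const_mul]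

end

section

/-! ### Integrals along rays -/

/-- `s ↦ f (x + s e)` decreases rapidly as `s → ∞`, locally uniformly for `(x, e)` in `U`. -/
def RapidDecayOn (U : Set (Spacetime × Spacetime)) (f : Spacetime → ℂ) : Prop :=
  ∀ z ∈ U, ∀ N : ℕ, ∃ C : ℝ, ∀ᶠ z' in nhds z, ∀ s : ℝ, 0 ≤ s →
    (1 + s) ^ N * ‖f (z'.1 + s • z'.2)‖ ≤ C

/-- The moment `∫₀^∞ s^m f(x + s e) ds` of a function along a ray. -/
def rayMoment (m : ℕ) (f : Spacetime → ℂ) (z : Spacetime × Spacetime) : ℂ :=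
  ∫ s in Ioi (0 : ℝ), (s : ℂ) ^ m * f (z.1 + s • z.2)

/-- A family of functions on Minkowski space, closed under partial derivatives. -/
structure DerivFamily (ι : Type*) where
  toFun : ι → Spacetime → ℂ
  deriv : Fin 4 → ι → ι
  hasFDerivAt : ∀ i x, HasFDerivAt (toFun i) (∑ κ, toFun (deriv κ i) x • coordForm κ) x

lemma integrableOn_inv_sq : IntegrableOn (fun s : ℝ => ((1 + s) ^ 2)⁻¹) (Ioi 0) := by
  have h := integrable_inv_one_add_sq.integrableOn (s := Ioi (0 : ℝ))
  refine h.mono' ?_ ?_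
  · exact (Measurable.inv (by fun_prop)).aestronglyMeasurable
  · refine (ae_restrict_iff' measurableSet_Ioi).2 (.of_forall fun s hs => ?_)
    have hs : 0 < s := hs
    rw [Real.norm_of_nonneg (by positivity)]
    gcongr
    nlinarith

lemma RapidDecayOn.bound {U : Set (Spacetime × Spacetime)} {f : Spacetime → ℂ}
    (hf : RapidDecayOn U f) {z : Spacetime × Spacetime} (hz : z ∈ U) (m : ℕ) :
    ∃ C : ℝ, ∀ᶠ z' in nhds z, ∀ s : ℝ, 0 ≤ s →
      ‖(s : ℂ) ^ m * f (z'.1 + s • z'.2)‖ ≤ C * ((1 + s) ^ 2)⁻¹ := by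
  obtain ⟨C, hC⟩ := hf z hz (m + 2)
  refine ⟨C, hC.mono fun z' h s hs => ?_⟩
  have h1 := h s hs
  rw [← div_eq_mul_inv, le_div_iff₀ (by positivity)]
  refine le_trans ?_ h1
  rw [norm_mul, norm_pow, Complex.norm_real, Real.norm_of_nonneg hs, pow_add, mul_right_comm]
  gcongr
  linarith

lemma continuous_rayIntegrand {f : Spacetime → ℂ} (hf : Continuous f) (m : ℕ)
    (z : Spacetime × Spacetime) : Continuous fun s : ℝ => (s : ℂ) ^ m * f (z.1 + s • z.2) := by
  fun_prop

lemma integrableOn_rayIntegrand {U : Set (Spacetime × Spacetime)} {f : Spacetime → ℂ}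
    (hf : RapidDecayOn U f) (hc : Continuous f) {z : Spacetime × Spacetime} (hz : z ∈ U) (m : ℕ) :
    IntegrableOn (fun s : ℝ => (s : ℂ) ^ m * f (z.1 + s • z.2)) (Ioi 0) := by
  obtain ⟨C, hC⟩ := hf.bound hz m
  refine (integrableOn_inv_sq.const_mul C).mono'
    (continuous_rayIntegrand hc m z).aestronglyMeasurable ?_
  exact (ae_restrict_iff' measurableSet_Ioi).2 (.of_forall fun s hs => hC.self_of_nhds s (le_of_lt hs))

/-- The linear form `(x, e) ↦ x^κ` on pairs. -/
def fstForm (κ : Fin 4) : Spacetime × Spacetime →L[ℝ] ℂ :=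
  (coordForm κ).comp (ContinuousLinearMap.fst ℝ _ _)

/-- The linear form `(x, e) ↦ e^κ` on pairs. -/
def sndForm (κ : Fin 4) : Spacetime × Spacetime →L[ℝ] ℂ :=
  (coordForm κ).comp (ContinuousLinearMap.snd ℝ _ _)

variable {ι : Type*} (W : DerivFamily ι) {U : Set (Spacetime × Spacetime)}

lemma DerivFamily.continuous (i : ι) : Continuous (W.toFun i) :=
  continuous_iff_continuousAt.2 fun x => (W.hasFDerivAt i x).continuousAt

/-- Differentiation of ray moments: a derivative in the base point acts on the integrand, a
derivative in the direction raises the moment as well. -/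
lemma DerivFamily.hasFDerivAt_rayMoment (hW : ∀ i, RapidDecayOn U (W.toFun i)) (i : ι) (m : ℕ)
    {z : Spacetime × Spacetime} (hz : z ∈ U) :
    HasFDerivAt (rayMoment m (W.toFun i))
      (∑ κ, (rayMoment m (W.toFun (W.deriv κ i)) z • fstForm κ
        + rayMoment (m + 1) (W.toFun (W.deriv κ i)) z • sndForm κ)) z := by
  have hint := fun j m => integrableOn_rayIntegrand (hW j) (W.continuous j) hz m
  choose C hC using fun κ => (hW (W.deriv κ i)).bound hz m
  choose C' hC' using fun κ => (hW (W.deriv κ i)).bound hz (m + 1)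
  have hs := (Filter.eventually_all.2 hC).and (Filter.eventually_all.2 hC')
  have key := hasFDerivAt_integral_of_dominated_of_fderiv_le (μ := volume.restrict (Ioi (0:ℝ)))
    (𝕜 := ℝ) (x₀ := z) (s := {z' | (∀ κ, ∀ s : ℝ, 0 ≤ s →
        ‖(s : ℂ) ^ m * W.toFun (W.deriv κ i) (z'.1 + s • z'.2)‖ ≤ C κ * ((1 + s) ^ 2)⁻¹) ∧
      ∀ κ, ∀ s : ℝ, 0 ≤ s →
        ‖(s : ℂ) ^ (m + 1) * W.toFun (W.deriv κ i) (z'.1 + s • z'.2)‖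
          ≤ C' κ * ((1 + s) ^ 2)⁻¹})
    (F := fun z' s => (s : ℂ) ^ m * W.toFun i (z'.1 + s • z'.2))
    (F' := fun z' s => ∑ κ,
      (((s : ℂ) ^ m * W.toFun (W.deriv κ i) (z'.1 + s • z'.2)) • fstForm κ
        + ((s : ℂ) ^ (m + 1) * W.toFun (W.deriv κ i) (z'.1 + s • z'.2)) • sndForm κ))
    (bound := fun s => ∑ κ, (C κ * ((1 + s) ^ 2)⁻¹ * ‖fstForm κ‖
      + C' κ * ((1 + s) ^ 2)⁻¹ * ‖sndForm κ‖))
    hs (.of_forall fun y => (continuous_rayIntegrand (W.continuous i) m y).aestronglyMeasurable)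
    (hint i m) ?_ ?_ ?_ ?_
  · refine key.congr_fderiv ?_
    rw [integral_finsetSum]
    · refine Finset.sum_congr rfl fun κ _ => ?_
      rw [integral_add ((hint _ _).smul_const _) ((hint _ _).smul_const _), integral_smul_const,
        integral_smul_const]
      rfl
    · exact fun κ _ => ((hint _ _).smul_const _).add ((hint _ _).smul_const _)
  · exact Finset.aestronglyMeasurable_fun_sum _ fun κ _ =>
      ((hint _ _).smul_const _).aestronglyMeasurable.add
        ((hint _ _).smul_const _).aestronglyMeasurable
  · refine (ae_restrict_iff' measurableSet_Ioi).2 (.of_forall fun s hs y hy => ?_)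
    refine (norm_sum_le _ _).trans (Finset.sum_le_sum fun κ _ => (norm_add_le _ _).trans ?_)
    rw [norm_smul, norm_smul]
    exact add_le_add (mul_le_mul_of_nonneg_right (hy.1 κ s (le_of_lt hs)) (norm_nonneg _))
      (mul_le_mul_of_nonneg_right (hy.2 κ s (le_of_lt hs)) (norm_nonneg _))
  · exact integrable_finsetSum _ fun κ _ =>
      ((integrableOn_inv_sq.const_mul _).mul_const _).add
        ((integrableOn_inv_sq.const_mul _).mul_const _)
  · refine .of_forall fun s y _ => ?_
    have h1 : HasFDerivAt (fun y : Spacetime × Spacetime => y.1 + s • y.2)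
        (ContinuousLinearMap.fst ℝ Spacetime Spacetime
          + s • ContinuousLinearMap.snd ℝ Spacetime Spacetime) y :=
      hasFDerivAt_fst.add (hasFDerivAt_snd.const_smul s)
    have h2 := ((W.hasFDerivAt i (y.1 + s • y.2)).comp y h1).const_mul ((s : ℂ) ^ m)
    refine h2.congr_fderiv ?_
    ext v <;>
    · simp [fstForm, sndForm, coordForm, Finset.mul_sum]
      refine Finset.sum_congr rfl fun κ _ => ?_
      ring

/-- The differential of a moment is a combination of moments of the same family, so that one
derivative suffices for smoothness. -/
lemma DerivFamily.contDiffOn_rayMoment (hU : IsOpen U)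
    (hW : ∀ i, RapidDecayOn U (W.toFun i)) (i : ι) (m : ℕ) :
    ContDiffOn ℝ ∞ (rayMoment m (W.toFun i)) U := by
  rw [contDiffOn_infty]
  intro N
  induction N generalizing i m with
  | zero =>
    rw [Nat.cast_zero, contDiffOn_zero]
    exact fun z hz => (W.hasFDerivAt_rayMoment hW i m hz).continuousAt.continuousWithinAt
  | succ N ih =>
    rw [Nat.cast_succ, contDiffOn_succ_iff_fderiv_of_isOpen hU]
    refine ⟨fun z hz => (W.hasFDerivAt_rayMoment hW i m hz).differentiableAt.differentiableWithinAt,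
      by simp, ?_⟩
    have h : ContDiffOn ℝ N (fun z =>
        ∑ κ, (rayMoment m (W.toFun (W.deriv κ i)) z • fstForm κ
        + rayMoment (m + 1) (W.toFun (W.deriv κ i)) z • sndForm κ)) U :=
      ContDiffOn.sum fun κ _ => ((ih _ _).smul contDiffOn_const).add
        ((ih _ _).smul contDiffOn_const)
    exact h.congr fun z hz => (W.hasFDerivAt_rayMoment hW i m hz).fderiv

/-! ### Rapid decrease of wave packets in spacelike directions -/

/-- Pairs of a point and a spacelike direction. -/
def spacelikePairs : Set (Spacetime × Spacetime) := {z | z.2 ∈ spacelike}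

lemma isOpen_spacelike : IsOpen spacelike := by
  have : Continuous fun e : Spacetime => minkowski e e :=
    continuous_minkowski.comp (continuous_id.prodMk continuous_id)
  exact isOpen_lt this continuous_const

lemma isOpen_spacelikePairs : IsOpen spacelikePairs := isOpen_spacelike.preimage continuous_snd

/-- Along a spacelike ray the square of the position grows quadratically. Multiplying a wave packet
by this square costs at most one power of the time, which grows linearly; each such step gains one
power of decay. -/
lemma IsAmplitude.rapidDecayOn {K : Space → ℂ} (hK : IsAmplitude K) {ε : ℝ} (hε : ε * ε = 1) :
    RapidDecayOn spacelikePairs (wavePacket ε K) := by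
  intro z hz
  set δ := -minkowski z.2 z.2 / 2 with hδ
  have hz' : minkowski z.2 z.2 < 0 := hz
  have hδ0 : 0 < δ := by rw [hδ]; linarith
  set A := 1 + |minkowski z.1 z.1| + |minkowski z.1 z.2| + |z.1 0| + |z.2 0| with hA
  have hA1 : 1 ≤ A := by
    have a1 := abs_nonneg (minkowski z.1 z.1)
    have a2 := abs_nonneg (minkowski z.1 z.2)
    have a3 := abs_nonneg (z.1 0)
    have a4 := abs_nonneg (z.2 0)
    linarith
  have hc : ∀ f : Spacetime × Spacetime → ℝ, Continuous f → |f z| < A →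
      ∀ᶠ z' in nhds z, |f z'| < A := fun f hf h =>
    (isOpen_lt hf.abs continuous_const).mem_nhds h
  have e1 : ∀ᶠ z' in nhds z, minkowski z'.2 z'.2 < -δ := by
    have : Continuous fun z' : Spacetime × Spacetime => minkowski z'.2 z'.2 :=
      continuous_minkowski.comp (continuous_snd.prodMk continuous_snd)
    exact (isOpen_lt this continuous_const).mem_nhds (by show _ < -δ; rw [hδ]; linarith)
  have e2 := hc (fun z' => minkowski z'.1 z'.1)
    (continuous_minkowski.comp (continuous_fst.prodMk continuous_fst)) (by
      rw [hA]; linarith [abs_nonneg (minkowski z.1 z.2), abs_nonneg (z.1 0), abs_nonneg (z.2 0)])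
  have e3 := hc (fun z' => minkowski z'.1 z'.2) continuous_minkowski (by
      rw [hA]; linarith [abs_nonneg (minkowski z.1 z.1), abs_nonneg (z.1 0), abs_nonneg (z.2 0)])
  have e4 := hc (fun z' => z'.1 0) (by fun_prop) (by
      rw [hA]; linarith [abs_nonneg (minkowski z.1 z.1), abs_nonneg (minkowski z.1 z.2),
        abs_nonneg (z.2 0)])
  have e5 := hc (fun z' => z'.2 0) (by fun_prop) (by
      rw [hA]; linarith [abs_nonneg (minkowski z.1 z.1), abs_nonneg (minkowski z.1 z.2),
        abs_nonneg (z.1 0)])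
  have hgood := (e1.and e2).and ((e3.and e4).and e5)
  intro N
  induction N generalizing K with
  | zero =>
    refine ⟨∫ p, ‖K p‖, .of_forall fun z' s _ => ?_⟩
    rw [pow_zero, one_mul]
    exact norm_wavePacket_le K ε _
  | succ N ih =>
    obtain ⟨L₁, L₂, hL₁, hL₂, hL⟩ := exists_minkowski_mul_wavePacket hK hε
    obtain ⟨C, hC⟩ := ih hK
    obtain ⟨C₁, hC₁⟩ := ih hL₁
    obtain ⟨C₂, hC₂⟩ := ih hL₂
    -- The squared spacelike distance along the string grows quadratically:
    -- `-(x + s e)² + B ≥ (δ / 2) (1 + s)²`.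
    set B := A + (2 * A + δ) ^ 2 / (2 * δ) + δ with hB
    have hB0 : 0 ≤ B := by positivity
    refine ⟨(A * C₁ + C₂ + B * C) / (δ / 2), ?_⟩
    filter_upwards [hC, hC₁, hC₂, hgood] with z' hC hC₁ hC₂ hg s hs
    obtain ⟨⟨g1, g2⟩, ⟨g3, g4⟩, g5⟩ := hg
    set x := z'.1 + s • z'.2 with hx
    have hxx : minkowski x x = minkowski z'.1 z'.1 + 2 * s * minkowski z'.1 z'.2
        + s ^ 2 * minkowski z'.2 z'.2 := by
      simp only [minkowski, hx, Finset.mul_sum, ← Finset.sum_add_distrib]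
      refine Finset.sum_congr rfl fun κ _ => ?_
      simp only [Pi.add_apply, Pi.smul_apply, smul_eq_mul]; ring
    have hQ : δ / 2 * (1 + s) ^ 2 ≤ -minkowski x x + B := by
      rw [hxx, hB]
      have a1 := (abs_lt.1 g2).2
      have a2 := (abs_lt.1 g3).2
      have a3 : s * minkowski z'.1 z'.2 ≤ s * A := mul_le_mul_of_nonneg_left a2.le hs
      have a4 : s ^ 2 * minkowski z'.2 z'.2 ≤ s ^ 2 * (-δ) :=
        mul_le_mul_of_nonneg_left g1.le (sq_nonneg s)
      have a5 : (2 * A + δ) * s ≤ δ / 2 * s ^ 2 + (2 * A + δ) ^ 2 / (2 * δ) := by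
        have h : 0 ≤ (δ * s - (2 * A + δ)) ^ 2 / (2 * δ) := by positivity
        have h2 : (δ * s - (2 * A + δ)) ^ 2 / (2 * δ) =
            δ / 2 * s ^ 2 - (2 * A + δ) * s + (2 * A + δ) ^ 2 / (2 * δ) := by
          field_simp; ring
        linarith
      nlinarith
    have ht : |x 0| ≤ A * (1 + s) := by
      have : x 0 = z'.1 0 + s * z'.2 0 := by simp [hx]
      rw [this]
      refine (abs_add_le _ _).trans ?_
      rw [abs_mul, abs_of_nonneg hs]
      nlinarith
    have hw := congrArg norm (hL x)
    rw [norm_mul, Complex.norm_real] at hw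
    have hw2 : |minkowski x x| * ‖wavePacket ε K x‖ ≤
        A * (1 + s) * ‖wavePacket ε L₁ x‖ + ‖wavePacket ε L₂ x‖ := by
      rw [← Real.norm_eq_abs, hw]
      refine (norm_add_le _ _).trans ?_
      rw [norm_mul, Complex.norm_real, Real.norm_eq_abs]
      gcongr
    have hw3 : δ / 2 * (1 + s) ^ 2 * ‖wavePacket ε K x‖ ≤
        A * (1 + s) * ‖wavePacket ε L₁ x‖ + ‖wavePacket ε L₂ x‖ + B * ‖wavePacket ε K x‖ := by
      refine (mul_le_mul_of_nonneg_right hQ (norm_nonneg _)).trans ?_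
      rw [add_mul]
      have := mul_le_mul_of_nonneg_right (neg_le_abs (minkowski x x))
        (norm_nonneg (wavePacket ε K x))
      linarith
    have h1 := hC s hs
    have h2 := hC₁ s hs
    have h3 := hC₂ s hs
    rw [le_div_iff₀ (by positivity)]
    have hs1 : (0 : ℝ) < 1 + s := by linarith
    have hP : (0 : ℝ) < (1 + s) ^ N := by positivity
    have hCn : 0 ≤ C := le_trans (by positivity) h1
    have hC₂n : 0 ≤ C₂ := le_trans (by positivity) h3
    refine le_of_mul_le_mul_left ?_ hs1
    calc (1 + s) * ((1 + s) ^ (N + 1) * ‖wavePacket ε K x‖ * (δ / 2))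
        = (1 + s) ^ N * (δ / 2 * (1 + s) ^ 2 * ‖wavePacket ε K x‖) := by ring
      _ ≤ (1 + s) ^ N * (A * (1 + s) * ‖wavePacket ε L₁ x‖ + ‖wavePacket ε L₂ x‖
            + B * ‖wavePacket ε K x‖) := mul_le_mul_of_nonneg_left hw3 hP.le
      _ = A * (1 + s) * ((1 + s) ^ N * ‖wavePacket ε L₁ x‖)
            + (1 + s) ^ N * ‖wavePacket ε L₂ x‖ + B * ((1 + s) ^ N * ‖wavePacket ε K x‖) := by ring
      _ ≤ A * (1 + s) * C₁ + C₂ + B * C :=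
        add_le_add (add_le_add (mul_le_mul_of_nonneg_left h2 (by positivity)) h3)
          (mul_le_mul_of_nonneg_left h1 hB0)
      _ ≤ (1 + s) * (A * C₁ + C₂ + B * C) := by
        have h4 : 0 ≤ s * (C₂ + B * C) := by positivity
        have h5 : (1 + s) * (A * C₁ + C₂ + B * C) =
          A * (1 + s) * C₁ + C₂ + B * C + s * (C₂ + B * C) := by ring
        linarith

/-- The family of all wave packets of a given frequency sign. -/
def wavePacketFamily (ε : ℝ) : DerivFamily {K : Space → ℂ // IsAmplitude K} where
  toFun K := wavePacket ε K
  deriv κ K := ⟨derivAmplitude ε κ K, K.2.derivAmplitude ε κ⟩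
  hasFDerivAt K x := hasFDerivAt_wavePacket K.2 ε x

end

section

/-! ### Moments along rays: uniformity, integration by parts, iterated string integrals -/

lemma RapidDecayOn.uniform_bound {U : Set (Spacetime × Spacetime)} {f : Spacetime → ℂ}
    (hf : RapidDecayOn U f) {S : Set (Spacetime × Spacetime)} (hS : IsCompact S) (hSU : S ⊆ U)
    (m : ℕ) : ∃ C : ℝ, ∀ z ∈ S, ∀ s : ℝ, 0 ≤ s →
      ‖(s : ℂ) ^ m * f (z.1 + s • z.2)‖ ≤ C * ((1 + s) ^ 2)⁻¹ := by
  refine hS.induction_on (p := fun S => ∃ C : ℝ, ∀ z ∈ S, ∀ s : ℝ, 0 ≤ s →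
      ‖(s : ℂ) ^ m * f (z.1 + s • z.2)‖ ≤ C * ((1 + s) ^ 2)⁻¹) ⟨0, by simp⟩ ?_ ?_ ?_
  · rintro S T hST ⟨C, hC⟩
    exact ⟨C, fun z hz => hC z (hST hz)⟩
  · rintro S T ⟨C, hC⟩ ⟨C', hC'⟩
    refine ⟨max C C', fun z hz s hs => ?_⟩
    have hp : 0 ≤ ((1 + s) ^ 2)⁻¹ := by positivity
    rcases hz with hz | hz
    · exact (hC z hz s hs).trans (mul_le_mul_of_nonneg_right (le_max_left _ _) hp)
    · exact (hC' z hz s hs).trans (mul_le_mul_of_nonneg_right (le_max_right _ _) hp)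
  · intro z hz
    obtain ⟨C, hC⟩ := hf.bound (hSU hz) m
    exact ⟨_, mem_nhdsWithin_of_mem_nhds hC, C, fun z' hz' => hz'⟩

lemma RapidDecayOn.tendsto {U : Set (Spacetime × Spacetime)} {f : Spacetime → ℂ}
    (hf : RapidDecayOn U f) {z : Spacetime × Spacetime} (hz : z ∈ U) (m : ℕ) :
    Filter.Tendsto (fun s : ℝ => (s : ℂ) ^ m * f (z.1 + s • z.2)) Filter.atTop (nhds 0) := by
  obtain ⟨C, hC⟩ := hf.bound hz m
  refine squeeze_zero_norm' (a := fun s : ℝ => C * ((1 + s) ^ 2)⁻¹) ?_ ?_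
  · filter_upwards [Filter.eventually_ge_atTop 0] with s hs using hC.self_of_nhds s hs
  · have h1 : Filter.Tendsto (fun s : ℝ => (1 + s) ^ 2) Filter.atTop Filter.atTop :=
      (Filter.tendsto_pow_atTop (by norm_num)).comp
        (Filter.tendsto_atTop_add_const_left _ _ Filter.tendsto_id)
    simpa using (h1.inv_tendsto_atTop).const_mul C

variable {ι : Type*} (W : DerivFamily ι) {U : Set (Spacetime × Spacetime)}

lemma DerivFamily.hasDerivAt_ray (i : ι) (z : Spacetime × Spacetime) (s : ℝ) :
    HasDerivAt (fun s : ℝ => W.toFun i (z.1 + s • z.2))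
      (∑ κ, (z.2 κ : ℂ) * W.toFun (W.deriv κ i) (z.1 + s • z.2)) s := by
  have h1 : HasDerivAt (fun s : ℝ => z.1 + s • z.2) z.2 s := by
    simpa using ((hasDerivAt_id s).smul_const z.2).const_add z.1
  have h2 := (W.hasFDerivAt i (z.1 + s • z.2)).comp_hasDerivAt s h1
  refine h2.congr_deriv ?_
  simp [coordForm, mul_comm]

/-- Integration by parts along a ray. -/
lemma DerivFamily.sum_mul_rayMoment_succ (hW : ∀ i, RapidDecayOn U (W.toFun i)) (i : ι) (m : ℕ)
    {z : Spacetime × Spacetime} (hz : z ∈ U) :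
    ∑ κ, (z.2 κ : ℂ) * rayMoment (m + 1) (W.toFun (W.deriv κ i)) z =
      -((m + 1 : ℕ) : ℂ) * rayMoment m (W.toFun i) z := by
  have hint := fun j m => integrableOn_rayIntegrand (hW j) (W.continuous j) hz m
  have hd : ∀ s ∈ Ioi (0 : ℝ), HasDerivAt (fun s : ℝ => (s : ℂ) ^ (m + 1) * W.toFun i (z.1 + s • z.2))
      (((m + 1 : ℕ) : ℂ) * ((s : ℂ) ^ m * W.toFun i (z.1 + s • z.2)) +
        ∑ κ, (z.2 κ : ℂ) * ((s : ℂ) ^ (m + 1) * W.toFun (W.deriv κ i) (z.1 + s • z.2))) s := by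
    intro s _
    have h1 : HasDerivAt (fun s : ℝ => (s : ℂ) ^ (m + 1)) (((m + 1 : ℕ) : ℂ) * (s : ℂ) ^ m) s := by
      simpa using (hasDerivAt_pow (m + 1) (s : ℂ)).comp_ofReal
    refine (h1.mul (W.hasDerivAt_ray i z s)).congr_deriv ?_
    rw [Finset.mul_sum]
    congr 1
    · ring
    · exact Finset.sum_congr rfl fun κ _ => by ring
  have hI1 := (hint i m).const_mul ((m + 1 : ℕ) : ℂ)
  have hI2 := integrable_finsetSum (μ := volume.restrict (Ioi (0 : ℝ))) Finset.univ
    fun κ _ => (hint (W.deriv κ i) (m + 1)).const_mul (z.2 κ : ℂ)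
  have h := integral_Ioi_of_hasDerivAt_of_tendsto
    (continuous_rayIntegrand (W.continuous i) (m + 1) z).continuousWithinAt hd
    (hI1.add hI2) ((hW i).tendsto hz (m + 1))
  rw [integral_add hI1 hI2, integral_const_mul, integral_finsetSum _
    fun κ _ => (hint (W.deriv κ i) (m + 1)).const_mul (z.2 κ : ℂ)] at h
  simp only [integral_const_mul] at h
  simp only [rayMoment]
  simp only [Complex.ofReal_zero, ne_eq, Nat.add_eq_zero_iff, one_ne_zero, and_false,
    not_false_eq_true, zero_pow, zero_mul, sub_zero] at h
  rw [neg_mul, eq_neg_iff_add_eq_zero, add_comm]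
  exact h

/-- The fundamental theorem of calculus along a ray. -/
lemma DerivFamily.sum_mul_rayMoment_zero (hW : ∀ i, RapidDecayOn U (W.toFun i)) (i : ι)
    {z : Spacetime × Spacetime} (hz : z ∈ U) :
    ∑ κ, (z.2 κ : ℂ) * rayMoment 0 (W.toFun (W.deriv κ i)) z = -W.toFun i z.1 := by
  have hint := fun j => integrableOn_rayIntegrand (hW j) (W.continuous j) hz 0
  simp only [pow_zero, one_mul] at hint
  have hI2 := integrable_finsetSum (μ := volume.restrict (Ioi (0 : ℝ))) Finset.univ
    fun κ _ => (hint (W.deriv κ i)).const_mul (z.2 κ : ℂ)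
  have ht := (hW i).tendsto hz 0
  have hc := (continuous_rayIntegrand (W.continuous i) 0 z).continuousWithinAt
    (s := Ici (0 : ℝ)) (x := 0)
  simp only [pow_zero, one_mul] at ht hc
  have h := integral_Ioi_of_hasDerivAt_of_tendsto hc
    (fun s _ => W.hasDerivAt_ray i z s) hI2 ht
  rw [integral_finsetSum _ fun κ _ => (hint (W.deriv κ i)).const_mul (z.2 κ : ℂ)] at h
  simp only [integral_const_mul, zero_smul, add_zero, zero_sub] at h
  simpa only [rayMoment, pow_zero, one_mul] using h

/-- Moments along a ray decrease rapidly when the starting point moves out along the ray. -/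
lemma RapidDecayOn.rayMoment_decay {f : Spacetime → ℂ} (hf : RapidDecayOn U f)
    {z : Spacetime × Spacetime} (hz : z ∈ U) (m N : ℕ) :
    ∃ C : ℝ, ∀ s : ℝ, 0 ≤ s → (1 + s) ^ N * ‖rayMoment m f (z.1 + s • z.2, z.2)‖ ≤ C := by
  obtain ⟨C, hC⟩ := hf z hz (m + 2 + N)
  have hC := hC.self_of_nhds
  refine ⟨∫ s in Ioi (0 : ℝ), C * ((1 + s) ^ 2)⁻¹, fun s hs => ?_⟩
  have hs1 : (0 : ℝ) < 1 + s := by linarith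
  have hP : (0 : ℝ) < (1 + s) ^ N := by positivity
  rw [mul_comm, ← le_div_iff₀ hP, ← integral_div]
  refine norm_integral_le_of_norm_le ((integrableOn_inv_sq.const_mul C).div_const _) ?_
  refine (ae_restrict_iff' measurableSet_Ioi).2 (.of_forall fun u hu => ?_)
  have hu : 0 < u := hu
  have h := hC (s + u) (by linarith)
  have hx : z.1 + s • z.2 + u • z.2 = z.1 + (s + u) • z.2 := by rw [add_smul, add_assoc]
  simp only [hx]
  rw [le_div_iff₀ hP, ← div_eq_mul_inv, le_div_iff₀ (by positivity)]
  refine le_trans ?_ h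
  rw [norm_mul, norm_pow, Complex.norm_real, Real.norm_of_nonneg hu.le, pow_add, pow_add]
  have h1 : u ^ m ≤ (1 + (s + u)) ^ m := by gcongr; linarith
  have h2 : (1 + u) ^ 2 ≤ (1 + (s + u)) ^ 2 := by gcongr; linarith
  have h3 : (1 + s) ^ N ≤ (1 + (s + u)) ^ N := by gcongr; linarith
  calc u ^ m * ‖f (z.1 + (s + u) • z.2)‖ * (1 + s) ^ N * (1 + u) ^ 2
      = u ^ m * (1 + u) ^ 2 * (1 + s) ^ N * ‖f (z.1 + (s + u) • z.2)‖ := by ring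
    _ ≤ _ := by gcongr

lemma wavePacketFamily_decay : ∀ K, RapidDecayOn spacelikePairs ((wavePacketFamily 1).toFun K) :=
  fun K => K.2.rapidDecayOn (by norm_num)

lemma integrableOn_of_decay {g : ℝ → ℂ} (hg : Continuous g) {C : ℝ}
    (hC : ∀ s : ℝ, 0 ≤ s → (1 + s) ^ 2 * ‖g s‖ ≤ C) : IntegrableOn g (Ioi 0) := by
  refine (integrableOn_inv_sq.const_mul C).mono' hg.aestronglyMeasurable ?_
  refine (ae_restrict_iff' measurableSet_Ioi).2 (.of_forall fun s hs => ?_)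
  have hs : 0 < s := hs
  rw [← div_eq_mul_inv, le_div_iff₀ (by positivity), mul_comm]
  exact hC s hs.le

lemma hasDerivAt_rayMoment_ray {K : Space → ℂ} (hK : IsAmplitude K) {e : Spacetime}
    (he : e ∈ spacelike) (x : Spacetime) (m : ℕ) (s : ℝ) :
    HasDerivAt (fun s : ℝ => rayMoment m (wavePacket 1 K) (x + s • e, e))
      (∑ κ, (e κ : ℂ) * rayMoment m (wavePacket 1 (derivAmplitude 1 κ K)) (x + s • e, e)) s := by
  have hz : (x + s • e, e) ∈ spacelikePairs := he
  have h1 : HasDerivAt (fun s : ℝ => (x + s • e, e)) (e, 0) s := by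
    have : HasDerivAt (fun s : ℝ => x + s • e) e s := by
      simpa using ((hasDerivAt_id s).smul_const e).const_add x
    exact this.prodMk (hasDerivAt_const s e)
  have h2 := ((wavePacketFamily 1).hasFDerivAt_rayMoment wavePacketFamily_decay ⟨K, hK⟩ m
    hz).comp_hasDerivAt s h1
  refine h2.congr_deriv ?_
  simp [fstForm, sndForm, coordForm, wavePacketFamily, mul_comm]

lemma continuous_rayMoment_ray {K : Space → ℂ} (hK : IsAmplitude K) {e : Spacetime}
    (he : e ∈ spacelike) (x : Spacetime) (m : ℕ) :
    Continuous (fun s : ℝ => rayMoment m (wavePacket 1 K) (x + s • e, e)) :=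
  continuous_iff_continuousAt.2 fun s => (hasDerivAt_rayMoment_ray hK he x m s).continuousAt

/-- The string integral of a moment is the next moment. -/
lemma stringIntegral_rayMoment {K : Space → ℂ} (hK : IsAmplitude K) {e : Spacetime}
    (he : e ∈ spacelike) (m : ℕ) (x : Spacetime) :
    ((m + 1 : ℕ) : ℂ) * stringIntegral e (fun y => rayMoment m (wavePacket 1 K) (y, e)) x =
      rayMoment (m + 1) (wavePacket 1 K) (x, e) := by
  have hdec := hK.rapidDecayOn (ε := 1) (by norm_num)
  have hz : (x, e) ∈ spacelikePairs := he
  have hd : ∀ s ∈ Ioi (0 : ℝ),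
      HasDerivAt (fun s : ℝ => rayMoment (m + 1) (wavePacket 1 K) (x + s • e, e))
      (-((m + 1 : ℕ) : ℂ) * rayMoment m (wavePacket 1 K) (x + s • e, e)) s := by
    intro s _
    refine (hasDerivAt_rayMoment_ray hK he x (m + 1) s).congr_deriv ?_
    exact (wavePacketFamily 1).sum_mul_rayMoment_succ wavePacketFamily_decay ⟨K, hK⟩ m
      (z := (x + s • e, e)) he
  obtain ⟨C, hC⟩ := hdec.rayMoment_decay hz m 2
  obtain ⟨C', hC'⟩ := hdec.rayMoment_decay hz (m + 1) 1
  have hI := integrableOn_of_decay (continuous_rayMoment_ray hK he x m) hC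
  have hT : Filter.Tendsto (fun s : ℝ => rayMoment (m + 1) (wavePacket 1 K) (x + s • e, e))
      Filter.atTop (nhds 0) := by
    refine squeeze_zero_norm' (a := fun s : ℝ => C' * (1 + s)⁻¹) ?_ ?_
    · filter_upwards [Filter.eventually_ge_atTop 0] with s hs
      have := hC' s hs
      rw [← div_eq_mul_inv, le_div_iff₀ (by positivity), mul_comm]
      simpa using this
    · have h1 : Filter.Tendsto (fun s : ℝ => 1 + s) Filter.atTop Filter.atTop :=
        Filter.tendsto_atTop_add_const_left _ _ Filter.tendsto_id
      simpa using (h1.inv_tendsto_atTop).const_mul C'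
  have h := integral_Ioi_of_hasDerivAt_of_tendsto
    (continuous_rayMoment_ray hK he x (m + 1)).continuousWithinAt hd (hI.const_mul _) hT
  rw [integral_const_mul] at h
  simp only [zero_smul, add_zero, zero_sub, neg_mul, neg_inj] at h
  exact h

/-- Iterated string integrals are moments along the string. -/
lemma iterate_stringIntegral {K : Space → ℂ} (hK : IsAmplitude K) {e : Spacetime}
    (he : e ∈ spacelike) (k : ℕ) :
    (stringIntegral e)^[k + 1] (wavePacket 1 K) =
      fun x => (k.factorial : ℂ)⁻¹ * rayMoment k (wavePacket 1 K) (x, e) := by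
  induction k with
  | zero => ext x; simp [stringIntegral, rayMoment]
  | succ k ih =>
    rw [Function.iterate_succ_apply', ih]
    ext x
    rw [← stringIntegral_rayMoment hK he k x]
    simp only [stringIntegral]
    rw [integral_const_mul, Nat.factorial_succ]
    push_cast
    have h1 : (k : ℂ) + 1 ≠ 0 := by exact_mod_cast Nat.succ_ne_zero k
    field_simp

lemma integrableOn_iterate_stringIntegral {K : Space → ℂ} (hK : IsAmplitude K) {e : Spacetime}
    (he : e ∈ spacelike) (k : ℕ) (x : Spacetime) :
    IntegrableOn (fun s : ℝ => (stringIntegral e)^[k] (wavePacket 1 K) (x + s • e)) (Ioi 0) := by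
  have hdec := hK.rapidDecayOn (ε := 1) (by norm_num)
  have hz : (x, e) ∈ spacelikePairs := he
  cases k with
  | zero =>
    have := integrableOn_rayIntegrand hdec (continuous_wavePacket hK 1) hz 0
    simpa using this
  | succ k =>
    rw [iterate_stringIntegral hK he]
    obtain ⟨C, hC⟩ := hdec.rayMoment_decay hz k 2
    exact (integrableOn_of_decay (continuous_rayMoment_ray hK he x k) hC).const_mul _

end

section

/-! ### The transform of a test function of the string direction -/

/-- The Fourier transform `q ↦ ∫ c(e) e^{-i q·e} d⁴e` of a test function of the string direction. -/
def directionTransform (c : Spacetime → ℂ) (q : Spacetime) : ℂ := ∫ e, c e * phase 1 e q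

/-- Smooth compactly supported functions of the string direction. -/
def IsBump (c : Spacetime → ℂ) : Prop := ContDiff ℝ ∞ c ∧ HasCompactSupport c

lemma phase_comm (ε : ℝ) (q x : Spacetime) : phase ε q x = phase ε x q := by
  rw [phase, phase, minkowski_comm]

lemma IsBump.mul_left {c m : Spacetime → ℂ} (hc : IsBump c) (hm : ContDiff ℝ ∞ m) :
    IsBump (fun e => m e * c e) := ⟨hm.mul hc.1, hc.2.mul_left⟩

lemma IsBump.integrable {c : Spacetime → ℂ} (hc : IsBump c) : Integrable c :=
  hc.1.continuous.integrable_of_hasCompactSupport hc.2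

lemma contDiff_lower (κ : Fin 4) : ContDiff ℝ ∞ fun e : Spacetime => (lower e κ : ℂ) := by
  have h : ContDiff ℝ ∞ fun e : Spacetime => metric κ * e κ := by fun_prop
  exact Complex.ofRealCLM.contDiff.comp h

lemma contDiff_coord (κ : Fin 4) : ContDiff ℝ ∞ fun e : Spacetime => (e κ : ℂ) :=
  (coordForm κ).contDiff

/-- The family of the transforms of all test functions. -/
def directionTransformFamily : DerivFamily {c : Spacetime → ℂ // IsBump c} where
  toFun c := directionTransform c
  deriv κ c := ⟨fun e => -Complex.I * (1 : ℝ) * lower e κ * c.1 e,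
    c.2.mul_left (contDiff_const.mul (contDiff_lower κ))⟩
  hasFDerivAt c x := hasFDerivAt_integral_phase 1 measurable_id c.2.integrable
    (fun κ => (c.2.mul_left (contDiff_lower κ)).integrable) x

lemma norm_directionTransform_le (c : Spacetime → ℂ) (q : Spacetime) :
    ‖directionTransform c q‖ ≤ ∫ e, ‖c e‖ := by
  refine (norm_integral_le_integral_norm _).trans_eq ?_
  simp [norm_phase]

lemma contDiff_phase (ε : ℝ) (q : Spacetime) : ContDiff ℝ ∞ (phase ε q) := by
  have : ContDiff ℝ ∞ fun x : Spacetime => ((ε * minkowski q x : ℝ) : ℂ) := by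
    refine Complex.ofRealCLM.contDiff.comp (contDiff_const.mul ?_)
    unfold minkowski
    fun_prop
  exact (contDiff_const.mul this).cexp

lemma IsBump.integrable_phase {c : Spacetime → ℂ} (hc : IsBump c) (q : Spacetime) :
    Integrable fun e => c e * phase 1 e q := by
  refine hc.integrable.mul_bdd (c := 1) ?_ (.of_forall fun v => by rw [norm_phase])
  exact ((continuous_phase 1).comp (Continuous.prodMk_left q)).aestronglyMeasurable

/-- Multiplication by a covariant momentum component is a derivative of the test function. -/
lemma lower_mul_directionTransform {c : Spacetime → ℂ} (hc : IsBump c) (κ : Fin 4) :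
    ∃ c', IsBump c' ∧ ∀ q, (lower q κ : ℂ) * directionTransform c q = directionTransform c' q := by
  set d : Spacetime → ℂ := fun e => fderiv ℝ c e (Pi.single κ 1) with hd
  have hdb : IsBump d := ⟨(hc.1.fderiv_right (m := ∞) (by simp)).clm_apply contDiff_const,
    hc.2.fderiv_apply (𝕜 := ℝ) _⟩
  refine ⟨fun e => -Complex.I * d e, hdb.mul_left contDiff_const, fun q => ?_⟩
  have hph : ∀ e, fderiv ℝ (fun e => phase 1 e q) e (Pi.single κ 1) =
      -Complex.I * lower q κ * phase 1 e q := by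
    intro e
    have : (fun e => phase 1 e q) = phase 1 q := by ext e; exact phase_comm _ _ _
    rw [this, (hasFDerivAt_phase 1 q e).fderiv]
    simp [coordForm_single, phase_comm 1 q e]
  have hdiff : Differentiable ℝ (fun e => phase 1 e q) := by
    have : (fun e => phase 1 e q) = phase 1 q := by ext e; exact phase_comm _ _ _
    rw [this]
    exact (contDiff_phase 1 q).differentiable (by simp)
  have h := integral_mul_fderiv_eq_neg_fderiv_mul_of_integrable (𝕜 := ℂ) (μ := volume)
    (f := c) (g := fun e => phase 1 e q) (v := (Pi.single κ 1 : Spacetime))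
    (hdb.integrable_phase q) (by
      simp only [hph]
      refine ((hc.integrable_phase q).const_mul (-Complex.I * lower q κ)).congr
        (.of_forall fun e => ?_)
      simp only
      ring)
    (hc.integrable_phase q)
    (fun x _ => hc.1.differentiable (by simp) x) (fun x _ => hdiff x)
  simp only [hph] at h
  have h1 : ∀ e, c e * (-Complex.I * lower q κ * phase 1 e q) =
      (-Complex.I * lower q κ) * (c e * phase 1 e q) := fun e => by ring
  simp only [h1, integral_const_mul] at h
  have h2 : directionTransform (fun e => -Complex.I * d e) q =
      -Complex.I * ∫ e, d e * phase 1 e q := by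
    simp only [directionTransform, mul_assoc, integral_const_mul]
  rw [h2]
  simp only [directionTransform, hd]
  linear_combination Complex.I * h + (lower q κ * ∫ e, c e * phase 1 e q) * Complex.I_mul_I

/-- Pairs with a non-zero direction. -/
def nonzeroPairs : Set (Spacetime × Spacetime) := {z | z.2 ≠ 0}

lemma isOpen_nonzeroPairs : IsOpen nonzeroPairs := isOpen_ne.preimage continuous_snd

/-- The transform of a test function decreases rapidly in every direction. -/
lemma IsBump.rapidDecayOn {c : Spacetime → ℂ} (hc : IsBump c) :
    RapidDecayOn nonzeroPairs (directionTransform c) := by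
  intro z hz
  obtain ⟨κ, hκ⟩ : ∃ κ, z.2 κ ≠ 0 := by
    by_contra! h
    exact hz (funext h)
  have hlow : ∀ x : Spacetime, |lower x κ| = |x κ| := fun x => by
    rw [lower, abs_mul, metric]; split_ifs <;> simp
  set δ := |z.2 κ| / 2 with hδ
  have hpos : 0 < |z.2 κ| := abs_pos.2 hκ
  have hδ0 : 0 < δ := by positivity
  have e1 : ∀ᶠ z' in nhds z, δ < |z'.2 κ| := by
    have : Continuous fun z' : Spacetime × Spacetime => |z'.2 κ| := by fun_prop
    exact (isOpen_lt continuous_const this).mem_nhds (by show δ < |z.2 κ|; rw [hδ]; linarith)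
  have e2 : ∀ᶠ z' in nhds z, |z'.1 κ| < |z.1 κ| + 1 := by
    have : Continuous fun z' : Spacetime × Spacetime => |z'.1 κ| := by fun_prop
    exact (isOpen_lt this continuous_const).mem_nhds (by show |z.1 κ| < |z.1 κ| + 1; linarith)
  set B := |z.1 κ| + 1 + δ with hB
  have hB0 : 0 ≤ B := by positivity
  intro N
  induction N generalizing c with
  | zero =>
    refine ⟨∫ e, ‖c e‖, .of_forall fun z' s _ => ?_⟩
    rw [pow_zero, one_mul]
    exact norm_directionTransform_le c _
  | succ N ih =>
    obtain ⟨c', hc', h⟩ := lower_mul_directionTransform hc κ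
    obtain ⟨C, hC⟩ := ih hc
    obtain ⟨C', hC'⟩ := ih hc'
    refine ⟨(C' + B * C) / δ, ?_⟩
    filter_upwards [hC, hC', e1, e2] with z' hC hC' g1 g2 s hs
    have h1 := hC s hs
    have h2 := hC' s hs
    set x := z'.1 + s • z'.2 with hx
    have hlx : δ * (1 + s) ≤ |lower x κ| + B := by
      rw [hlow, hB]
      have a1 : x κ = z'.1 κ + s * z'.2 κ := by simp [hx]
      have a2 : s * |z'.2 κ| ≤ |x κ| + |z'.1 κ| := by
        have : s * z'.2 κ = x κ - z'.1 κ := by rw [a1]; ring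
        calc s * |z'.2 κ| = |s * z'.2 κ| := by rw [abs_mul, abs_of_nonneg hs]
          _ = |x κ - z'.1 κ| := by rw [this]
          _ ≤ |x κ| + |z'.1 κ| := abs_sub _ _
      have a3 : s * δ ≤ s * |z'.2 κ| := mul_le_mul_of_nonneg_left g1.le hs
      linarith
    have hw := congrArg norm (h x)
    rw [norm_mul, Complex.norm_real, Real.norm_eq_abs] at hw
    have hP : (0 : ℝ) ≤ (1 + s) ^ N := by positivity
    rw [le_div_iff₀ hδ0]
    calc (1 + s) ^ (N + 1) * ‖directionTransform c x‖ * δ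
        = (1 + s) ^ N * (δ * (1 + s) * ‖directionTransform c x‖) := by ring
      _ ≤ (1 + s) ^ N * ((|lower x κ| + B) * ‖directionTransform c x‖) := by gcongr
      _ = (1 + s) ^ N * ‖directionTransform c' x‖
          + B * ((1 + s) ^ N * ‖directionTransform c x‖) := by rw [add_mul, hw]; ring
      _ ≤ C' + B * C := add_le_add h2 (mul_le_mul_of_nonneg_left h1 hB0)

/-- The moment `∫₀^∞ s^m ĉ(s p) ds` of the transform along the ray through a light-like momentum. It
is the average of `m! / (i (p·e - i0))^{m+1}` over the string direction. -/
def directionMoment (m : ℕ) (c : Spacetime → ℂ) (p : Space) : ℂ :=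
  rayMoment m (directionTransform c) (0, onShell p)

lemma onShell_ne_zero {p : Space} (hp : p ≠ 0) : onShell p ≠ 0 := fun h => by
  have := congrFun h 0
  rw [onShell_zero] at this
  exact hp (norm_eq_zero.1 this)

lemma directionTransformFamily_decay :
    ∀ c, RapidDecayOn nonzeroPairs (directionTransformFamily.toFun c) := fun c => c.2.rapidDecayOn

lemma smoothOffTip_directionMoment (m : ℕ) {c : Spacetime → ℂ} (hc : IsBump c) :
    SmoothOffTip (directionMoment m c) := by
  intro p hp
  have h1 := (directionTransformFamily.contDiffOn_rayMoment isOpen_nonzeroPairs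
    directionTransformFamily_decay ⟨c, hc⟩ m).contDiffAt
    (isOpen_nonzeroPairs.mem_nhds (x := (0, onShell p)) (onShell_ne_zero hp))
  have h2 : ContDiffAt ℝ ∞ (fun q : Space => ((0 : Spacetime), onShell q)) p :=
    contDiffAt_const.prodMk (contDiffAt_pi.2 fun κ => contDiffAt_onShell κ hp)
  exact h1.comp p h2

/-- The components `e^{ν₁}⋯e^{ν_k} c(e)` of a test function. -/
def directionComponent {k : ℕ} (c : Spacetime → ℂ) (ν : Index k) (e : Spacetime) : ℂ :=
  (∏ i, (e (ν i) : ℂ)) * c e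

lemma IsBump.directionComponent {k : ℕ} {c : Spacetime → ℂ} (hc : IsBump c) (ν : Index k) :
    IsBump (directionComponent c ν) :=
  hc.mul_left (contDiff_prod fun i _ => contDiff_coord (ν i))

/-- Contraction with `p` lowers the order of a moment, by integration by parts along the ray. -/
lemma sum_onShell_directionMoment {c : Spacetime → ℂ} (hc : IsBump c) (m : ℕ) {p : Space}
    (hp : p ≠ 0) :
    ∑ κ, (lower (onShell p) κ : ℂ) * directionMoment (m + 1) (fun e => (e κ : ℂ) * c e) p =
      -Complex.I * ((m + 1 : ℕ) : ℂ) * directionMoment m c p := by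
  have h := directionTransformFamily.sum_mul_rayMoment_succ directionTransformFamily_decay ⟨c, hc⟩ m
    (z := (0, onShell p)) (onShell_ne_zero hp)
  have h2 : ∀ κ, rayMoment (m + 1) (directionTransformFamily.toFun
      (directionTransformFamily.deriv κ ⟨c, hc⟩)) (0, onShell p) =
      -Complex.I * metric κ * directionMoment (m + 1) (fun e => (e κ : ℂ) * c e) p := by
    intro κ
    simp only [directionMoment, rayMoment, ← integral_const_mul]
    refine integral_congr_ae (.of_forall fun s => ?_)
    simp only [directionTransformFamily, directionTransform, ← integral_const_mul]
    refine integral_congr_ae (.of_forall fun e => ?_)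
    simp only [lower]
    push_cast
    ring
  simp only [h2] at h
  have h3 : ∑ κ, (onShell p κ : ℂ) * (-Complex.I * metric κ *
        directionMoment (m + 1) (fun e => (e κ : ℂ) * c e) p) =
      -Complex.I * ∑ κ, (lower (onShell p) κ : ℂ) *
        directionMoment (m + 1) (fun e => (e κ : ℂ) * c e) p := by
    rw [Finset.mul_sum]
    refine Finset.sum_congr rfl fun κ _ => ?_
    simp only [lower]; push_cast; ring
  rw [h3] at h
  have h4 : rayMoment m (directionTransformFamily.toFun ⟨c, hc⟩) (0, onShell p) =
    directionMoment m c p := rfl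
  rw [h4] at h
  linear_combination Complex.I * h + (∑ κ, (lower (onShell p) κ : ℂ) *
        directionMoment (m + 1) (fun e => (e κ : ℂ) * c e) p) * Complex.I_mul_I

/-- Contraction of the zeroth moment with `p` leaves a boundary term, the value at the origin of the
Fourier transform of the test function. -/
lemma sum_onShell_directionMoment_zero {c : Spacetime → ℂ} (hc : IsBump c) {p : Space}
    (hp : p ≠ 0) :
    ∑ κ, (lower (onShell p) κ : ℂ) * directionMoment 0 (fun e => (e κ : ℂ) * c e) p =
      -Complex.I * ∫ e, c e := by
  have h := directionTransformFamily.sum_mul_rayMoment_zero directionTransformFamily_decay ⟨c, hc⟩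
    (z := (0, onShell p)) (onShell_ne_zero hp)
  have h2 : ∀ κ, rayMoment 0 (directionTransformFamily.toFun
      (directionTransformFamily.deriv κ ⟨c, hc⟩)) (0, onShell p) =
      -Complex.I * metric κ * directionMoment 0 (fun e => (e κ : ℂ) * c e) p := by
    intro κ
    simp only [directionMoment, rayMoment, ← integral_const_mul]
    refine integral_congr_ae (.of_forall fun s => ?_)
    simp only [directionTransformFamily, directionTransform, ← integral_const_mul]
    refine integral_congr_ae (.of_forall fun e => ?_)
    simp only [lower]
    push_cast
    ring
  simp only [h2] at h
  have h3 : ∑ κ, (onShell p κ : ℂ) * (-Complex.I * metric κ *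
        directionMoment 0 (fun e => (e κ : ℂ) * c e) p) =
      -Complex.I * ∑ κ, (lower (onShell p) κ : ℂ) *
        directionMoment 0 (fun e => (e κ : ℂ) * c e) p := by
    rw [Finset.mul_sum]
    refine Finset.sum_congr rfl fun κ _ => ?_
    simp only [lower]; push_cast; ring
  rw [h3] at h
  have h4 : directionTransformFamily.toFun ⟨c, hc⟩ 0 = ∫ e, c e := by
    simp [directionTransformFamily, directionTransform, phase, minkowski]
  rw [h4] at h
  linear_combination Complex.I * h + (∑ κ, (lower (onShell p) κ : ℂ) *
        directionMoment 0 (fun e => (e κ : ℂ) * c e) p) * Complex.I_mul_I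

lemma sum_cons {n : ℕ} (f : Index (n + 1) → ℂ) :
    ∑ μ, f μ = ∑ κ, ∑ ν : Index n, f (Fin.cons κ ν) := by
  rw [← (Fin.consEquiv fun _ : Fin (n + 1) => Fin 4).sum_comp, Fintype.sum_prod_type]
  rfl

/-- The average of `n! (p·e)^{n+1} / (p·e - i0)^{n+1}` over the string direction. -/
lemma sum_directionMoment {c : Spacetime → ℂ} (hc : IsBump c) (n : ℕ) {p : Space} (hp : p ≠ 0) :
    ∑ ν : Index (n + 1), (∏ i, (lower (onShell p) (ν i) : ℂ)) *
      directionMoment n (directionComponent c ν) p =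
      (-Complex.I) ^ (n + 1) * n.factorial * ∫ e, c e := by
  induction n generalizing c with
  | zero =>
    rw [sum_cons]
    have h := sum_onShell_directionMoment_zero hc hp
    have h2 : ∀ (κ : Fin 4) (ν : Index 0), directionComponent c (Fin.cons κ ν : Index 1) =
        fun e => (e κ : ℂ) * c e := fun κ ν => by
      ext e; simp [directionComponent]
    simp only [h2]
    simpa using h
  | succ n ih =>
    rw [sum_cons, Finset.sum_comm]
    have h2 : ∀ (κ : Fin 4) (ν : Index (n + 1)), directionComponent c (Fin.cons κ ν : Index (n + 2)) =
        fun e => (e κ : ℂ) * directionComponent c ν e := fun κ ν => by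
      ext e; simp [directionComponent, Fin.prod_univ_succ, mul_assoc]
    have h3 : ∀ ν : Index (n + 1), ∑ κ, (∏ i, (lower (onShell p) ((Fin.cons κ ν : Index (n + 2)) i) : ℂ)) *
        directionMoment (n + 1) (directionComponent c (Fin.cons κ ν : Index (n + 2))) p =
        -Complex.I * ((n + 1 : ℕ) : ℂ) * ((∏ i, (lower (onShell p) (ν i) : ℂ)) *
          directionMoment n (directionComponent c ν) p) := by
      intro ν
      have h := sum_onShell_directionMoment (hc.directionComponent ν) n hp
      calc _ = (∏ i, (lower (onShell p) (ν i) : ℂ)) * ∑ κ, (lower (onShell p) κ : ℂ) *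
            directionMoment (n + 1) (fun e => (e κ : ℂ) * directionComponent c ν e) p := by
            rw [Finset.mul_sum]
            refine Finset.sum_congr rfl fun κ _ => ?_
            rw [h2, Fin.prod_univ_succ]
            simp only [Fin.cons_zero, Fin.cons_succ]
            ring
        _ = _ := by rw [h]; ring
    rw [Finset.sum_congr rfl fun ν _ => h3 ν, ← Finset.mul_sum, ih hc, Nat.factorial_succ]
    push_cast
    ring

/-! ### Averaging a string integral over the string direction -/

lemma IsStringTest.isBump {c : Spacetime → ℂ} (hc : IsStringTest c) : IsBump c := ⟨hc.1, hc.2.1⟩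

lemma continuous_phase_onShell_left (ε : ℝ) (x : Spacetime) :
    Continuous fun p => phase ε (onShell p) x := by
  have h := (continuous_phase_onShell ε).comp (Continuous.prodMk_left x)
  simpa only [Function.comp_def] using h

/-- The direction and the string parameter may be exchanged. -/
lemma integral_mul_rayMoment_swap {c : Spacetime → ℂ} (hc : IsStringTest c) {K : Space → ℂ}
    (hK : IsAmplitude K) (m : ℕ) (x : Spacetime) :
    ∫ e, c e * rayMoment m (wavePacket 1 K) (x, e) =
      ∫ s in Ioi (0 : ℝ), ∫ e, c e * ((s : ℂ) ^ m * wavePacket 1 K (x + s • e)) := by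
  have hW := hK.rapidDecayOn (ε := 1) (by norm_num)
  simp only [rayMoment, ← integral_const_mul]
  refine integral_integral_swap ?_
  obtain ⟨C, hC⟩ := hW.uniform_bound (S := (fun e => (x, e)) '' tsupport c)
    (hc.2.1.isCompact.image (by fun_prop)) (by
      rintro _ ⟨e, he, rfl⟩; exact hc.2.2 he) m
  refine Integrable.mono' (hc.isBump.integrable.norm.mul_prod (integrableOn_inv_sq.const_mul C))
    ?_ ?_
  · have hw := continuous_wavePacket hK 1
    have := hc.1.continuous
    have h : Continuous fun z : Spacetime × ℝ =>
      c z.1 * ((z.2 : ℂ) ^ m * wavePacket 1 K (x + z.2 • z.1)) := by fun_prop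
    exact h.aestronglyMeasurable
  · have hmem : ∀ᵐ z : Spacetime × ℝ ∂(volume.prod (volume.restrict (Ioi 0))), z.2 ∈ Ioi (0:ℝ) :=
      Measure.quasiMeasurePreserving_snd.ae (ae_restrict_mem measurableSet_Ioi)
    filter_upwards [hmem] with z hz
    have hz : 0 < z.2 := hz
    simp only [Function.uncurry]
    rw [norm_mul]
    by_cases he : z.1 ∈ tsupport c
    · exact mul_le_mul_of_nonneg_left (hC _ ⟨z.1, he, rfl⟩ z.2 hz.le) (norm_nonneg _)
    · simp [image_eq_zero_of_notMem_tsupport he]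

/-- The direction and the momentum may be exchanged. -/
lemma integral_mul_wavePacket_swap {c : Spacetime → ℂ} (hc : IsBump c) {K : Space → ℂ}
    (hK : IsAmplitude K) (m : ℕ) (x : Spacetime) (s : ℝ) :
    ∫ e, c e * ((s : ℂ) ^ m * wavePacket 1 K (x + s • e)) =
      ∫ p, K p * phase 1 (onShell p) x *
        ((s : ℂ) ^ m * directionTransform c (0 + s • onShell p)) := by
  have e1 : ∀ e, c e * ((s : ℂ) ^ m * wavePacket 1 K (x + s • e)) =
      ∫ p, (s : ℂ) ^ m * (K p * phase 1 (onShell p) x) * (c e * phase 1 e (s • onShell p)) := by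
    intro e
    rw [wavePacket, ← integral_const_mul, ← integral_const_mul]
    refine integral_congr_ae (.of_forall fun p => ?_)
    simp only [phase_add]
    have : phase 1 (onShell p) (s • e) = phase 1 e (s • onShell p) := by
      simp only [phase, minkowski]
      congr 4
      refine Finset.sum_congr rfl fun κ _ => ?_
      simp only [Pi.smul_apply, smul_eq_mul]; ring
    rw [this]; ring
  simp only [e1]
  rw [integral_integral_swap]
  · refine integral_congr_ae (.of_forall fun p => ?_)
    simp only [integral_const_mul, zero_add, directionTransform]
    ring
  · have hi := hc.integrable.norm.mul_prod ((hK.integrable.norm).const_mul (‖(s : ℂ) ^ m‖))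
    refine Integrable.mono' hi ?_ (.of_forall fun z => ?_)
    · have h1 := hK.continuous
      have h2 := hc.1.continuous
      have h3 : Continuous fun z : Spacetime × Space => phase 1 (onShell z.2) x := by
        have h := (continuous_phase_onShell_left 1 x).comp (continuous_snd (X := Spacetime))
        simpa only [Function.comp_def] using h
      have h4 : Continuous fun z : Spacetime × Space => phase 1 z.1 (s • onShell z.2) := by
        have h := (continuous_phase 1).comp (continuous_fst.prodMk
          ((continuous_onShell.comp (continuous_snd (X := Spacetime))).const_smul s))
        simpa only [Function.comp_def, Pi.smul_apply] using h
      have h5 : Continuous fun z : Spacetime × Space => K z.2 := h1.comp continuous_snd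
      have h6 : Continuous fun z : Spacetime × Space => c z.1 := h2.comp continuous_fst
      have h7 : Continuous fun _ : Spacetime × Space => (s : ℂ) ^ m := continuous_const
      have h : Continuous fun z : Spacetime × Space => (s : ℂ) ^ m *
          (K z.2 * phase 1 (onShell z.2) x) * (c z.1 * phase 1 z.1 (s • onShell z.2)) :=
        (h7.mul (h5.mul h3)).mul (h6.mul h4)
      exact h.aestronglyMeasurable
    · simp only [Function.uncurry, norm_mul, norm_phase, mul_one]
      rw [mul_comm]

/-- The average of string integrals of a wave packet is again a wave packet. -/
lemma integral_mul_rayMoment {c : Spacetime → ℂ} (hc : IsStringTest c) {K : Space → ℂ}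
    (hK : IsAmplitude K) (m : ℕ) (x : Spacetime) :
    ∫ e, c e * rayMoment m (wavePacket 1 K) (x, e) =
      wavePacket 1 (fun p => directionMoment m c p * K p) x := by
  have hcb := hc.isBump
  rw [integral_mul_rayMoment_swap hc hK]
  simp only [integral_mul_wavePacket_swap hcb hK]
  rw [integral_integral_swap]
  · rw [wavePacket]
    refine integral_congr_ae (.of_forall fun p => ?_)
    simp only [integral_const_mul, directionMoment, rayMoment]
    ring
  · obtain ⟨C, hC⟩ := hcb.rapidDecayOn.uniform_bound
      (S := (fun p => ((0 : Spacetime), onShell p)) '' tsupport K)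
      (hK.compact.isCompact.image (continuous_const.prodMk continuous_onShell)) (by
        rintro _ ⟨p, hp, rfl⟩
        exact onShell_ne_zero fun h => hK.off_tip (h ▸ hp)) m
    have hi := (integrableOn_inv_sq.const_mul C).mul_prod hK.integrable.norm
    refine Integrable.mono' hi ?_ ?_
    · have h1 := hK.continuous
      have h2 : Continuous (directionTransform c) := directionTransformFamily.continuous ⟨c, hcb⟩
      have h3 : Continuous fun z : ℝ × Space => phase 1 (onShell z.2) x := by
        have h := (continuous_phase_onShell_left 1 x).comp (continuous_snd (X := ℝ))
        simpa only [Function.comp_def] using h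
      have h4 : Continuous fun z : ℝ × Space => directionTransform c (0 + z.1 • onShell z.2) :=
        h2.comp (continuous_const.add
          (continuous_fst.smul (continuous_onShell.comp continuous_snd)))
      have h5 : Continuous fun z : ℝ × Space => (z.1 : ℂ) ^ m := by fun_prop
      have h6 : Continuous fun z : ℝ × Space => K z.2 := h1.comp continuous_snd
      have h : Continuous fun z : ℝ × Space => K z.2 * phase 1 (onShell z.2) x *
          ((z.1 : ℂ) ^ m * directionTransform c (0 + z.1 • onShell z.2)) :=
        (h6.mul h3).mul (h5.mul h4)
      exact h.aestronglyMeasurable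
    · have hmem : ∀ᵐ z : ℝ × Space ∂((volume.restrict (Ioi 0)).prod volume), z.1 ∈ Ioi (0:ℝ) :=
        Measure.quasiMeasurePreserving_fst.ae (ae_restrict_mem measurableSet_Ioi)
      filter_upwards [hmem] with z hz
      have hz : 0 < z.1 := hz
      simp only [Function.uncurry]
      rw [norm_mul, norm_mul, norm_phase, mul_one, mul_comm]
      by_cases he : z.2 ∈ tsupport K
      · exact mul_le_mul_of_nonneg_right (hC _ ⟨z.2, he, rfl⟩ z.1 hz.le) (norm_nonneg _)
      · simp [image_eq_zero_of_notMem_tsupport he]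

end

section

/-! ### The potentials as moments of wave packets along the string -/

/-- The amplitude of the field strength `F_{[μ₁ν₁]…[μ_rν_r]}`, including the invariant density. -/
def curlAmplitude {r : ℕ} (φ : WaveFunction r) (μ ν : Index r) (p : Space) : ℂ :=
  (invariantDensity p : ℂ) * ((-Complex.I) ^ r * ∑ S : Finset (Fin r), (-1) ^ S.card *
    (∏ i, (lower (onShell p) (if i ∈ S then ν i else μ i) : ℂ)) *
      φ.toFun p (fun i => if i ∈ S then μ i else ν i))

lemma WaveFunction.isAmplitude {r : ℕ} (φ : WaveFunction r) (μ : Index r) :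
    IsAmplitude fun p => φ.toFun p μ := by
  have h0 : ∀ p, p ∉ tsupport φ.toFun → φ.toFun p μ = 0 := fun p hp => by
    rw [fun_zero hp]; rfl
  have hsub : tsupport (fun p => φ.toFun p μ) ⊆ tsupport φ.toFun := closure_minimal
    (fun p hp => by by_contra h; exact hp (h0 p h)) (isClosed_tsupport _)
  exact ⟨contDiff_pi.1 φ.smooth μ, φ.compact.of_isClosed_subset (isClosed_tsupport _) hsub,
    fun h => φ.off_tip (hsub h)⟩

lemma isAmplitude_curlAmplitude {r : ℕ} (φ : WaveFunction r) (μ ν : Index r) :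
    IsAmplitude (curlAmplitude φ μ ν) := by
  refine IsAmplitude.mul_left (IsAmplitude.mul_left (.sum fun S _ => ?_) (smoothOffTip_const _))
    smoothOffTip_invariantDensity
  exact (φ.isAmplitude _).mul_left ((smoothOffTip_const _).mul (.prod fun i _ => smoothOffTip_lower _))

lemma fieldStrength_eq {r : ℕ} (φ : WaveFunction r) (μ ν : Index r) :
    fieldStrength φ μ ν = wavePacket 1 (curlAmplitude φ μ ν) := by
  ext x
  refine integral_congr_ae (.of_forall fun p => ?_)
  simp only [curlAmplitude, phase, one_mul]
  ring

lemma isAmplitude_contracted {r : ℕ} (φ : WaveFunction r) (e : Spacetime) (μ : Index r) :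
    IsAmplitude fun p => ∑ ν : Index r, (∏ i, (e (ν i) : ℂ)) * curlAmplitude φ μ ν p :=
  .sum fun ν _ => (isAmplitude_curlAmplitude φ μ ν).mul_left (smoothOffTip_const _)

lemma contractedFieldStrength_eq {r : ℕ} (φ : WaveFunction r) (e : Spacetime) (μ : Index r) :
    contractedFieldStrength φ e μ =
      wavePacket 1 fun p => ∑ ν : Index r, (∏ i, (e (ν i) : ℂ)) * curlAmplitude φ μ ν p := by
  ext x
  rw [wavePacket_sum fun ν _ => (isAmplitude_curlAmplitude φ μ ν).mul_left (smoothOffTip_const _)]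
  simp only [contractedFieldStrength, fieldStrength_eq, wavePacket_const_mul]
  exact Finset.sum_congr rfl fun ν _ => mul_comm _ _

variable {n : ℕ}

/-- The potential with the additional factor `m(p)` in momentum space. The derivatives of the
potential are of this form. -/
def multiplierPotential (m : Space → ℂ) (e : Spacetime) (μ : Index (n + 1)) : Field (n + 1) :=
  fun x φ => ∑ ν : Index (n + 1), (∏ i, (e (ν i) : ℂ)) *
    ((n.factorial : ℂ)⁻¹ * rayMoment n (wavePacket 1 fun p => m p * curlAmplitude φ μ ν p) (x, e))

lemma potential_eq {e : Spacetime} (he : e ∈ spacelike) (μ : Index (n + 1)) :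
    potential e μ = multiplierPotential (fun _ => 1) e μ := by
  ext x φ
  have hA := fun ν => isAmplitude_curlAmplitude φ μ ν
  have hB := fun ν : Index (n + 1) => (hA ν).mul_left (smoothOffTip_const (∏ i, (e (ν i) : ℂ)))
  rw [potential, contractedFieldStrength_eq,
    iterate_stringIntegral (isAmplitude_contracted φ e μ) he]
  simp only [multiplierPotential, one_mul]
  have h : rayMoment n (wavePacket 1 fun p => ∑ ν : Index (n + 1), (∏ i, (e (ν i) : ℂ)) *
      curlAmplitude φ μ ν p) (x, e) =
      ∑ ν : Index (n + 1), (∏ i, (e (ν i) : ℂ)) * rayMoment n (wavePacket 1 (curlAmplitude φ μ ν)) (x, e) := by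
    simp only [rayMoment, ← integral_const_mul]
    rw [← integral_finsetSum]
    · refine integral_congr_ae (.of_forall fun s => ?_)
      simp only
      rw [wavePacket_sum fun ν _ => hB ν, Finset.mul_sum]
      refine Finset.sum_congr rfl fun ν _ => ?_
      rw [wavePacket_const_mul]; ring
    · intro ν _
      exact (integrableOn_rayIntegrand ((hA ν).rapidDecayOn (by norm_num))
        (continuous_wavePacket (hA ν) 1) (z := (x, e)) he n).const_mul _
  rw [h, Finset.mul_sum]
  exact Finset.sum_congr rfl fun ν _ => by ring

lemma contDiffOn_multiplierPotential {m : Space → ℂ} (hm : SmoothOffTip m) (μ : Index (n + 1))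
    (φ : WaveFunction (n + 1)) :
    ContDiffOn ℝ ∞ (fun z : Spacetime × Spacetime => multiplierPotential m z.2 μ z.1 φ)
      spacelikePairs := by
  refine ContDiffOn.sum fun ν _ => ContDiffOn.mul ?_ (contDiffOn_const.mul ?_)
  · exact (contDiff_prod fun i _ => (contDiff_coord (ν i)).comp contDiff_snd).contDiffOn
  · exact (wavePacketFamily 1).contDiffOn_rayMoment isOpen_spacelikePairs wavePacketFamily_decay
      ⟨_, (isAmplitude_curlAmplitude φ μ ν).mul_left hm⟩ n

/-- `f` has the partial derivatives `f' κ` at `x`. -/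
def HasPartials (f : Spacetime → ℂ) (f' : Fin 4 → ℂ) (x : Spacetime) : Prop :=
  HasFDerivAt f (∑ κ, f' κ • coordForm κ) x

lemma HasPartials.partialDeriv {f : Spacetime → ℂ} {f' : Fin 4 → ℂ} {x : Spacetime}
    (h : HasPartials f f' x) (κ : Fin 4) : partialDeriv κ f x = f' κ := by
  rw [StringField.partialDeriv, HasFDerivAt.fderiv h]
  simp [coordForm_single]

lemma HasPartials.add {f g : Spacetime → ℂ} {f' g' : Fin 4 → ℂ} {x : Spacetime}
    (hf : HasPartials f f' x) (hg : HasPartials g g' x) :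
    HasPartials (fun y => f y + g y) (fun κ => f' κ + g' κ) x := by
  refine (HasFDerivAt.fun_add hf hg).congr_fderiv ?_
  ext v
  simp only [add_apply, sum_apply, smul_apply, smul_eq_mul, add_mul, Finset.sum_add_distrib]

lemma HasPartials.sub {f g : Spacetime → ℂ} {f' g' : Fin 4 → ℂ} {x : Spacetime}
    (hf : HasPartials f f' x) (hg : HasPartials g g' x) :
    HasPartials (fun y => f y - g y) (fun κ => f' κ - g' κ) x := by
  refine (HasFDerivAt.fun_sub hf hg).congr_fderiv ?_
  ext v
  simp only [sub_apply, sum_apply, smul_apply, smul_eq_mul, sub_mul, Finset.sum_sub_distrib]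

lemma HasPartials.sum {ι : Type*} {s : Finset ι} {f : ι → Spacetime → ℂ} {f' : ι → Fin 4 → ℂ}
    {x : Spacetime} (hf : ∀ i ∈ s, HasPartials (f i) (f' i) x) :
    HasPartials (fun y => ∑ i ∈ s, f i y) (fun κ => ∑ i ∈ s, f' i κ) x := by
  refine (HasFDerivAt.fun_sum hf).congr_fderiv ?_
  ext v
  simp only [sum_apply, smul_apply, smul_eq_mul, Finset.sum_mul]
  rw [Finset.sum_comm]

lemma HasPartials.mul {f g : Spacetime → ℂ} {f' g' : Fin 4 → ℂ} {x : Spacetime}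
    (hf : HasPartials f f' x) (hg : HasPartials g g' x) :
    HasPartials (fun y => f y * g y) (fun κ => f' κ * g x + f x * g' κ) x := by
  refine (HasFDerivAt.fun_mul hf hg).congr_fderiv ?_
  ext v
  simp only [add_apply, sum_apply, smul_apply, smul_eq_mul, Finset.mul_sum,
    ← Finset.sum_add_distrib]
  exact Finset.sum_congr rfl fun κ _ => by ring

lemma HasPartials.const_mul {f : Spacetime → ℂ} {f' : Fin 4 → ℂ} {x : Spacetime}
    (hf : HasPartials f f' x) (c : ℂ) :
    HasPartials (fun y => c * f y) (fun κ => c * f' κ) x := by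
  refine (HasFDerivAt.const_mul hf c).congr_fderiv ?_
  ext v
  simp only [sum_apply, smul_apply, smul_eq_mul, Finset.mul_sum, mul_assoc]

lemma HasPartials.conj {f : Spacetime → ℂ} {f' : Fin 4 → ℂ} {x : Spacetime}
    (hf : HasPartials f f' x) :
    HasPartials (fun y => conj (f y)) (fun κ => conj (f' κ)) x := by
  refine (Complex.conjCLE.hasFDerivAt.comp x hf).congr_fderiv ?_
  ext v
  simp [coordForm]

lemma hasPartials_multiplierPotential {m : Space → ℂ} (hm : SmoothOffTip m) {e : Spacetime}
    (he : e ∈ spacelike) (μ : Index (n + 1)) (φ : WaveFunction (n + 1)) (x : Spacetime) :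
    HasPartials (fun y => multiplierPotential m e μ y φ)
      (fun κ => multiplierPotential (derivAmplitude 1 κ m) e μ x φ) x := by
  refine HasPartials.sum fun ν _ => HasPartials.const_mul (HasPartials.const_mul ?_ _) _
  have h := (wavePacketFamily 1).hasFDerivAt_rayMoment wavePacketFamily_decay
    ⟨_, (isAmplitude_curlAmplitude φ μ ν).mul_left hm⟩ n (z := (x, e)) he
  have h2 := HasFDerivAt.comp (f := fun y : Spacetime => (y, e)) x h (hasFDerivAt_prodMk_left (𝕜 := ℝ) x e)
  refine h2.congr_fderiv ?_
  ext v
  simp only [ContinuousLinearMap.comp_apply, sum_apply, add_apply, smul_apply, fstForm, sndForm]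
  refine Finset.sum_congr rfl fun κ _ => ?_
  have : (wavePacketFamily 1).toFun ((wavePacketFamily 1).deriv κ
      ⟨_, (isAmplitude_curlAmplitude φ μ ν).mul_left hm⟩) =
      wavePacket 1 (fun p => derivAmplitude 1 κ m p * curlAmplitude φ μ ν p) := by
    show wavePacket 1 (derivAmplitude 1 κ fun p => m p * curlAmplitude φ μ ν p) = _
    congr 1; ext p; simp only [derivAmplitude]; ring
  rw [this]
  simp

lemma fieldDeriv_multiplierPotential {m : Space → ℂ} (hm : SmoothOffTip m) {e : Spacetime}
    (he : e ∈ spacelike) (μ : Index (n + 1)) (κ : Fin 4) :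
    fieldDeriv κ (multiplierPotential m e μ) = multiplierPotential (derivAmplitude 1 κ m) e μ := by
  ext x φ
  exact (hasPartials_multiplierPotential hm he μ φ x).partialDeriv κ

/-! ### Averages of the potentials over the string direction -/

/-- The other factor may be discontinuous outside the spacelike directions, where the test function
vanishes. -/
lemma IsStringTest.integrable_mul {c g : Spacetime → ℂ} (hc : IsStringTest c)
    (hg : ContinuousOn g spacelike) : Integrable fun e => c e * g e := by
  refine Continuous.integrable_of_hasCompactSupport ?_ hc.2.1.mul_right
  rw [continuous_iff_continuousAt]
  intro e
  by_cases he : e ∈ tsupport c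
  · exact hc.1.continuous.continuousAt.mul
      (hg.continuousAt (isOpen_spacelike.mem_nhds (hc.2.2 he)))
  · have : (fun e => c e * g e) =ᶠ[nhds e] fun _ => 0 := by
      filter_upwards [(isClosed_tsupport c).isOpen_compl.mem_nhds he] with q hq
      rw [image_eq_zero_of_notMem_tsupport hq, zero_mul]
    exact continuousAt_const.congr this.symm

/-- The amplitude of the potential averaged with the test function `c` of the string direction. -/
def averagedAmplitude (c : Spacetime → ℂ) (φ : WaveFunction (n + 1)) (μ : Index (n + 1))
    (p : Space) : ℂ :=
  ∑ ν : Index (n + 1), (n.factorial : ℂ)⁻¹ * directionMoment n (directionComponent c ν) p *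
    curlAmplitude φ μ ν p

lemma isAmplitude_averagedAmplitude {c : Spacetime → ℂ} (hc : IsBump c)
    (φ : WaveFunction (n + 1)) (μ : Index (n + 1)) : IsAmplitude (averagedAmplitude c φ μ) :=
  .sum fun ν _ => (isAmplitude_curlAmplitude φ μ ν).mul_left
    ((smoothOffTip_const _).mul (smoothOffTip_directionMoment n (hc.directionComponent ν)))

lemma IsStringTest.directionComponent {k : ℕ} {c : Spacetime → ℂ} (hc : IsStringTest c)
    (ν : Index k) : IsStringTest (directionComponent c ν) := by
  refine ⟨(hc.isBump.directionComponent ν).1, (hc.isBump.directionComponent ν).2, ?_⟩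
  exact (tsupport_mul_subset_right).trans hc.2.2

/-- Averaging over the string direction turns the potential into a wave packet. -/
lemma integral_mul_multiplierPotential {c : Spacetime → ℂ} (hc : IsStringTest c)
    {m : Space → ℂ} (hm : SmoothOffTip m) (μ : Index (n + 1)) (φ : WaveFunction (n + 1))
    (x : Spacetime) :
    ∫ e, c e * multiplierPotential m e μ x φ =
      wavePacket 1 (fun p => m p * averagedAmplitude c φ μ p) x := by
  have hA := fun ν => (isAmplitude_curlAmplitude φ μ ν).mul_left hm
  have h1 : ∀ e, c e * multiplierPotential m e μ x φ = ∑ ν : Index (n + 1),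
      (n.factorial : ℂ)⁻¹ * (directionComponent c ν e *
        rayMoment n (wavePacket 1 fun p => m p * curlAmplitude φ μ ν p) (x, e)) := by
    intro e
    rw [multiplierPotential, Finset.mul_sum]
    refine Finset.sum_congr rfl fun ν _ => ?_
    rw [directionComponent]; ring
  simp only [h1]
  rw [integral_finsetSum]
  · simp only [integral_const_mul, integral_mul_rayMoment (hc.directionComponent _) (hA _)]
    simp only [← wavePacket_const_mul]
    rw [← wavePacket_sum]
    · congr 1
      ext p
      rw [averagedAmplitude, Finset.mul_sum]
      exact Finset.sum_congr rfl fun ν _ => by ring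
    · intro ν _
      exact ((hA ν).mul_left (smoothOffTip_directionMoment n
        (hc.isBump.directionComponent ν))).mul_left (smoothOffTip_const _)
  · intro ν _
    refine ((hc.directionComponent ν).integrable_mul ?_).const_mul _
    exact ((wavePacketFamily 1).contDiffOn_rayMoment isOpen_spacelikePairs wavePacketFamily_decay
      ⟨_, hA ν⟩ n).continuousOn.comp (f := fun e => (x, e)) (by fun_prop) fun _ he => he

end

section

/-! ### Jets of tensor fields and the classical stress-energy tensor -/

/-- The value of a field (`false`) or of its adjoint (`true`) in a one-particle vector. -/
def evalField {r : ℕ} (a : Bool × WaveFunction r) (f : WaveFunction r → ℂ) : ℂ :=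
  if a.1 then conj (f a.2) else f a.2

/-- The summation indices in the expansion of a Wick product: for each of the two factors, a
particle and the choice between annihilation and creation part. -/
abbrev WickIndex (r : ℕ) := (Bool × WaveFunction r) × (Bool × WaveFunction r)

/-- The summation indices for a matrix element between `Ψ` and `Φ`. -/
def wickIndices {r : ℕ} (Ψ Φ : Fock r) : Finset (WickIndex r) :=
  (Finset.univ ×ˢ particles Ψ Φ) ×ˢ (Finset.univ ×ˢ particles Ψ Φ)

/-- The coefficients in the expansion of a Wick product. -/
def wickCoeff {r : ℕ} (Ψ Φ : Fock r) : WickIndex r → ℂ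
  | ((false, φ), (false, ψ)) => coeffAnnihilation Ψ Φ φ ψ
  | ((true, φ), (false, ψ)) => coeffMixed Ψ Φ φ ψ
  | ((false, φ), (true, ψ)) => coeffMixed Ψ Φ ψ φ
  | ((true, φ), (true, ψ)) => coeffCreation Ψ Φ φ ψ

lemma sum_wickIndices {r : ℕ} (Ψ Φ : Fock r) (F : WickIndex r → ℂ) :
    ∑ i ∈ wickIndices Ψ Φ, F i = ∑ φ ∈ particles Ψ Φ, ∑ ψ ∈ particles Ψ Φ,
      (F ((false, φ), (false, ψ)) + F ((true, φ), (false, ψ)) + F ((false, ψ), (true, φ))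
        + F ((true, φ), (true, ψ))) := by
  simp only [wickIndices, Finset.sum_product, Fintype.sum_bool, Finset.sum_add_distrib]
  rw [Finset.sum_comm (f := fun φ ψ => F ((false, ψ), (true, φ)))]
  ring

lemma wick_eq_indices {r : ℕ} (f g : WaveFunction r → ℂ) (Ψ Φ : Fock r) :
    wick f g Ψ Φ = ∑ i ∈ wickIndices Ψ Φ, wickCoeff Ψ Φ i * (evalField i.1 f * evalField i.2 g) := by
  rw [sum_wickIndices, wick_eq_sum]
  refine Finset.sum_congr rfl fun φ _ => Finset.sum_congr rfl fun ψ _ => ?_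
  simp [wickCoeff, evalField]

lemma annihilate_comm {r : ℕ} (f g : WaveFunction r → ℂ) (Ψ : Fock r) :
    annihilate f (annihilate g Ψ) = annihilate g (annihilate f Ψ) := by
  have h : ⁅annihilate f, annihilate g⁆ = 0 := by
    apply MvPolynomial.derivation_ext
    intro χ
    simp [Derivation.commutator_apply, annihilate]
  have h2 := congrArg (fun D : Derivation ℂ (Fock r) (Fock r) => D Ψ) h
  simpa [Derivation.commutator_apply, sub_eq_zero] using h2

lemma wick_comm {r : ℕ} (f g : WaveFunction r → ℂ) (Ψ Φ : Fock r) :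
    wick f g Ψ Φ = wick g f Ψ Φ := by
  rw [wick, wick, annihilate_comm f g, annihilate_comm f g]
  ring

variable {n : ℕ}

/-- The values of a tensor field and of all its partial derivatives at a point; the list contains
the directions of the derivatives. -/
abbrev Jet (n : ℕ) := List (Fin 4) → Index (n + 1) → ℂ

/-- `A_μ ∂↔_ρ ∂↔_σ B^μ` in terms of jets. -/
def jetFull (ρ σ : Fin 4) (J J' : Jet n) : ℂ :=
  ∑ μ : Index (n + 1), (raise μ : ℂ) * (J [] μ * J' [ρ, σ] μ - J [ρ] μ * J' [σ] μ
    - J [σ] μ * J' [ρ] μ + J [ρ, σ] μ * J' [] μ)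

/-- `A_{α×} ∂↔_σ B_β^×` in terms of jets. -/
def jetCurrent (α β σ : Fin 4) (J J' : Jet n) : ℂ :=
  ∑ ν : Index n, (raise ν : ℂ) * (J [] (Fin.cons α ν) * J' [σ] (Fin.cons β ν)
    - J [σ] (Fin.cons α ν) * J' [] (Fin.cons β ν))

/-- `∂_κ (A_{α×} ∂↔_σ B_β^×)` in terms of jets. -/
def jetCurrentD (κ α β σ : Fin 4) (J J' : Jet n) : ℂ :=
  ∑ ν : Index n, (raise ν : ℂ) * ((J [κ] (Fin.cons α ν) * J' [σ] (Fin.cons β ν)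
      + J [] (Fin.cons α ν) * J' [κ, σ] (Fin.cons β ν))
    - (J [κ, σ] (Fin.cons α ν) * J' [] (Fin.cons β ν)
      + J [σ] (Fin.cons α ν) * J' [κ] (Fin.cons β ν)))

/-- The antisymmetric current `A_{α×} ∂↔_σ B_β^× - (α ↔ β)`. By Wick symmetry, symmetrising in the
two strings antisymmetrises in `α`, `β`. -/
def jetSpin (α β σ : Fin 4) (J J' : Jet n) : ℂ := jetCurrent α β σ J J' - jetCurrent β α σ J J'

/-- The derivative `∂_κ` of `jetSpin`. -/
def jetSpinD (κ α β σ : Fin 4) (J J' : Jet n) : ℂ :=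
  jetCurrentD κ α β σ J J' - jetCurrentD κ β α σ J J'

/-- The divergence `∂^κ B_{κρσ}` of the improvement term. -/
def jetImprovement (ρ σ : Fin 4) (J J' : Jet n) : ℂ :=
  ∑ κ, (metric κ : ℂ) * (jetSpinD κ ρ κ σ J J' + jetSpinD κ σ κ ρ J J')

/-- The classical stress-energy tensor, bilinear in two jets. -/
def jetStress (ρ σ : Fin 4) (J J' : Jet n) : ℂ :=
  (-1) ^ (n + 1) * (-(1 / 4) * jetFull ρ σ J J'
    - ((n + 1 : ℕ) : ℂ) / 4 * jetImprovement ρ σ J J')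

/-- Bilinear forms in two jets: the linear combinations of products of their components. -/
inductive IsJetForm : (Jet n → Jet n → ℂ) → Prop
  | mul (l : List (Fin 4)) (μ : Index (n + 1)) (l' : List (Fin 4)) (μ' : Index (n + 1)) :
      IsJetForm fun J J' => J l μ * J' l' μ'
  | add {B B' : Jet n → Jet n → ℂ} : IsJetForm B → IsJetForm B' →
      IsJetForm fun J J' => B J J' + B' J J'
  | const_mul (c : ℂ) {B : Jet n → Jet n → ℂ} : IsJetForm B → IsJetForm fun J J' => c * B J J'

lemma IsJetForm.sub {B B' : Jet n → Jet n → ℂ} (h : IsJetForm B) (h' : IsJetForm B') :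
    IsJetForm fun J J' => B J J' - B' J J' := by
  simpa only [neg_one_mul, ← sub_eq_add_neg] using h.add (h'.const_mul (-1))

lemma isJetForm_zero : IsJetForm fun _ _ : Jet n => 0 := by
  simpa only [zero_mul] using (IsJetForm.mul [] 0 [] 0).const_mul 0

lemma IsJetForm.sum {ι : Type*} {s : Finset ι} {B : ι → Jet n → Jet n → ℂ}
    (h : ∀ i, IsJetForm (B i)) : IsJetForm fun J J' => ∑ i ∈ s, B i J J' := by
  classical
  induction s using Finset.induction_on with
  | empty => simpa only [Finset.sum_empty] using isJetForm_zero
  | insert i s hi ih => simpa only [Finset.sum_insert hi] using (h i).add ih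

lemma isJetForm_full (ρ σ : Fin 4) : IsJetForm (jetFull (n := n) ρ σ) :=
  .sum fun _ => ((((IsJetForm.mul _ _ _ _).sub (.mul _ _ _ _)).sub (.mul _ _ _ _)).add
    (.mul _ _ _ _)).const_mul _

lemma isJetForm_spin (α β σ : Fin 4) : IsJetForm (jetSpin (n := n) α β σ) :=
  have h : ∀ α β, IsJetForm (jetCurrent (n := n) α β σ) := fun _ _ =>
    .sum fun _ => ((IsJetForm.mul _ _ _ _).sub (.mul _ _ _ _)).const_mul _
  (h α β).sub (h β α)

lemma isJetForm_spinD (κ α β σ : Fin 4) : IsJetForm (jetSpinD (n := n) κ α β σ) :=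
  have h : ∀ α β, IsJetForm (jetCurrentD (n := n) κ α β σ) := fun _ _ =>
    .sum fun _ => (((IsJetForm.mul _ _ _ _).add (.mul _ _ _ _)).sub
      ((IsJetForm.mul _ _ _ _).add (.mul _ _ _ _))).const_mul _
  (h α β).sub (h β α)

lemma isJetForm_improvement (ρ σ : Fin 4) : IsJetForm (jetImprovement (n := n) ρ σ) :=
  .sum fun _ => ((isJetForm_spinD _ _ _ _).add (isJetForm_spinD _ _ _ _)).const_mul _

lemma isJetForm_stress (ρ σ : Fin 4) : IsJetForm (jetStress (n := n) ρ σ) :=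
  (((isJetForm_full ρ σ).const_mul _).sub ((isJetForm_improvement ρ σ).const_mul _)).const_mul _

/-- The jet of a solution of the wave equation. -/
structure IsWaveJet (J : Spacetime → Jet n) : Prop where
  partials : ∀ l μ x, HasPartials (fun y => J y l μ) (fun κ => J x (κ :: l) μ) x
  perm : ∀ x l l' μ, l.Perm l' → J x l μ = J x l' μ
  wave : ∀ x l μ, ∑ κ, (metric κ : ℂ) * J x (κ :: κ :: l) μ = 0

variable {J J' : Spacetime → Jet n}

lemma IsWaveJet.hasPartials_current (hJ : IsWaveJet J) (hJ' : IsWaveJet J') (α β σ : Fin 4)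
    (x : Spacetime) :
    HasPartials (fun y => jetCurrent α β σ (J y) (J' y))
      (fun κ => jetCurrentD κ α β σ (J x) (J' x)) x :=
  HasPartials.sum fun _ _ => (((hJ.partials _ _ x).mul (hJ'.partials _ _ x)).sub
    ((hJ.partials _ _ x).mul (hJ'.partials _ _ x))).const_mul _

lemma IsWaveJet.hasPartials_spin (hJ : IsWaveJet J) (hJ' : IsWaveJet J') (α β σ : Fin 4)
    (x : Spacetime) :
    HasPartials (fun y => jetSpin α β σ (J y) (J' y))
      (fun κ => jetSpinD κ α β σ (J x) (J' x)) x :=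
  (hJ.hasPartials_current hJ' α β σ x).sub (hJ.hasPartials_current hJ' β α σ x)

lemma jetSpin_antisymm (α β σ : Fin 4) (J J' : Jet n) :
    jetSpin β α σ J J' = -jetSpin α β σ J J' := by simp [jetSpin]

lemma sum_metric_mul_comm {ι : Type*} [Fintype ι] (w : ι → ℂ) (f : Fin 4 → ι → ℂ) :
    ∑ κ, (metric κ : ℂ) * ∑ i, w i * f κ i = ∑ i, w i * ∑ κ, (metric κ : ℂ) * f κ i := by
  simp only [Finset.mul_sum]
  rw [Finset.sum_comm]
  exact Finset.sum_congr rfl fun i _ => Finset.sum_congr rfl fun κ _ => by ring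

/-- The current `A ∂↔_σ B` of two solutions of the wave equation is conserved. -/
lemma IsWaveJet.sum_currentD (hJ : IsWaveJet J) (hJ' : IsWaveJet J') (α β : Fin 4)
    (x : Spacetime) : ∑ σ, (metric σ : ℂ) * jetCurrentD σ α β σ (J x) (J' x) = 0 := by
  simp only [jetCurrentD]
  rw [sum_metric_mul_comm]
  refine Finset.sum_eq_zero fun ν _ => ?_
  have h1 := hJ.wave x [] (Fin.cons α ν)
  have h2 := hJ'.wave x [] (Fin.cons β ν)
  rw [Fin.sum_univ_four] at h1 h2 ⊢
  linear_combination (raise ν * J x [] (Fin.cons α ν) : ℂ) * h2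
    - (raise ν * J' x [] (Fin.cons β ν) : ℂ) * h1

/-- The antisymmetric current is conserved in its last index. -/
lemma IsWaveJet.sum_spinD (hJ : IsWaveJet J) (hJ' : IsWaveJet J') (α β : Fin 4)
    (x : Spacetime) : ∑ σ, (metric σ : ℂ) * jetSpinD σ α β σ (J x) (J' x) = 0 := by
  simp only [jetSpinD, mul_sub, Finset.sum_sub_distrib, hJ.sum_currentD hJ', sub_self]

/-- `∂_λ ∂_κ (A_{α×} ∂↔_σ B_β^×)` in terms of jets. -/
def jetCurrentDD (l κ α β σ : Fin 4) (J J' : Jet n) : ℂ :=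
  ∑ ν : Index n, (raise ν : ℂ) *
    (((J [l, κ] (Fin.cons α ν) * J' [σ] (Fin.cons β ν)
        + J [κ] (Fin.cons α ν) * J' [l, σ] (Fin.cons β ν))
      + (J [l] (Fin.cons α ν) * J' [κ, σ] (Fin.cons β ν)
        + J [] (Fin.cons α ν) * J' [l, κ, σ] (Fin.cons β ν)))
    - ((J [l, κ, σ] (Fin.cons α ν) * J' [] (Fin.cons β ν)
        + J [κ, σ] (Fin.cons α ν) * J' [l] (Fin.cons β ν))
      + (J [l, σ] (Fin.cons α ν) * J' [κ] (Fin.cons β ν)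
        + J [σ] (Fin.cons α ν) * J' [l, κ] (Fin.cons β ν))))

lemma IsWaveJet.hasPartials_currentD (hJ : IsWaveJet J) (hJ' : IsWaveJet J') (κ α β σ : Fin 4)
    (x : Spacetime) :
    HasPartials (fun y => jetCurrentD κ α β σ (J y) (J' y))
      (fun l => jetCurrentDD l κ α β σ (J x) (J' x)) x :=
  have h := fun l μ l' μ' => (hJ.partials l μ x).mul (hJ'.partials l' μ' x)
  HasPartials.sum fun _ _ => (((h _ _ _ _).add (h _ _ _ _)).sub
    ((h _ _ _ _).add (h _ _ _ _))).const_mul _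

lemma IsWaveJet.currentDD_comm (hJ : IsWaveJet J) (hJ' : IsWaveJet J') (l κ α β σ : Fin 4)
    (x : Spacetime) :
    jetCurrentDD l κ α β σ (J x) (J' x) = jetCurrentDD κ l α β σ (J x) (J' x) := by
  refine Finset.sum_congr rfl fun ν _ => ?_
  have p1 : [l, κ].Perm [κ, l] := List.Perm.swap _ _ _
  have p2 : [l, κ, σ].Perm [κ, l, σ] := List.Perm.swap _ _ _
  rw [hJ.perm x _ _ _ p1, hJ.perm x _ _ _ p2, hJ'.perm x _ _ _ p1, hJ'.perm x _ _ _ p2]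
  ring

lemma IsWaveJet.sum_currentDD (hJ : IsWaveJet J) (hJ' : IsWaveJet J') (κ α β : Fin 4)
    (x : Spacetime) : ∑ l, (metric l : ℂ) * jetCurrentDD l κ α β l (J x) (J' x) = 0 := by
  simp only [jetCurrentDD]
  rw [sum_metric_mul_comm]
  refine Finset.sum_eq_zero fun ν _ => ?_
  have h1 := hJ.wave x [] (Fin.cons α ν)
  have h2 := hJ'.wave x [] (Fin.cons β ν)
  have h3 := hJ.wave x [κ] (Fin.cons α ν)
  have h4 := hJ'.wave x [κ] (Fin.cons β ν)
  have p1 : ∀ l : Fin 4, [κ, l].Perm [l, κ] := fun l => List.Perm.swap _ _ _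
  have p2 : ∀ l : Fin 4, [l, κ, l].Perm [l, l, κ] := fun l => (p1 l).cons l
  simp only [hJ.perm x _ _ _ (p1 _), hJ'.perm x _ _ _ (p1 _), hJ.perm x _ _ _ (p2 _),
    hJ'.perm x _ _ _ (p2 _)]
  rw [Fin.sum_univ_four] at h1 h2 h3 h4 ⊢
  linear_combination (raise ν * J x [κ] (Fin.cons α ν) : ℂ) * h2
    + (raise ν * J x [] (Fin.cons α ν) : ℂ) * h4
    - (raise ν * J' x [κ] (Fin.cons β ν) : ℂ) * h1
    - (raise ν * J' x [] (Fin.cons β ν) : ℂ) * h3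

/-- `∂_λ (A_μ ∂↔_ρ ∂↔_σ B^μ)` in terms of jets. -/
def jetFullD (l ρ σ : Fin 4) (J J' : Jet n) : ℂ :=
  ∑ μ : Index (n + 1), (raise μ : ℂ) *
    ((J [l] μ * J' [ρ, σ] μ + J [] μ * J' [l, ρ, σ] μ)
      - (J [l, ρ] μ * J' [σ] μ + J [ρ] μ * J' [l, σ] μ)
      - (J [l, σ] μ * J' [ρ] μ + J [σ] μ * J' [l, ρ] μ)
      + (J [l, ρ, σ] μ * J' [] μ + J [ρ, σ] μ * J' [l] μ))

lemma IsWaveJet.hasPartials_full (hJ : IsWaveJet J) (hJ' : IsWaveJet J') (ρ σ : Fin 4)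
    (x : Spacetime) :
    HasPartials (fun y => jetFull ρ σ (J y) (J' y))
      (fun l => jetFullD l ρ σ (J x) (J' x)) x :=
  have h := fun l l' μ => (hJ.partials l μ x).mul (hJ'.partials l' μ x)
  HasPartials.sum fun _ _ => ((((h _ _ _).sub (h _ _ _)).sub (h _ _ _)).add
    (h _ _ _)).const_mul _

/-- The leading term of the stress-energy tensor is conserved. -/
lemma IsWaveJet.sum_fullD (hJ : IsWaveJet J) (hJ' : IsWaveJet J') (σ : Fin 4)
    (x : Spacetime) : ∑ ρ, (metric ρ : ℂ) * jetFullD ρ ρ σ (J x) (J' x) = 0 := by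
  simp only [jetFullD]
  rw [sum_metric_mul_comm]
  refine Finset.sum_eq_zero fun μ _ => ?_
  have h1 := hJ.wave x [] μ
  have h2 := hJ'.wave x [] μ
  have h3 := hJ.wave x [σ] μ
  have h4 := hJ'.wave x [σ] μ
  rw [Fin.sum_univ_four] at h1 h2 h3 h4 ⊢
  linear_combination (-raise μ * J x [σ] μ : ℂ) * h2
    + (raise μ * J x [] μ : ℂ) * h4
    - (raise μ * J' x [σ] μ : ℂ) * h1
    + (raise μ * J' x [] μ : ℂ) * h3

/-- `∂_λ ∂_κ` of `jetSpin`. -/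
def jetSpinDD (l κ α β σ : Fin 4) (J J' : Jet n) : ℂ :=
  jetCurrentDD l κ α β σ J J' - jetCurrentDD l κ β α σ J J'

/-- The derivative `∂_l` of the classical stress-energy tensor. -/
def jetStressD (l ρ σ : Fin 4) (J J' : Jet n) : ℂ :=
  (-1) ^ (n + 1) * (-(1 / 4) * jetFullD l ρ σ J J'
    - ((n + 1 : ℕ) : ℂ) / 4 * ∑ κ, (metric κ : ℂ) *
      (jetSpinDD l κ ρ κ σ J J' + jetSpinDD l κ σ κ ρ J J'))

lemma IsWaveJet.hasPartials_stress (hJ : IsWaveJet J) (hJ' : IsWaveJet J') (ρ σ : Fin 4)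
    (x : Spacetime) :
    HasPartials (fun y => jetStress ρ σ (J y) (J' y))
      (fun l => jetStressD l ρ σ (J x) (J' x)) x := by
  have h := fun κ α β σ => (hJ.hasPartials_currentD hJ' κ α β σ x).sub
    (hJ.hasPartials_currentD hJ' κ β α σ x)
  exact (((hJ.hasPartials_full hJ' ρ σ x).const_mul _).sub ((HasPartials.sum fun κ _ =>
    ((h κ ρ κ σ).add (h κ σ κ ρ)).const_mul _).const_mul _)).const_mul _

/-- The classical stress-energy tensor is conserved: the first part and the part
`∂^ρ ∂^κ (A_σ ∂↔_ρ B_κ - …)` by the wave equation, the remaining part because it is the double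
divergence of an antisymmetric tensor. -/
lemma IsWaveJet.sum_stressD (hJ : IsWaveJet J) (hJ' : IsWaveJet J') (σ : Fin 4)
    (x : Spacetime) : ∑ ρ, (metric ρ : ℂ) * jetStressD ρ ρ σ (J x) (J' x) = 0 := by
  have h1 := hJ.sum_fullD hJ' σ x
  have h2 : ∑ ρ, (metric ρ : ℂ) * ∑ κ, (metric κ : ℂ) * jetSpinDD ρ κ ρ κ σ (J x) (J' x) = 0 := by
    have h : ∑ ρ, (metric ρ : ℂ) * ∑ κ, (metric κ : ℂ) * jetSpinDD ρ κ ρ κ σ (J x) (J' x) =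
        -∑ ρ, (metric ρ : ℂ) * ∑ κ, (metric κ : ℂ) * jetSpinDD ρ κ ρ κ σ (J x) (J' x) := by
      conv_lhs => rw [sum_metric_mul_comm]
      rw [← Finset.sum_neg_distrib]
      refine Finset.sum_congr rfl fun κ _ => ?_
      rw [← mul_neg, ← Finset.sum_neg_distrib]
      congr 1
      refine Finset.sum_congr rfl fun ρ _ => ?_
      simp only [jetSpinDD, hJ.currentDD_comm hJ' ρ κ]
      ring
    linear_combination h / 2
  have h3 : ∑ ρ, (metric ρ : ℂ) * ∑ κ, (metric κ : ℂ) * jetSpinDD ρ κ σ κ ρ (J x) (J' x) = 0 := by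
    rw [sum_metric_mul_comm]
    refine Finset.sum_eq_zero fun κ _ => ?_
    simp only [jetSpinDD, mul_sub, Finset.sum_sub_distrib, hJ.sum_currentDD hJ', sub_zero, mul_zero]
  have h4 : ∀ ρ, (metric ρ : ℂ) * jetStressD ρ ρ σ (J x) (J' x) =
      (-1) ^ (n + 1) * (-(1 / 4)) * ((metric ρ : ℂ) * jetFullD ρ ρ σ (J x) (J' x))
      + (-(-1) ^ (n + 1) * (((n + 1 : ℕ) : ℂ) / 4)) *
        ((metric ρ : ℂ) * ∑ κ, (metric κ : ℂ) * jetSpinDD ρ κ ρ κ σ (J x) (J' x))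
      + (-(-1) ^ (n + 1) * (((n + 1 : ℕ) : ℂ) / 4)) *
        ((metric ρ : ℂ) * ∑ κ, (metric κ : ℂ) * jetSpinDD ρ κ σ κ ρ (J x) (J' x)) := by
    intro ρ
    simp only [jetStressD, mul_add, Finset.sum_add_distrib]
    ring
  rw [Finset.sum_congr rfl fun ρ _ => h4 ρ, Finset.sum_add_distrib, Finset.sum_add_distrib,
    ← Finset.mul_sum, ← Finset.mul_sum, ← Finset.mul_sum, h1, h2, h3]
  simp

lemma jetStress_symm (hJ : IsWaveJet J) (hJ' : IsWaveJet J') (ρ σ : Fin 4) (x : Spacetime) :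
    jetStress ρ σ (J x) (J' x) = jetStress σ ρ (J x) (J' x) := by
  have p : [ρ, σ].Perm [σ, ρ] := List.Perm.swap _ _ _
  have h1 : jetFull ρ σ (J x) (J' x) = jetFull σ ρ (J x) (J' x) := by
    refine Finset.sum_congr rfl fun μ _ => ?_
    rw [hJ.perm x _ _ _ p, hJ'.perm x _ _ _ p]
    ring
  have h2 : jetImprovement ρ σ (J x) (J' x) = jetImprovement σ ρ (J x) (J' x) :=
    Finset.sum_congr rfl fun κ _ => by rw [add_comm]
  rw [jetStress, jetStress, h1, h2]

/-! ### The jets of the potential and the stress-energy tensor -/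

/-- The momentum space factor of an iterated derivative. -/
def multiplier (ε : ℝ) : List (Fin 4) → Space → ℂ
  | [] => fun _ => 1
  | κ :: l => derivAmplitude ε κ (multiplier ε l)

lemma multiplier_eq_prod (ε : ℝ) (l : List (Fin 4)) (p : Space) :
    multiplier ε l p = (l.map fun κ => -Complex.I * ε * lower (onShell p) κ).prod := by
  induction l with
  | nil => rfl
  | cons κ l ih => rw [multiplier, derivAmplitude, ih, List.map_cons, List.prod_cons]

lemma multiplier_perm (ε : ℝ) {l l' : List (Fin 4)} (h : l.Perm l') :
    multiplier ε l = multiplier ε l' := by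
  ext p
  rw [multiplier_eq_prod, multiplier_eq_prod]
  exact (h.map _).prod_eq

lemma smoothOffTip_multiplier (ε : ℝ) (l : List (Fin 4)) : SmoothOffTip (multiplier ε l) := by
  induction l with
  | nil => exact smoothOffTip_const 1
  | cons κ l ih => exact (smoothOffTip_derivFactor ε κ).mul ih

lemma sum_metric_multiplier (ε : ℝ) (l : List (Fin 4)) (p : Space) :
    ∑ κ, (metric κ : ℂ) * multiplier ε (κ :: κ :: l) p = 0 := by
  have h : ∀ κ, (metric κ : ℂ) * multiplier ε (κ :: κ :: l) p =
      (-Complex.I * ε * (-Complex.I * ε) * multiplier ε l p) *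
      ((metric κ : ℂ) * ((lower (onShell p) κ : ℂ) * (lower (onShell p) κ : ℂ))) := fun κ => by
    simp only [multiplier, derivAmplitude]; ring
  simp only [h, ← Finset.mul_sum, onShell_sq, mul_zero]

/-- The jet of the potential, or of its adjoint, in a one-particle vector. -/
def potentialJet (a : Bool × WaveFunction (n + 1)) (e x : Spacetime) : Jet n := fun l μ =>
  evalField a (multiplierPotential (multiplier 1 l) e μ x)

lemma rayMoment_sum {ι : Type*} [Fintype ι] (c : ι → ℂ) {K : ι → Space → ℂ}
    (hK : ∀ i, IsAmplitude (K i)) (m : ℕ) {e : Spacetime} (he : e ∈ spacelike) (x : Spacetime) :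
    ∑ i, c i * rayMoment m (wavePacket 1 (K i)) (x, e) =
      rayMoment m (wavePacket 1 fun p => ∑ i, c i * K i p) (x, e) := by
  simp only [rayMoment, ← integral_const_mul]
  rw [← integral_finsetSum]
  · refine integral_congr_ae (.of_forall fun s => ?_)
    simp only
    rw [wavePacket_sum fun i _ => (hK i).mul_left (smoothOffTip_const _), Finset.mul_sum]
    refine Finset.sum_congr rfl fun i _ => ?_
    rw [wavePacket_const_mul]; ring
  · intro i _
    exact (integrableOn_rayIntegrand ((hK i).rapidDecayOn (by norm_num))
      (continuous_wavePacket (hK i) 1) (z := (x, e)) he m).const_mul _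

lemma rayMoment_zero (m : ℕ) (z : Spacetime × Spacetime) :
    rayMoment m (wavePacket 1 fun _ => 0) z = 0 := by
  simp [rayMoment, wavePacket]

lemma sum_metric_multiplierPotential {e : Spacetime} (he : e ∈ spacelike) (l : List (Fin 4))
    (μ : Index (n + 1)) (x : Spacetime) (φ : WaveFunction (n + 1)) :
    ∑ κ, (metric κ : ℂ) * multiplierPotential (multiplier 1 (κ :: κ :: l)) e μ x φ = 0 := by
  simp only [multiplierPotential, Finset.mul_sum]
  rw [Finset.sum_comm]
  refine Finset.sum_eq_zero fun ν _ => ?_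
  have h := rayMoment_sum (fun κ : Fin 4 => (metric κ : ℂ))
    (fun κ => (isAmplitude_curlAmplitude φ μ ν).mul_left (smoothOffTip_multiplier 1 (κ :: κ :: l)))
    n he x
  have h2 : (fun p => ∑ κ, (metric κ : ℂ) * (multiplier 1 (κ :: κ :: l) p * curlAmplitude φ μ ν p)) =
      fun _ => 0 := by
    ext p
    simp only [← mul_assoc, ← Finset.sum_mul, sum_metric_multiplier, zero_mul]
  rw [h2, rayMoment_zero] at h
  calc _ = ((∏ i, (e (ν i) : ℂ)) * (n.factorial : ℂ)⁻¹) * ∑ κ, (metric κ : ℂ) *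
        rayMoment n (wavePacket 1 fun p => multiplier 1 (κ :: κ :: l) p * curlAmplitude φ μ ν p)
          (x, e) := by
        rw [Finset.mul_sum]; exact Finset.sum_congr rfl fun κ _ => by ring
    _ = 0 := by rw [h, mul_zero]

lemma isWaveJet_potentialJet (a : Bool × WaveFunction (n + 1)) {e : Spacetime}
    (he : e ∈ spacelike) : IsWaveJet (potentialJet a e) := by
  obtain ⟨b, φ⟩ := a
  refine ⟨fun l μ x => ?_, fun x l l' μ h => ?_, fun x l μ => ?_⟩
  · have h := hasPartials_multiplierPotential (smoothOffTip_multiplier 1 l) he μ φ x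
    cases b
    · exact h
    · exact h.conj
  · simp only [potentialJet, multiplier_perm 1 h]
  · have h := sum_metric_multiplierPotential he l μ x φ
    cases b
    · exact h
    · have h2 := congrArg (starRingEnd ℂ) h
      simpa [potentialJet, evalField] using h2

lemma potential_eq_multiplier {e : Spacetime} (he : e ∈ spacelike) (μ : Index (n + 1)) :
    potential e μ = multiplierPotential (multiplier 1 []) e μ := potential_eq he μ

lemma fieldDeriv_multiplier {e : Spacetime} (he : e ∈ spacelike) (l : List (Fin 4)) (κ : Fin 4)
    (μ : Index (n + 1)) :
    fieldDeriv κ (multiplierPotential (multiplier 1 l) e μ) =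
      multiplierPotential (multiplier 1 (κ :: l)) e μ :=
  fieldDeriv_multiplierPotential (smoothOffTip_multiplier 1 l) he μ κ

lemma wickProduct_eq (e e' : Spacetime) (l l' : List (Fin 4)) (μ μ' : Index (n + 1))
    (Ψ Φ : Fock (n + 1)) (x : Spacetime) :
    wickProduct (multiplierPotential (multiplier 1 l) e μ)
      (multiplierPotential (multiplier 1 l') e' μ') Ψ Φ x =
      ∑ i ∈ wickIndices Ψ Φ, wickCoeff Ψ Φ i *
        (potentialJet i.1 e x l μ * potentialJet i.2 e' x l' μ') :=
  wick_eq_indices _ _ _ _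

lemma wickProduct_comm {r : ℕ} (A B : Field r) (Ψ Φ : Fock r) (x : Spacetime) :
    wickProduct A B Ψ Φ x = wickProduct B A Ψ Φ x := wick_comm _ _ _ _

lemma fullBilinear_eq {e e' : Spacetime} (he : e ∈ spacelike) (he' : e' ∈ spacelike)
    (ρ σ : Fin 4) (Ψ Φ : Fock (n + 1)) (x : Spacetime) :
    fullBilinear e e' ρ σ Ψ Φ x = ∑ i ∈ wickIndices Ψ Φ, wickCoeff Ψ Φ i *
      jetFull ρ σ (potentialJet i.1 e x) (potentialJet i.2 e' x) := by
  simp only [fullBilinear, arrowArrow, potential_eq_multiplier he, potential_eq_multiplier he',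
    fieldDeriv_multiplier he, fieldDeriv_multiplier he', wickProduct_eq, jetFull]
  simp only [Finset.mul_sum, ← Finset.sum_sub_distrib, ← Finset.sum_add_distrib]
  rw [Finset.sum_comm]
  exact Finset.sum_congr rfl fun i _ => Finset.sum_congr rfl fun μ _ => by ring

lemma openBilinear_eq {e e' : Spacetime} (he : e ∈ spacelike) (he' : e' ∈ spacelike)
    (α β σ : Fin 4) (Ψ Φ : Fock (n + 1)) (x : Spacetime) :
    openBilinear e e' α β σ Ψ Φ x = ∑ i ∈ wickIndices Ψ Φ, wickCoeff Ψ Φ i *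
      jetCurrent α β σ (potentialJet i.1 e x) (potentialJet i.2 e' x) := by
  simp only [openBilinear, arrow, potential_eq_multiplier he, potential_eq_multiplier he',
    fieldDeriv_multiplier he, fieldDeriv_multiplier he', wickProduct_eq, jetCurrent]
  simp only [Finset.mul_sum, ← Finset.sum_sub_distrib]
  rw [Finset.sum_comm]
  exact Finset.sum_congr rfl fun i _ => Finset.sum_congr rfl fun μ _ => by ring

lemma openBilinear_swap (e e' : Spacetime) (α β σ : Fin 4) (Ψ Φ : Fock (n + 1)) (x : Spacetime) :
    openBilinear e' e α β σ Ψ Φ x = -openBilinear e e' β α σ Ψ Φ x := by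
  simp only [openBilinear, arrow]
  rw [← Finset.sum_neg_distrib]
  refine Finset.sum_congr rfl fun ν _ => ?_
  rw [wickProduct_comm (potential e' (Fin.cons α ν)),
    wickProduct_comm (fieldDeriv σ (potential e' (Fin.cons α ν)))]
  ring

/-- The stress-energy tensor as a combination of classical ones. -/
lemma stressTensor_eq {e e' : Spacetime} (he : e ∈ spacelike) (he' : e' ∈ spacelike)
    (ρ σ : Fin 4) (Ψ Φ : Fock (n + 1)) (x : Spacetime) :
    stressTensor e e' ρ σ Ψ Φ x = ∑ i ∈ wickIndices Ψ Φ, wickCoeff Ψ Φ i *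
      jetStress ρ σ (potentialJet i.1 e x) (potentialJet i.2 e' x) := by
  have h : ∀ κ, partialDeriv κ (fun y =>
        openBilinear e e' ρ κ σ Ψ Φ y + openBilinear e' e ρ κ σ Ψ Φ y
          + openBilinear e e' σ κ ρ Ψ Φ y + openBilinear e' e σ κ ρ Ψ Φ y) x =
      ∑ i ∈ wickIndices Ψ Φ, wickCoeff Ψ Φ i *
        (jetSpinD κ ρ κ σ (potentialJet i.1 e x) (potentialJet i.2 e' x)
          + jetSpinD κ σ κ ρ (potentialJet i.1 e x) (potentialJet i.2 e' x)) := by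
    intro κ
    have h1 : (fun y => openBilinear e e' ρ κ σ Ψ Φ y + openBilinear e' e ρ κ σ Ψ Φ y
          + openBilinear e e' σ κ ρ Ψ Φ y + openBilinear e' e σ κ ρ Ψ Φ y) = fun y =>
        ∑ i ∈ wickIndices Ψ Φ, wickCoeff Ψ Φ i *
        (jetSpin ρ κ σ (potentialJet i.1 e y) (potentialJet i.2 e' y)
          + jetSpin σ κ ρ (potentialJet i.1 e y) (potentialJet i.2 e' y)) := by
      ext y
      rw [openBilinear_swap e e', openBilinear_swap e e']
      simp only [openBilinear_eq he he', ← Finset.sum_neg_distrib, ← Finset.sum_add_distrib]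
      refine Finset.sum_congr rfl fun i _ => ?_
      simp only [jetSpin]; ring
    rw [h1]
    refine HasPartials.partialDeriv (f' := fun l => ∑ i ∈ wickIndices Ψ Φ, wickCoeff Ψ Φ i *
        (jetSpinD l ρ κ σ (potentialJet i.1 e x) (potentialJet i.2 e' x)
          + jetSpinD l σ κ ρ (potentialJet i.1 e x) (potentialJet i.2 e' x))) ?_ κ
    refine HasPartials.sum fun i _ => HasPartials.const_mul ?_ _
    have hJ := isWaveJet_potentialJet i.1 he
    have hJ' := isWaveJet_potentialJet i.2 he'
    exact (hJ.hasPartials_spin hJ' _ _ _ x).add (hJ.hasPartials_spin hJ' _ _ _ x)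
  simp only [stressTensor, h, fullBilinear_eq he he', jetStress, jetImprovement]
  have h2 : ∑ κ, (metric κ : ℂ) * ∑ i ∈ wickIndices Ψ Φ, wickCoeff Ψ Φ i *
        (jetSpinD κ ρ κ σ (potentialJet i.1 e x) (potentialJet i.2 e' x)
          + jetSpinD κ σ κ ρ (potentialJet i.1 e x) (potentialJet i.2 e' x)) =
      ∑ i ∈ wickIndices Ψ Φ, wickCoeff Ψ Φ i * ∑ κ, (metric κ : ℂ) *
        (jetSpinD κ ρ κ σ (potentialJet i.1 e x) (potentialJet i.2 e' x)
          + jetSpinD κ σ κ ρ (potentialJet i.1 e x) (potentialJet i.2 e' x)) := by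
    simp only [Finset.mul_sum]
    rw [Finset.sum_comm]
    exact Finset.sum_congr rfl fun i _ => Finset.sum_congr rfl fun κ _ => by ring
  rw [h2, Finset.mul_sum, Finset.mul_sum, ← Finset.sum_sub_distrib, Finset.mul_sum]
  exact Finset.sum_congr rfl fun i _ => by ring

lemma stressTensor_symm {e e' : Spacetime} (he : e ∈ spacelike) (he' : e' ∈ spacelike)
    (ρ σ : Fin 4) (Ψ Φ : Fock (n + 1)) (x : Spacetime) :
    stressTensor e e' ρ σ Ψ Φ x = stressTensor e e' σ ρ Ψ Φ x := by
  rw [stressTensor_eq he he', stressTensor_eq he he']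
  refine Finset.sum_congr rfl fun i _ => ?_
  rw [jetStress_symm (isWaveJet_potentialJet i.1 he) (isWaveJet_potentialJet i.2 he')]

lemma stressTensor_conserved {e e' : Spacetime} (he : e ∈ spacelike) (he' : e' ∈ spacelike)
    (σ : Fin 4) (Ψ Φ : Fock (n + 1)) (x : Spacetime) :
    ∑ ρ, (metric ρ : ℂ) * partialDeriv ρ (stressTensor e e' ρ σ Ψ Φ) x = 0 := by
  have h : ∀ ρ, partialDeriv ρ (stressTensor e e' ρ σ Ψ Φ) x =
      ∑ i ∈ wickIndices Ψ Φ, wickCoeff Ψ Φ i *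
        jetStressD ρ ρ σ (potentialJet i.1 e x) (potentialJet i.2 e' x) := by
    intro ρ
    rw [funext fun y => stressTensor_eq he he' ρ σ Ψ Φ y]
    refine HasPartials.partialDeriv (f' := fun l => ∑ i ∈ wickIndices Ψ Φ, wickCoeff Ψ Φ i *
      jetStressD l ρ σ (potentialJet i.1 e x) (potentialJet i.2 e' x)) ?_ ρ
    exact HasPartials.sum fun i _ => ((isWaveJet_potentialJet i.1 he).hasPartials_stress
      (isWaveJet_potentialJet i.2 he') ρ σ x).const_mul _
  simp only [h, Finset.mul_sum]
  rw [Finset.sum_comm]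
  refine Finset.sum_eq_zero fun i _ => ?_
  have h2 := (isWaveJet_potentialJet i.1 he).sum_stressD (isWaveJet_potentialJet i.2 he') σ x
  calc _ = wickCoeff Ψ Φ i * ∑ ρ, (metric ρ : ℂ) *
        jetStressD ρ ρ σ (potentialJet i.1 e x) (potentialJet i.2 e' x) := by
        rw [Finset.mul_sum]; exact Finset.sum_congr rfl fun ρ _ => by ring
    _ = 0 := by rw [h2, mul_zero]

/-- Pairs of spacelike directions, together with a point. -/
def spacelikeTriples : Set (Spacetime × Spacetime × Spacetime) :=
  {z | z.2.1 ∈ spacelike ∧ z.2.2 ∈ spacelike}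

lemma contDiffOn_potentialJet (a : Bool × WaveFunction (n + 1)) (l : List (Fin 4))
    (μ : Index (n + 1)) :
    ContDiffOn ℝ ∞ (fun z : Spacetime × Spacetime => potentialJet a z.2 z.1 l μ)
      spacelikePairs := by
  obtain ⟨b, φ⟩ := a
  have h := contDiffOn_multiplierPotential (smoothOffTip_multiplier 1 l) μ φ
  cases b
  · simpa only [potentialJet, evalField, Bool.false_eq_true, if_false] using h
  · have h2 := Complex.conjCLE.contDiff.comp_contDiffOn (n := ∞) h
    simpa only [potentialJet, evalField, if_true, Function.comp_def, Complex.conjCLE_apply] using h2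

lemma contDiffOn_stressTensor (Ψ Φ : Fock (n + 1)) (ρ σ : Fin 4) :
    ContDiffOn ℝ ∞ (fun z : Spacetime × Spacetime × Spacetime =>
      stressTensor z.2.1 z.2.2 ρ σ Ψ Φ z.1) spacelikeTriples := by
  have h1 : ∀ a l μ, ContDiffOn ℝ ∞ (fun z : Spacetime × Spacetime × Spacetime =>
      potentialJet (n := n) a z.2.1 z.1 l μ) spacelikeTriples := fun a l μ => by
    have h := (contDiffOn_potentialJet a l μ).comp (s := spacelikeTriples)
      (f := fun z : Spacetime × Spacetime × Spacetime => (z.1, z.2.1))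
      (contDiff_fst.prodMk (contDiff_fst.comp contDiff_snd)).contDiffOn fun z hz => hz.1
    simpa only [Function.comp_def] using h
  have h2 : ∀ a l μ, ContDiffOn ℝ ∞ (fun z : Spacetime × Spacetime × Spacetime =>
      potentialJet (n := n) a z.2.2 z.1 l μ) spacelikeTriples := fun a l μ => by
    have h := (contDiffOn_potentialJet a l μ).comp (s := spacelikeTriples)
      (f := fun z : Spacetime × Spacetime × Spacetime => (z.1, z.2.2))
      (contDiff_fst.prodMk (contDiff_snd.comp contDiff_snd)).contDiffOn fun z hz => hz.2
    simpa only [Function.comp_def] using h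
  have h3 : ∀ (i : WickIndex (n + 1)) (B : Jet n → Jet n → ℂ), IsJetForm B → ContDiffOn ℝ ∞
      (fun z : Spacetime × Spacetime × Spacetime =>
        B (potentialJet i.1 z.2.1 z.1) (potentialJet i.2 z.2.2 z.1)) spacelikeTriples := by
    intro i B hB
    induction hB with
    | mul l μ l' μ' => exact (h1 _ _ _).mul (h2 _ _ _)
    | add _ _ ih ih' => exact ih.add ih'
    | const_mul c _ ih => exact contDiffOn_const.mul ih
  have h : ContDiffOn ℝ ∞ (fun z : Spacetime × Spacetime × Spacetime =>
      ∑ i ∈ wickIndices Ψ Φ, wickCoeff Ψ Φ i *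
      jetStress ρ σ (potentialJet i.1 z.2.1 z.1) (potentialJet i.2 z.2.2 z.1)) spacelikeTriples :=
    ContDiffOn.sum fun i _ => contDiffOn_const.mul (h3 i _ (isJetForm_stress ρ σ))
  exact h.congr fun z hz => stressTensor_eq hz.1 hz.2 ρ σ Ψ Φ z.1

end

section

variable {n : ℕ}

/-! ### Averages of Wick bilinears over the string directions -/

/-- The iterated integrals defining `average c c' G` converge, with value `v`. -/
def HasAverage (c c' : Spacetime → ℂ) (G : Spacetime → Spacetime → ℂ) (v : ℂ) : Prop :=
  (∀ e, Integrable fun e' => c e * c' e' * G e e') ∧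
    Integrable (fun e => ∫ e', c e * c' e' * G e e') ∧ average c c' G = v

section

variable {c c' : Spacetime → ℂ} {G G' : Spacetime → Spacetime → ℂ} {v v' : ℂ}

lemma HasAverage.add (h : HasAverage c c' G v) (h' : HasAverage c c' G' v') :
    HasAverage c c' (fun e e' => G e e' + G' e e') (v + v') := by
  have h1 : ∀ e, ∫ e', c e * c' e' * (G e e' + G' e e') =
      (∫ e', c e * c' e' * G e e') + ∫ e', c e * c' e' * G' e e' := fun e => by
    simp only [mul_add]
    exact integral_add (h.1 e) (h'.1 e)
  refine ⟨fun e => ?_, ?_, ?_⟩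
  · simp only [mul_add]
    exact (h.1 e).add (h'.1 e)
  · simp only [h1]
    exact h.2.1.add h'.2.1
  · rw [average, integral_congr_ae (.of_forall h1), integral_add h.2.1 h'.2.1, ← h.2.2, ← h'.2.2]
    rfl

lemma HasAverage.const_mul (h : HasAverage c c' G v) (a : ℂ) :
    HasAverage c c' (fun e e' => a * G e e') (a * v) := by
  have h1 : ∀ e, ∫ e', c e * c' e' * (a * G e e') = a * ∫ e', c e * c' e' * G e e' := fun e => by
    rw [← integral_const_mul]
    exact integral_congr_ae (.of_forall fun e' => by ring)
  refine ⟨fun e => ?_, ?_, ?_⟩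
  · exact ((h.1 e).const_mul a).congr (.of_forall fun e' => by ring)
  · simp only [h1]
    exact h.2.1.const_mul a
  · rw [average, integral_congr_ae (.of_forall h1), integral_const_mul, ← h.2.2]
    rfl

lemma HasAverage.sum {ι : Type*} {s : Finset ι} {G : ι → Spacetime → Spacetime → ℂ} {v : ι → ℂ}
    (h : ∀ i ∈ s, HasAverage c c' (G i) (v i)) :
    HasAverage c c' (fun e e' => ∑ i ∈ s, G i e e') (∑ i ∈ s, v i) := by
  classical
  induction s using Finset.induction_on with
  | empty => exact ⟨fun e => by simp, by simp, by simp [average]⟩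
  | insert i s hi ih =>
    simp only [Finset.sum_insert hi]
    exact (h i (Finset.mem_insert_self i s)).add
      (ih fun j hj => h j (Finset.mem_insert_of_mem hj))

lemma hasAverage_mul {u w : Spacetime → ℂ} (hu : Integrable fun e => c e * u e)
    (hw : Integrable fun e => c' e * w e) :
    HasAverage c c' (fun e e' => u e * w e') ((∫ e, c e * u e) * ∫ e, c' e * w e) := by
  have h : ∀ e e', c e * c' e' * (u e * w e') = c e * u e * (c' e' * w e') := fun e e' => by ring
  refine ⟨fun e => ?_, ?_, ?_⟩ <;> simp only [average, h, integral_const_mul, integral_mul_const]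
  · exact hw.const_mul _
  · exact hu.mul_const _

/-- Only the spacelike directions matter for an average with string test functions. -/
lemma HasAverage.congr (h : HasAverage c c' G v) (hc : IsStringTest c) (hc' : IsStringTest c')
    (hG : ∀ e ∈ spacelike, ∀ e' ∈ spacelike, G e e' = G' e e') : HasAverage c c' G' v := by
  have h0 : ∀ {c : Spacetime → ℂ}, IsStringTest c → ∀ e ∉ spacelike, c e = 0 := fun hc e he =>
    image_eq_zero_of_notMem_tsupport fun h => he (hc.2.2 h)
  have : ∀ e e', c e * c' e' * G e e' = c e * c' e' * G' e e' := by
    intro e e'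
    by_cases he : e ∈ spacelike
    · by_cases he' : e' ∈ spacelike
      · rw [hG e he e' he']
      · simp [h0 hc' e' he']
    · simp [h0 hc e he]
  simpa only [HasAverage, average, this] using h

end

/-! ### Jets of wave packets -/

/-- The jet of the tensor of wave packets with the amplitudes `K`. -/
def packetJet (ε : ℝ) (K : Index (n + 1) → Space → ℂ) (x : Spacetime) : Jet n := fun l μ =>
  wavePacket ε (fun p => multiplier ε l p * K μ p) x

/-- The sign of the frequency of a field (`false`) or of its adjoint (`true`). -/
def frequency (b : Bool) : ℝ := if b then -1 else 1

/-- The amplitude of the averaged potential, or of its adjoint, in a one-particle vector. -/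
def averagedTensor (c : Spacetime → ℂ) (a : Bool × WaveFunction (n + 1)) (μ : Index (n + 1))
    (p : Space) : ℂ :=
  if a.1 then conj (averagedAmplitude (fun e => conj (c e)) a.2 μ p) else averagedAmplitude c a.2 μ p

lemma IsStringTest.conj {c : Spacetime → ℂ} (hc : IsStringTest c) :
    IsStringTest fun e => conj (c e) := by
  refine ⟨Complex.conjCLE.contDiff.comp hc.1, hc.2.1.comp_left (g := conj) (map_zero _),
    (tsupport_comp_subset (map_zero (starRingEnd ℂ)) c).trans hc.2.2⟩

lemma isAmplitude_averagedTensor {c : Spacetime → ℂ} (hc : IsStringTest c)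
    (a : Bool × WaveFunction (n + 1)) (μ : Index (n + 1)) :
    IsAmplitude (averagedTensor c a μ) := by
  obtain ⟨b, φ⟩ := a
  cases b
  · exact isAmplitude_averagedAmplitude hc.isBump φ μ
  · exact (isAmplitude_averagedAmplitude hc.conj.isBump φ μ).conj

lemma conj_multiplier (l : List (Fin 4)) (p : Space) :
    conj (multiplier 1 l p) = multiplier (-1) l p := by
  induction l with
  | nil => simp [multiplier]
  | cons κ l ih => simp [multiplier, derivAmplitude, ih]

/-- Averaging the jet of the potential over the string direction gives the jet of a wave packet. -/
lemma integral_mul_potentialJet {c : Spacetime → ℂ} (hc : IsStringTest c)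
    (a : Bool × WaveFunction (n + 1)) (x : Spacetime) (l : List (Fin 4)) (μ : Index (n + 1)) :
    ∫ e, c e * potentialJet a e x l μ = packetJet (frequency a.1) (averagedTensor c a) x l μ := by
  obtain ⟨b, φ⟩ := a
  cases b
  · exact integral_mul_multiplierPotential hc (smoothOffTip_multiplier 1 l) μ φ x
  · have h := congrArg (starRingEnd ℂ)
      (integral_mul_multiplierPotential hc.conj (smoothOffTip_multiplier 1 l) μ φ x)
    rw [← integral_conj, conj_wavePacket] at h
    simpa only [potentialJet, evalField, if_true, packetJet, frequency, averagedTensor, map_mul,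
      Complex.conj_conj, conj_multiplier] using h

lemma integrable_mul_potentialJet {c : Spacetime → ℂ} (hc : IsStringTest c)
    (a : Bool × WaveFunction (n + 1)) (x : Spacetime) (l : List (Fin 4)) (μ : Index (n + 1)) :
    Integrable fun e => c e * potentialJet a e x l μ := by
  refine hc.integrable_mul ?_
  have h := (contDiffOn_potentialJet a l μ).continuousOn.comp (s := spacelike)
    (f := fun e : Spacetime => (x, e)) (by fun_prop) fun _ he => he
  simpa only [Function.comp_def] using h

lemma IsJetForm.hasAverage {B : Jet n → Jet n → ℂ} (hB : IsJetForm B) {c c' : Spacetime → ℂ}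
    (hc : IsStringTest c) (hc' : IsStringTest c') (a b : Bool × WaveFunction (n + 1))
    (x : Spacetime) :
    HasAverage c c' (fun e e' => B (potentialJet a e x) (potentialJet b e' x))
      (B (packetJet (frequency a.1) (averagedTensor c a) x)
        (packetJet (frequency b.1) (averagedTensor c' b) x)) := by
  induction hB with
  | mul l μ l' μ' =>
    simp only [← integral_mul_potentialJet hc, ← integral_mul_potentialJet hc']
    exact hasAverage_mul (integrable_mul_potentialJet hc a x l μ)
      (integrable_mul_potentialJet hc' b x l' μ')
  | add _ _ ih ih' => exact ih.add ih'
  | const_mul k _ ih => exact ih.const_mul k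

/-- The value of a form in the averaged potentials. -/
def averagedForm (c c' : Spacetime → ℂ) (B : Jet n → Jet n → ℂ) (i : WickIndex (n + 1))
    (x : Spacetime) : ℂ :=
  B (packetJet (frequency i.1.1) (averagedTensor c i.1) x)
    (packetJet (frequency i.2.1) (averagedTensor c' i.2) x)

lemma IsJetForm.hasAverage_wick {B : Jet n → Jet n → ℂ} (hB : IsJetForm B)
    {c c' : Spacetime → ℂ} (hc : IsStringTest c) (hc' : IsStringTest c') (Ψ Φ : Fock (n + 1))
    (x : Spacetime) :
    HasAverage c c' (fun e e' => ∑ i ∈ wickIndices Ψ Φ, wickCoeff Ψ Φ i *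
        B (potentialJet i.1 e x) (potentialJet i.2 e' x))
      (∑ i ∈ wickIndices Ψ Φ, wickCoeff Ψ Φ i * averagedForm c c' B i x) :=
  HasAverage.sum fun i _ => (hB.hasAverage hc hc' i.1 i.2 x).const_mul _

section

variable {c c' : Spacetime → ℂ} (Ψ Φ : Fock (n + 1)) (x : Spacetime)

lemma averagedStressTensor_eq (hc : IsStringTest c) (hc' : IsStringTest c') (ρ σ : Fin 4) :
    averagedStressTensor c c' ρ σ Ψ Φ x =
      ∑ i ∈ wickIndices Ψ Φ, wickCoeff Ψ Φ i * averagedForm c c' (jetStress ρ σ) i x :=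
  (((isJetForm_stress ρ σ).hasAverage_wick hc hc' Ψ Φ x).congr hc hc' fun _ he _ he' =>
    (stressTensor_eq he he' ρ σ Ψ Φ x).symm).2.2

/-- The form of the density of `P_σ`. -/
def jetMomentum (σ : Fin 4) (J J' : Jet n) : ℂ := (-1) ^ (n + 1) * (-(1 / 4) * jetFull 0 σ J J')

/-- The form of the density of `M_{στ}` at the point `x`. -/
def jetLorentz (x : Spacetime) (σ τ : Fin 4) (J J' : Jet n) : ℂ :=
  (lower x σ : ℂ) * jetMomentum τ J J' - (lower x τ : ℂ) * jetMomentum σ J J'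
    - (-1) ^ (n + 1) * ((n + 1 : ℕ) : ℂ) / 2 * jetSpin σ τ 0 J J'

lemma isJetForm_momentum (σ : Fin 4) : IsJetForm (jetMomentum (n := n) σ) :=
  ((isJetForm_full 0 σ).const_mul _).const_mul _

lemma isJetForm_lorentz (σ τ : Fin 4) : IsJetForm (jetLorentz (n := n) x σ τ) :=
  (((isJetForm_momentum τ).const_mul _).sub ((isJetForm_momentum σ).const_mul _)).sub
    ((isJetForm_spin σ τ 0).const_mul _)

lemma averagedMomentumDensity_eq (hc : IsStringTest c) (hc' : IsStringTest c') (σ : Fin 4) :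
    averagedMomentumDensity c c' σ Ψ Φ x =
      ∑ i ∈ wickIndices Ψ Φ, wickCoeff Ψ Φ i * averagedForm c c' (jetMomentum σ) i x := by
  refine (((isJetForm_momentum σ).hasAverage_wick hc hc' Ψ Φ x).congr hc hc' fun e he e' he' =>
    ?_).2.2
  rw [momentumDensity, fullBilinear_eq he he', Finset.mul_sum, Finset.mul_sum]
  exact Finset.sum_congr rfl fun i _ => by rw [jetMomentum]; ring

lemma averagedLorentzDensity_eq (hc : IsStringTest c) (hc' : IsStringTest c') (σ τ : Fin 4) :
    averagedLorentzDensity c c' σ τ Ψ Φ x =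
      ∑ i ∈ wickIndices Ψ Φ, wickCoeff Ψ Φ i * averagedForm c c' (jetLorentz x σ τ) i x := by
  refine (((isJetForm_lorentz x σ τ).hasAverage_wick hc hc' Ψ Φ x).congr hc hc' fun e he e' he' =>
    ?_).2.2
  rw [lorentzDensity, fullBilinear_eq he he', fullBilinear_eq he he', openBilinear_eq he he',
    openBilinear_eq he he']
  simp only [Finset.mul_sum, ← Finset.sum_sub_distrib]
  exact Finset.sum_congr rfl fun i _ => by
    simp only [jetLorentz, jetMomentum, jetSpin]; ring

end

lemma isWaveJet_packetJet {ε : ℝ} {K : Index (n + 1) → Space → ℂ} (hK : ∀ μ, IsAmplitude (K μ)) :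
    IsWaveJet (packetJet ε K) := by
  refine ⟨fun l μ x => ?_, fun x l l' μ h => ?_, fun x l μ => ?_⟩
  · have h := hasFDerivAt_wavePacket ((hK μ).mul_left (smoothOffTip_multiplier ε l)) ε x
    have h2 : ∀ κ, wavePacket ε (derivAmplitude ε κ fun p => multiplier ε l p * K μ p) x =
        packetJet ε K x (κ :: l) μ := fun κ => by
      rw [packetJet]
      congr 1
      ext p
      simp only [multiplier, derivAmplitude]; ring
    simp only [h2] at h
    exact h
  · simp only [packetJet, multiplier_perm ε h]
  · have hA := fun κ => (hK μ).mul_left (smoothOffTip_multiplier ε (κ :: κ :: l))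
    simp only [packetJet, ← wavePacket_const_mul]
    rw [← wavePacket_sum fun κ _ => (hA κ).mul_left (smoothOffTip_const _)]
    simp only [← mul_assoc, ← Finset.sum_mul, sum_metric_multiplier, zero_mul]
    simp [wavePacket]

end

section

/-! ### Wave packets at a fixed time -/

open scoped FourierTransform SchwartzMap RealInnerProductSpace in
section

/-- The amplitude of a wave packet at time `t`. -/
def sliceAmplitude (ε t : ℝ) (K : Space → ℂ) (p : Space) : ℂ :=
  phase ε (onShell p) (fourVector t 0) * K p

variable {K K' : Space → ℂ}

lemma IsAmplitude.sliceAmplitude (hK : IsAmplitude K) (ε t : ℝ) :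
    IsAmplitude (sliceAmplitude ε t K) := hK.mul_left (smoothOffTip_phase ε _)

/-- An amplitude as a Schwartz function. -/
def IsAmplitude.toSchwartz (hK : IsAmplitude K) : 𝓢(Space, ℂ) :=
  hK.compact.toSchwartzMap hK.smooth

lemma IsAmplitude.toSchwartz_coe (hK : IsAmplitude K) : (hK.toSchwartz : Space → ℂ) = K := rfl

lemma phase_fourVector (ε t : ℝ) (p y : Space) :
    phase ε (onShell p) (fourVector t y) =
      phase ε (onShell p) (fourVector t 0) * Complex.exp (((ε * ⟪p, y⟫ : ℝ) : ℂ) * Complex.I) := by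
  rw [phase, phase, ← Complex.exp_add]
  congr 1
  simp [minkowski, onShell, fourVector, Fin.sum_univ_succ, metric, PiLp.inner_apply]
  ring

lemma wavePacket_one_slice (hK : IsAmplitude K) (t : ℝ) (y : Space) :
    wavePacket 1 K (fourVector t y) =
      𝓕⁻ (hK.sliceAmplitude 1 t).toSchwartz ((2 * Real.pi)⁻¹ • y) := by
  rw [SchwartzMap.fourierInv_coe, IsAmplitude.toSchwartz_coe, Real.fourierInv_eq', wavePacket]
  refine integral_congr_ae (.of_forall fun p => ?_)
  simp only [sliceAmplitude, inner_smul_right, smul_eq_mul]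
  rw [phase_fourVector 1 t p y, mul_inv_cancel_left₀ (by positivity), one_mul]
  ring

lemma wavePacket_neg_one_slice (hK : IsAmplitude K) (t : ℝ) (y : Space) :
    wavePacket (-1) K (fourVector t y) =
      𝓕 (hK.sliceAmplitude (-1) t).toSchwartz ((2 * Real.pi)⁻¹ • y) := by
  rw [SchwartzMap.fourier_coe, IsAmplitude.toSchwartz_coe, Real.fourier_eq', wavePacket]
  refine integral_congr_ae (.of_forall fun p => ?_)
  have h : -2 * Real.pi * ((2 * Real.pi)⁻¹ * ⟪p, y⟫) = -1 * ⟪p, y⟫ := by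
    field_simp
  simp only [sliceAmplitude, inner_smul_right, smul_eq_mul, h]
  rw [phase_fourVector (-1) t p y]
  ring

lemma integrable_wavePacket_slice (hK : IsAmplitude K) {ε : ℝ} (hε : ε * ε = 1) (t : ℝ) :
    Integrable fun y : Space => wavePacket ε K (fourVector t y) := by
  have hc : (2 * Real.pi)⁻¹ ≠ 0 := by positivity
  rcases mul_self_eq_one_iff.1 hε with rfl | rfl
  · simp only [wavePacket_one_slice hK]
    exact (SchwartzMap.integrable _).comp_smul hc
  · simp only [wavePacket_neg_one_slice hK]
    exact (SchwartzMap.integrable _).comp_smul hc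

lemma integral_wavePacket_neg_one_mul (hK : IsAmplitude K) (hK' : IsAmplitude K') (t : ℝ) :
    ∫ y : Space, wavePacket (-1) K (fourVector t y) * wavePacket 1 K' (fourVector t y) =
      (2 * Real.pi) ^ 3 * ∫ p, K p * K' p := by
  simp only [wavePacket_neg_one_slice hK, wavePacket_one_slice hK']
  rw [Measure.integral_comp_smul volume (fun w =>
    𝓕 (hK.sliceAmplitude (-1) t).toSchwartz w * 𝓕⁻ (hK'.sliceAmplitude 1 t).toSchwartz w),
    SchwartzMap.integral_fourier_mul_eq, FourierTransform.fourier_fourierInv_eq]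
  have h1 : |((2 * Real.pi)⁻¹ ^ Module.finrank ℝ Space)⁻¹| = (2 * Real.pi) ^ 3 := by
    rw [finrank_euclideanSpace, Fintype.card_fin, inv_pow, inv_inv]
    exact abs_of_pos (by positivity)
  rw [h1, Complex.real_smul]
  push_cast
  congr 1
  refine integral_congr_ae (.of_forall fun p => ?_)
  have h2 : phase (-1) (onShell p) (fourVector t 0) * phase 1 (onShell p) (fourVector t 0) = 1 := by
    rw [phase, phase, ← Complex.exp_add]
    simp
  simp only [IsAmplitude.toSchwartz_coe, sliceAmplitude]
  linear_combination (K p * K' p) * h2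

/-- Plancherel's theorem for two wave packets of opposite frequencies. -/
lemma integral_wavePacket_mul (hK : IsAmplitude K) (hK' : IsAmplitude K') {ε : ℝ}
    (hε : ε * ε = 1) (t : ℝ) :
    ∫ y : Space, wavePacket (-ε) K (fourVector t y) * wavePacket ε K' (fourVector t y) =
      (2 * Real.pi) ^ 3 * ∫ p, K p * K' p := by
  rcases mul_self_eq_one_iff.1 hε with rfl | rfl
  · exact integral_wavePacket_neg_one_mul hK hK' t
  · simp only [neg_neg, mul_comm (wavePacket 1 _ _), mul_comm (K _)]
    exact integral_wavePacket_neg_one_mul hK' hK t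

/-- The amplitude which represents a wave packet at time `t` as one of the opposite frequency. -/
def reflect (ε t : ℝ) (K : Space → ℂ) (p : Space) : ℂ :=
  phase ε (onShell p) (fourVector (2 * t) 0) * K (-p)

lemma IsAmplitude.comp_neg (hK : IsAmplitude K) : IsAmplitude fun p => K (-p) := by
  refine ⟨hK.smooth.comp contDiff_neg, hK.compact.comp_homeomorph (Homeomorph.neg Space), ?_⟩
  rw [notMem_tsupport_iff_eventuallyEq]
  have h := notMem_tsupport_iff_eventuallyEq.1 hK.off_tip
  have h2 : Filter.Tendsto (fun p : Space => -p) (nhds 0) (nhds 0) := by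
    simpa using (continuous_neg (G := Space)).tendsto 0
  exact h2.eventually h

lemma IsAmplitude.reflect (hK : IsAmplitude K) (ε t : ℝ) : IsAmplitude (reflect ε t K) :=
  hK.comp_neg.mul_left (smoothOffTip_phase ε _)

lemma wavePacket_reflect (K : Space → ℂ) (ε t : ℝ) (y : Space) :
    wavePacket ε K (fourVector t y) = wavePacket (-ε) (reflect ε t K) (fourVector t y) := by
  rw [wavePacket, wavePacket, ← integral_neg_eq_self]
  refine integral_congr_ae (.of_forall fun p => ?_)
  simp only [reflect]
  rw [mul_right_comm, mul_comm (K (-p))]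
  congr 1
  rw [phase, phase, phase, ← Complex.exp_add]
  congr 1
  simp [minkowski, onShell, fourVector, Fin.sum_univ_succ, metric]
  ring

end

/-! ### Bilinear forms at a fixed time -/

section

variable {K K' : Space → ℂ} {ε δ : ℝ}

lemma continuous_fourVector (t : ℝ) : Continuous fun y : Space => fourVector t y := by
  refine continuous_pi fun κ => Fin.cases ?_ (fun j => ?_) κ
  · exact continuous_const
  · simp only [fourVector, Fin.cons_succ]
    fun_prop

lemma integrable_wavePacket_mul (hK : IsAmplitude K) (hK' : IsAmplitude K')
    (hδ : δ * δ = 1) (t : ℝ) :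
    Integrable fun y : Space =>
      wavePacket ε K (fourVector t y) * wavePacket δ K' (fourVector t y) := by
  refine (integrable_wavePacket_slice hK' hδ t).bdd_mul (c := ∫ p, ‖K p‖) ?_ ?_
  · have h := (continuous_wavePacket hK ε).comp (continuous_fourVector t)
    exact Continuous.aestronglyMeasurable (by simpa only [Function.comp_def] using h)
  · exact .of_forall fun y => norm_wavePacket_le _ _ _

lemma integrable_lower_mul_wavePacket_mul (hK : IsAmplitude K) (hK' : IsAmplitude K')
    (hδ : δ * δ = 1) (t : ℝ) (l : Fin 4) :
    Integrable fun y : Space => (lower (fourVector t y) l : ℂ) *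
      (wavePacket ε K (fourVector t y) * wavePacket δ K' (fourVector t y)) := by
  simp only [mul_left_comm (lower _ l : ℂ), lower_mul_wavePacket hK' hδ]
  exact integrable_wavePacket_mul hK (hK'.positionAmplitude δ t l) hδ t

variable {n : ℕ} {B : Jet n → Jet n → ℂ} {T T' : Index (n + 1) → Space → ℂ}

lemma IsJetForm.integrable_slice (hB : IsJetForm B) (hT : ∀ μ, IsAmplitude (T μ))
    (hT' : ∀ μ, IsAmplitude (T' μ)) (hδ : δ * δ = 1) (t : ℝ) :
    Integrable fun y : Space =>
      B (packetJet ε T (fourVector t y)) (packetJet δ T' (fourVector t y)) := by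
  induction hB with
  | mul l μ l' μ' =>
    exact integrable_wavePacket_mul ((hT μ).mul_left (smoothOffTip_multiplier ε l))
      ((hT' μ').mul_left (smoothOffTip_multiplier δ l')) hδ t
  | add _ _ ih ih' => exact ih.add ih'
  | const_mul k _ ih => exact ih.const_mul k

lemma IsJetForm.integrable_lower_slice (hB : IsJetForm B) (hT : ∀ μ, IsAmplitude (T μ))
    (hT' : ∀ μ, IsAmplitude (T' μ)) (hδ : δ * δ = 1) (t : ℝ) (l : Fin 4) :
    Integrable fun y : Space => (lower (fourVector t y) l : ℂ) *
      B (packetJet ε T (fourVector t y)) (packetJet δ T' (fourVector t y)) := by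
  induction hB with
  | mul m μ m' μ' =>
    exact integrable_lower_mul_wavePacket_mul ((hT μ).mul_left (smoothOffTip_multiplier ε m))
      ((hT' μ').mul_left (smoothOffTip_multiplier δ m')) hδ t l
  | add _ _ ih ih' =>
    simp only [mul_add]
    exact ih.add ih'
  | const_mul k _ ih => simpa only [mul_left_comm k] using ih.const_mul k

/-! ### The improvement term does not contribute to momentum and reduces to spin -/

lemma hasPartials_lower (l : Fin 4) (x : Spacetime) :
    HasPartials (fun y => (lower y l : ℂ)) (fun κ => (eta l κ : ℂ)) x := by
  have h : (fun y : Spacetime => (lower y l : ℂ)) = fun y => ((metric l : ℝ) : ℂ) * coordForm l y := by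
    ext y; simp [lower, coordForm]
  rw [h]
  refine ((coordForm l).hasFDerivAt.const_mul _).congr_fderiv ?_
  ext v
  simp only [sum_apply, smul_apply, smul_eq_mul, eta, apply_ite (fun x : ℝ => (x : ℂ)), ite_mul,
    Complex.ofReal_zero, zero_mul, Finset.sum_ite_eq, Finset.mem_univ, if_true]

/-- The integral of a spatial derivative vanishes. -/
lemma integral_partial_slice {f : Spacetime → ℂ} {f' : Spacetime → Fin 4 → ℂ}
    (hf : ∀ x, HasPartials f (f' x) x) (t : ℝ) (j : Fin 3)
    (hi : Integrable fun y : Space => f (fourVector t y))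
    (hi' : Integrable fun y : Space => f' (fourVector t y) j.succ) :
    ∫ y : Space, f' (fourVector t y) j.succ = 0 := by
  have hv : ∀ y : Space, HasFDerivAt (fun y : Space => fourVector t y)
      (ContinuousLinearMap.pi fun κ : Fin 4 => Fin.cases (0 : Space →L[ℝ] ℝ)
        (fun i => EuclideanSpace.proj i) κ) y := fun y => by
    rw [hasFDerivAt_pi]
    refine fun κ => Fin.cases ?_ (fun i => ?_) κ
    · exact hasFDerivAt_const _ _
    · exact (EuclideanSpace.proj i : Space →L[ℝ] ℝ).hasFDerivAt
  have hd := fun y => HasFDerivAt.comp (f := fun y : Space => fourVector t y) y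
    (hf (fourVector t y)) (hv y)
  simp only [Function.comp_def] at hd
  have h2 : ∀ y : Space, fderiv ℝ (fun y : Space => f (fourVector t y)) y
      (EuclideanSpace.single j 1) = f' (fourVector t y) j.succ := fun y => by
    rw [(hd y).fderiv]
    have h4 : ∀ κ, (Fin.cases (0 : Space →L[ℝ] ℝ) (fun i => EuclideanSpace.proj i) κ :
        Space →L[ℝ] ℝ) (EuclideanSpace.single j 1) = if κ = j.succ then 1 else 0 := fun κ =>
      Fin.cases (by simp [(Fin.succ_ne_zero j).symm]) (fun i => by simp) κ
    simp [coordForm, h4, apply_ite (fun x : ℝ => (x : ℂ))]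
  have h3 := integral_mul_fderiv_eq_neg_fderiv_mul_of_integrable (𝕜 := ℂ) (μ := volume)
    (f := fun _ : Space => (1 : ℂ)) (g := fun y : Space => f (fourVector t y))
    (v := EuclideanSpace.single j 1) (by simp) (by simpa [h2] using hi') (by simpa using hi)
    (fun _ _ => differentiableAt_const _) (fun y _ => (hd y).differentiableAt)
  simpa [h2] using h3

/-- The first moment of a spatial derivative: integration by parts. -/
lemma integral_lower_mul_partial_slice {f : Spacetime → ℂ} {f' : Spacetime → Fin 4 → ℂ}
    (hf : ∀ x, HasPartials f (f' x) x) (t : ℝ) (l : Fin 4) (j : Fin 3)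
    (hi : Integrable fun y : Space => f (fourVector t y))
    (hi' : Integrable fun y : Space => (lower (fourVector t y) l : ℂ) * f (fourVector t y))
    (hi2 : Integrable fun y : Space =>
      (lower (fourVector t y) l : ℂ) * f' (fourVector t y) j.succ) :
    ∫ y : Space, (lower (fourVector t y) l : ℂ) * f' (fourVector t y) j.succ =
      -eta l j.succ * ∫ y : Space, f (fourVector t y) := by
  have h := integral_partial_slice (fun x => (hasPartials_lower l x).mul (hf x)) t j hi'
    ((hi.const_mul _).add hi2)
  rw [integral_add (hi.const_mul _) hi2, integral_const_mul] at h
  linear_combination h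

end

end

section

/-! ### The moments of the improvement term -/

lemma integrable_sub_sub {f g h : Space → ℂ} (hf : Integrable f) (hg : Integrable g)
    (hh : Integrable h) : Integrable fun x => f x - g x - h x := (hf.sub hg).sub hh

lemma integral_sub_sub {f g h : Space → ℂ} (hf : Integrable f) (hg : Integrable g)
    (hh : Integrable h) :
    ∫ x, (f x - g x - h x) = (∫ x, f x) - (∫ x, g x) - ∫ x, h x := by
  have h1 : Integrable fun x => f x - g x := hf.sub hg
  rw [integral_sub h1 hh, integral_sub hf hg]

section

variable {n : ℕ} {ε δ : ℝ} {T T' : Index (n + 1) → Space → ℂ}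

/-- The integral of `jetSpin` over the time slice, for two tensors of wave packets. -/
def spinCharge (ε δ t : ℝ) (T T' : Index (n + 1) → Space → ℂ) (α β σ : Fin 4) : ℂ :=
  ∫ y : Space, jetSpin α β σ (packetJet ε T (fourVector t y)) (packetJet δ T' (fourVector t y))

lemma spinCharge_antisymm (t : ℝ) (α β σ : Fin 4) :
    spinCharge ε δ t T T' β α σ = -spinCharge ε δ t T T' α β σ := by
  simp only [spinCharge, jetSpin_antisymm α β, integral_neg]

lemma integral_jetSpinD_succ (hT : ∀ μ, IsAmplitude (T μ)) (hT' : ∀ μ, IsAmplitude (T' μ))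
    (hδ : δ * δ = 1) (t : ℝ) (j : Fin 3) (α β σ : Fin 4) :
    ∫ y : Space, jetSpinD j.succ α β σ (packetJet ε T (fourVector t y))
      (packetJet δ T' (fourVector t y)) = 0 :=
  integral_partial_slice (fun x => (isWaveJet_packetJet hT).hasPartials_spin
    (isWaveJet_packetJet hT') α β σ x) t j ((isJetForm_spin α β σ).integrable_slice hT hT' hδ t)
    ((isJetForm_spinD j.succ α β σ).integrable_slice hT hT' hδ t)

lemma integral_lower_mul_jetSpinD_succ (hT : ∀ μ, IsAmplitude (T μ))
    (hT' : ∀ μ, IsAmplitude (T' μ)) (hδ : δ * δ = 1) (t : ℝ) (l : Fin 4) (j : Fin 3)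
    (α β σ : Fin 4) :
    ∫ y : Space, (lower (fourVector t y) l : ℂ) * jetSpinD j.succ α β σ
      (packetJet ε T (fourVector t y)) (packetJet δ T' (fourVector t y)) =
      -eta l j.succ * spinCharge ε δ t T T' α β σ :=
  integral_lower_mul_partial_slice (fun x => (isWaveJet_packetJet hT).hasPartials_spin
    (isWaveJet_packetJet hT') α β σ x) t l j ((isJetForm_spin α β σ).integrable_slice hT hT' hδ t)
    ((isJetForm_spin α β σ).integrable_lower_slice hT hT' hδ t l)
    ((isJetForm_spinD j.succ α β σ).integrable_lower_slice hT hT' hδ t l)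

/-- Current conservation, solved for the time derivative. -/
lemma jetSpinD_zero (hT : ∀ μ, IsAmplitude (T μ)) (hT' : ∀ μ, IsAmplitude (T' μ)) (α β : Fin 4)
    (x : Spacetime) :
    jetSpinD 0 α β 0 (packetJet ε T x) (packetJet δ T' x) =
      ∑ j : Fin 3, jetSpinD j.succ α β j.succ (packetJet ε T x) (packetJet δ T' x) := by
  have h := (isWaveJet_packetJet (ε := ε) hT).sum_spinD (isWaveJet_packetJet (ε := δ) hT') α β x
  rw [Fin.sum_univ_succ] at h
  simp only [metric, if_true, Fin.succ_ne_zero, if_false] at h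
  push_cast at h
  rw [← Finset.mul_sum] at h
  linear_combination h

lemma jetSpinD_self (κ α σ : Fin 4) (J J' : Jet n) : jetSpinD κ α α σ J J' = 0 := sub_self _

lemma jetImprovement_zero (hT : ∀ μ, IsAmplitude (T μ)) (hT' : ∀ μ, IsAmplitude (T' μ))
    (σ : Fin 4) (x : Spacetime) :
    jetImprovement 0 σ (packetJet ε T x) (packetJet δ T' x) =
      ∑ j : Fin 3, (jetSpinD j.succ σ 0 j.succ (packetJet ε T x) (packetJet δ T' x)
        - jetSpinD j.succ 0 j.succ σ (packetJet ε T x) (packetJet δ T' x)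
        - jetSpinD j.succ σ j.succ 0 (packetJet ε T x) (packetJet δ T' x)) := by
  rw [jetImprovement, Fin.sum_univ_succ, jetSpinD_self, jetSpinD_zero hT hT']
  simp only [metric, if_true, Fin.succ_ne_zero, if_false, Finset.sum_sub_distrib]
  push_cast
  rw [← Finset.mul_sum, Finset.sum_add_distrib]
  ring

/-- The improvement term does not contribute to the momentum. -/
lemma integral_jetImprovement (hT : ∀ μ, IsAmplitude (T μ)) (hT' : ∀ μ, IsAmplitude (T' μ))
    (hδ : δ * δ = 1) (t : ℝ) (σ : Fin 4) :
    ∫ y : Space, jetImprovement 0 σ (packetJet ε T (fourVector t y))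
      (packetJet δ T' (fourVector t y)) = 0 := by
  have hi := fun j : Fin 3 => fun α β σ =>
    (isJetForm_spinD (n := n) j.succ α β σ).integrable_slice (ε := ε) hT hT' hδ t
  simp only [jetImprovement_zero hT hT']
  rw [integral_finsetSum _ fun j _ => integrable_sub_sub (hi j _ _ _) (hi j _ _ _) (hi j _ _ _)]
  refine Finset.sum_eq_zero fun j _ => ?_
  rw [integral_sub_sub (hi j _ _ _) (hi j _ _ _) (hi j _ _ _)]
  simp only [integral_jetSpinD_succ hT hT' hδ, sub_zero]

lemma integral_lower_mul_jetImprovement (hT : ∀ μ, IsAmplitude (T μ))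
    (hT' : ∀ μ, IsAmplitude (T' μ)) (hδ : δ * δ = 1) (t : ℝ) (l σ : Fin 4) :
    ∫ y : Space, (lower (fourVector t y) l : ℂ) * jetImprovement 0 σ
      (packetJet ε T (fourVector t y)) (packetJet δ T' (fourVector t y)) =
      spinCharge ε δ t T T' σ 0 l - spinCharge ε δ t T T' 0 l σ - spinCharge ε δ t T T' σ l 0 := by
  have hi := fun j : Fin 3 => fun α β σ =>
    (isJetForm_spinD (n := n) j.succ α β σ).integrable_lower_slice (ε := ε) hT hT' hδ t l
  simp only [jetImprovement_zero hT hT', Finset.mul_sum, mul_sub]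
  rw [integral_finsetSum _ fun j _ => integrable_sub_sub (hi j _ _ _) (hi j _ _ _) (hi j _ _ _)]
  have h : ∀ j : Fin 3, ∫ y : Space, ((lower (fourVector t y) l : ℂ) * jetSpinD j.succ σ 0 j.succ
        (packetJet ε T (fourVector t y)) (packetJet δ T' (fourVector t y))
      - (lower (fourVector t y) l : ℂ) * jetSpinD j.succ 0 j.succ σ
        (packetJet ε T (fourVector t y)) (packetJet δ T' (fourVector t y))
      - (lower (fourVector t y) l : ℂ) * jetSpinD j.succ σ j.succ 0
        (packetJet ε T (fourVector t y)) (packetJet δ T' (fourVector t y))) =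
      if l = j.succ then spinCharge ε δ t T T' σ 0 l - spinCharge ε δ t T T' 0 l σ
        - spinCharge ε δ t T T' σ l 0 else 0 := by
    intro j
    rw [integral_sub_sub (hi j _ _ _) (hi j _ _ _) (hi j _ _ _)]
    simp only [integral_lower_mul_jetSpinD_succ hT hT' hδ, eta]
    split_ifs with hl
    · subst hl
      simp [metric]
    · simp
  simp only [h]
  refine Fin.cases ?_ (fun i => ?_) l
  · have h0 := spinCharge_antisymm (ε := ε) (δ := δ) (T := T) (T' := T') t 0 0 σ
    simp only [(Fin.succ_ne_zero _).symm, if_false, Finset.sum_const_zero]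
    linear_combination h0 / 2
  · simp [Fin.succ_inj]

/-- In the angular momentum the improvement term contributes twice the spin charge. -/
lemma integral_moment_jetImprovement (hT : ∀ μ, IsAmplitude (T μ))
    (hT' : ∀ μ, IsAmplitude (T' μ)) (hδ : δ * δ = 1) (t : ℝ) (σ τ : Fin 4) :
    (∫ y : Space, (lower (fourVector t y) σ : ℂ) * jetImprovement 0 τ
        (packetJet ε T (fourVector t y)) (packetJet δ T' (fourVector t y)))
      - ∫ y : Space, (lower (fourVector t y) τ : ℂ) * jetImprovement 0 σ
        (packetJet ε T (fourVector t y)) (packetJet δ T' (fourVector t y)) =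
      2 * spinCharge ε δ t T T' σ τ 0 := by
  rw [integral_lower_mul_jetImprovement hT hT' hδ, integral_lower_mul_jetImprovement hT hT' hδ]
  have h := fun α β σ => spinCharge_antisymm (ε := ε) (δ := δ) (T := T) (T' := T') t α β σ
  rw [h 0 τ σ, h 0 σ τ, h σ τ 0]
  ring

/-- The form of the moments of the stress-energy tensor: up to the improvement term, the density
of `P_σ`. -/
lemma jetStress_zero (σ : Fin 4) (J J' : Jet n) :
    jetStress 0 σ J J' = jetMomentum σ J J'
      - (-1) ^ (n + 1) * ((n + 1 : ℕ) : ℂ) / 4 * jetImprovement 0 σ J J' := by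
  rw [jetStress, jetMomentum]
  ring

lemma integral_jetStress (hT : ∀ μ, IsAmplitude (T μ)) (hT' : ∀ μ, IsAmplitude (T' μ))
    (hδ : δ * δ = 1) (t : ℝ) (σ : Fin 4) :
    ∫ y : Space, jetStress 0 σ (packetJet ε T (fourVector t y)) (packetJet δ T' (fourVector t y)) =
      ∫ y : Space, jetMomentum σ (packetJet ε T (fourVector t y))
        (packetJet δ T' (fourVector t y)) := by
  simp only [jetStress_zero]
  rw [integral_sub ((isJetForm_momentum σ).integrable_slice hT hT' hδ t)
    (((isJetForm_improvement 0 σ).integrable_slice hT hT' hδ t).const_mul _),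
    integral_const_mul, integral_jetImprovement hT hT' hδ, mul_zero, sub_zero]

/-- The form of the angular momentum density of the stress-energy tensor. -/
def jetMoment (x : Spacetime) (σ τ : Fin 4) (J J' : Jet n) : ℂ :=
  (lower x σ : ℂ) * jetStress 0 τ J J' - (lower x τ : ℂ) * jetStress 0 σ J J'

lemma integrable_jetLorentz (hT : ∀ μ, IsAmplitude (T μ)) (hT' : ∀ μ, IsAmplitude (T' μ))
    (hδ : δ * δ = 1) (t : ℝ) (σ τ : Fin 4) :
    Integrable fun y : Space => jetLorentz (fourVector t y) σ τ
      (packetJet ε T (fourVector t y)) (packetJet δ T' (fourVector t y)) :=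
  ((((isJetForm_momentum τ).integrable_lower_slice hT hT' hδ t σ).sub
    ((isJetForm_momentum σ).integrable_lower_slice hT hT' hδ t τ)).sub
    (((isJetForm_spin σ τ 0).integrable_slice hT hT' hδ t).const_mul _))

lemma integral_jetLorentz (hT : ∀ μ, IsAmplitude (T μ)) (hT' : ∀ μ, IsAmplitude (T' μ))
    (hδ : δ * δ = 1) (t : ℝ) (σ τ : Fin 4) :
    ∫ y : Space, jetLorentz (fourVector t y) σ τ
      (packetJet ε T (fourVector t y)) (packetJet δ T' (fourVector t y)) =
    (∫ y : Space, (lower (fourVector t y) σ : ℂ) * jetMomentum τ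
      (packetJet ε T (fourVector t y)) (packetJet δ T' (fourVector t y)))
    - (∫ y : Space, (lower (fourVector t y) τ : ℂ) * jetMomentum σ
      (packetJet ε T (fourVector t y)) (packetJet δ T' (fourVector t y)))
    - (-1) ^ (n + 1) * ((n + 1 : ℕ) : ℂ) / 2 * spinCharge ε δ t T T' σ τ 0 := by
  have h1 := (isJetForm_momentum τ).integrable_lower_slice (ε := ε) hT hT' hδ t σ
  have h2 := (isJetForm_momentum σ).integrable_lower_slice (ε := ε) hT hT' hδ t τ
  have h3 := ((isJetForm_spin σ τ 0).integrable_slice (ε := ε) hT hT' hδ t).const_mul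
    ((-1) ^ (n + 1) * ((n + 1 : ℕ) : ℂ) / 2)
  simp only [jetLorentz]
  rw [integral_sub_sub h1 h2 h3, integral_const_mul]
  rfl

lemma integral_jetMoment (hT : ∀ μ, IsAmplitude (T μ)) (hT' : ∀ μ, IsAmplitude (T' μ))
    (hδ : δ * δ = 1) (t : ℝ) (σ τ : Fin 4) :
    ∫ y : Space, jetMoment (fourVector t y) σ τ (packetJet ε T (fourVector t y))
      (packetJet δ T' (fourVector t y)) =
    ∫ y : Space, jetLorentz (fourVector t y) σ τ (packetJet ε T (fourVector t y))
      (packetJet δ T' (fourVector t y)) := by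
  have h1 := fun σ τ => (isJetForm_momentum τ).integrable_lower_slice (ε := ε) hT hT' hδ t σ
  have h2 := fun σ τ => ((isJetForm_improvement 0 τ).integrable_lower_slice (ε := ε) hT hT' hδ t
    σ).const_mul ((-1) ^ (n + 1) * ((n + 1 : ℕ) : ℂ) / 4)
  rw [integral_jetLorentz hT hT' hδ]
  simp only [jetMoment, jetStress_zero, mul_sub, mul_left_comm (lower _ _ : ℂ)
    ((-1) ^ (n + 1) * ((n + 1 : ℕ) : ℂ) / 4)]
  have h3 : ∀ σ τ, Integrable fun y : Space => _ := fun σ τ => (h1 σ τ).sub (h2 σ τ)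
  simp only [Pi.sub_apply] at h3
  rw [integral_sub (h3 σ τ) (h3 τ σ), integral_sub (h1 σ τ) (h2 σ τ),
    integral_sub (h1 τ σ) (h2 τ σ), integral_const_mul, integral_const_mul]
  linear_combination (-((-1) ^ (n + 1) * ((n + 1 : ℕ) : ℂ) / 4)) *
    integral_moment_jetImprovement (ε := ε) hT hT' hδ t σ τ

end

end

section

/-! ### Evaluation of the moments in momentum space -/

section

variable {n : ℕ}

/-- An identity between integrals of products of jet components extends to all bilinear forms. -/
lemma IsJetForm.integral_transfer {B : Jet n → Jet n → ℂ} (hB : IsJetForm B)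
    {J J' U V : Space → Jet n} {w : Space → ℂ} {C : ℂ}
    (hJ : ∀ l μ l' μ', Integrable fun y => w y * (J y l μ * J' y l' μ'))
    (hU : ∀ l μ l' μ', Integrable fun p => U p l μ * V p l' μ')
    (h : ∀ l μ l' μ', ∫ y, w y * (J y l μ * J' y l' μ') = C * ∫ p, U p l μ * V p l' μ') :
    Integrable (fun y => w y * B (J y) (J' y)) ∧ Integrable (fun p => B (U p) (V p)) ∧
      ∫ y, w y * B (J y) (J' y) = C * ∫ p, B (U p) (V p) := by
  induction hB with
  | mul l μ l' μ' => exact ⟨hJ _ _ _ _, hU _ _ _ _, h _ _ _ _⟩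
  | add _ _ ih ih' =>
    simp only [mul_add]
    refine ⟨ih.1.add ih'.1, ih.2.1.add ih'.2.1, ?_⟩
    rw [integral_add ih.1 ih'.1, integral_add ih.2.1 ih'.2.1, ih.2.2, ih'.2.2, mul_add]
  | const_mul k _ ih =>
    simp only [mul_left_comm _ k]
    refine ⟨ih.1.const_mul k, ih.2.1.const_mul k, ?_⟩
    rw [integral_const_mul, integral_const_mul, ih.2.2, mul_left_comm]

/-- The momentum space factor of an iterated derivative of a wave packet of frequency `-s ε`,
written at time `t` as a wave packet of frequency `-ε`. For `s = -1` this reverses the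
three-momentum, so that only the factors of the time derivatives change sign. -/
def dualMultiplier (ε s : ℝ) : List (Fin 4) → Space → ℂ
  | [] => fun _ => 1
  | κ :: l => fun p => Complex.I * ε * (if κ = 0 then s else 1 : ℝ) * lower (onShell p) κ *
      dualMultiplier ε s l p

lemma dualMultiplier_one (ε : ℝ) (l : List (Fin 4)) (p : Space) :
    dualMultiplier ε 1 l p = multiplier (-ε) l p := by
  induction l with
  | nil => rfl
  | cons κ l ih => simp [dualMultiplier, multiplier, derivAmplitude, ih]

lemma dualMultiplier_neg_one (ε : ℝ) (l : List (Fin 4)) (p : Space) :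
    dualMultiplier ε (-1) l p = multiplier ε l (-p) := by
  induction l with
  | nil => rfl
  | cons κ l ih =>
    have h : (lower (onShell (-p)) κ : ℂ) =
        -((if κ = 0 then -1 else 1 : ℝ) * (lower (onShell p) κ : ℂ)) := by
      refine Fin.cases ?_ (fun j => ?_) κ
      · simp [lower, onShell, fourVector]
      · simp [lower, onShell, fourVector]
    simp only [dualMultiplier, multiplier, derivAmplitude, ih, h]
    ring

lemma smoothOffTip_dualMultiplier (ε s : ℝ) (l : List (Fin 4)) :
    SmoothOffTip (dualMultiplier ε s l) := by
  induction l with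
  | nil => exact smoothOffTip_const 1
  | cons κ l ih => exact ((smoothOffTip_const _).mul (smoothOffTip_lower κ)).mul ih

/-- The wave packets of frequency `ε₁` with the amplitudes `T` are, at time `t`, wave packets of
frequency `-ε` with the amplitudes `L`, and Plancherel's theorem gives their integrals against wave
packets of frequency `ε`. -/
structure IsDual (ε₁ ε s t : ℝ) (T L : Index (n + 1) → Space → ℂ) : Prop where
  isAmplitude : ∀ μ, IsAmplitude (T μ)
  isAmplitude_dual : ∀ μ, IsAmplitude (L μ)
  integral : ∀ l μ (H : Space → ℂ), IsAmplitude H →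
    ∫ y : Space, packetJet ε₁ T (fourVector t y) l μ * wavePacket ε H (fourVector t y) =
      (2 * Real.pi) ^ 3 * ∫ p, dualMultiplier ε s l p * L μ p * H p

variable {T T' L : Index (n + 1) → Space → ℂ} {ε₁ ε s t : ℝ}

lemma isDual_opposite (hT : ∀ μ, IsAmplitude (T μ)) (hε : ε * ε = 1) (t : ℝ) :
    IsDual (-ε) ε 1 t T T := by
  refine ⟨hT, hT, fun l μ H hH => ?_⟩
  simp only [packetJet, dualMultiplier_one]
  exact integral_wavePacket_mul ((hT μ).mul_left (smoothOffTip_multiplier _ l)) hH hε t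

lemma isDual_same (hT : ∀ μ, IsAmplitude (T μ)) (hε : ε * ε = 1) (t : ℝ) :
    IsDual ε ε (-1) t T fun μ => reflect ε t (T μ) := by
  refine ⟨hT, fun μ => (hT μ).reflect ε t, fun l μ H hH => ?_⟩
  simp only [packetJet]
  simp only [wavePacket_reflect (fun p => multiplier ε l p * T μ p)]
  rw [integral_wavePacket_mul (((hT μ).mul_left (smoothOffTip_multiplier _ l)).reflect ε t) hH hε t]
  congr 1
  refine integral_congr_ae (.of_forall fun p => ?_)
  simp only [reflect, dualMultiplier_neg_one]
  ring

lemma IsAmplitude.mul {K K' : Space → ℂ} (hK : IsAmplitude K) (hK' : IsAmplitude K') :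
    IsAmplitude fun p => K p * K' p := hK'.mul_left hK.smoothOffTip

/-- The jet of the first factor in momentum space. -/
def dualJet (ε s : ℝ) (L : Index (n + 1) → Space → ℂ) (p : Space) : Jet n := fun l μ =>
  dualMultiplier ε s l p * L μ p

/-- The jet of the second factor in momentum space. -/
def momentumJet (ε : ℝ) (T : Index (n + 1) → Space → ℂ) (p : Space) : Jet n := fun l μ =>
  multiplier ε l p * T μ p

/-- The jet of the second factor, multiplied by `x_l`, in momentum space. -/
def positionJet (ε t : ℝ) (l : Fin 4) (T : Index (n + 1) → Space → ℂ) (p : Space) : Jet n :=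
  fun m μ => positionAmplitude ε t l (fun q => multiplier ε m q * T μ q) p

lemma IsDual.integral_form (hd : IsDual ε₁ ε s t T L) (hT' : ∀ μ, IsAmplitude (T' μ))
    (hε : ε * ε = 1) {B : Jet n → Jet n → ℂ} (hB : IsJetForm B) :
    Integrable (fun p => B (dualJet ε s L p) (momentumJet ε T' p)) ∧
    ∫ y : Space, B (packetJet ε₁ T (fourVector t y)) (packetJet ε T' (fourVector t y)) =
      (2 * Real.pi) ^ 3 * ∫ p, B (dualJet ε s L p) (momentumJet ε T' p) := by
  have hm := fun l μ => (hT' μ).mul_left (smoothOffTip_multiplier ε l)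
  have h := hB.integral_transfer (w := fun _ => 1) (C := ((2 * Real.pi) ^ 3 : ℂ))
    (J := fun y => packetJet ε₁ T (fourVector t y)) (J' := fun y => packetJet ε T' (fourVector t y))
    (U := dualJet ε s L) (V := momentumJet ε T')
    (fun l μ l' μ' => by
      simp only [one_mul]
      exact (IsJetForm.mul l μ l' μ').integrable_slice hd.isAmplitude hT' hε t)
    (fun l μ l' μ' => (((hd.isAmplitude_dual μ).mul_left
      (smoothOffTip_dualMultiplier ε s l)).mul (hm l' μ')).integrable)
    (fun l μ l' μ' => by
      simp only [one_mul]
      exact hd.integral l μ _ (hm l' μ'))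
  exact ⟨h.2.1, by simpa only [one_mul] using h.2.2⟩

lemma IsDual.integral_lower_form (hd : IsDual ε₁ ε s t T L) (hT' : ∀ μ, IsAmplitude (T' μ))
    (hε : ε * ε = 1) (k : Fin 4) {B : Jet n → Jet n → ℂ} (hB : IsJetForm B) :
    Integrable (fun p => B (dualJet ε s L p) (positionJet ε t k T' p)) ∧
    ∫ y : Space, (lower (fourVector t y) k : ℂ) *
        B (packetJet ε₁ T (fourVector t y)) (packetJet ε T' (fourVector t y)) =
      (2 * Real.pi) ^ 3 * ∫ p, B (dualJet ε s L p) (positionJet ε t k T' p) := by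
  have hm := fun l μ => (hT' μ).mul_left (smoothOffTip_multiplier ε l)
  have h := hB.integral_transfer (w := fun y => (lower (fourVector t y) k : ℂ))
    (C := ((2 * Real.pi) ^ 3 : ℂ))
    (J := fun y => packetJet ε₁ T (fourVector t y)) (J' := fun y => packetJet ε T' (fourVector t y))
    (U := dualJet ε s L) (V := positionJet ε t k T')
    (fun l μ l' μ' =>
      (IsJetForm.mul l μ l' μ').integrable_lower_slice hd.isAmplitude hT' hε t k)
    (fun l μ l' μ' => (((hd.isAmplitude_dual μ).mul_left
      (smoothOffTip_dualMultiplier ε s l)).mul ((hm l' μ').positionAmplitude ε t k)).integrable)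
    (fun l μ l' μ' => by
      have h1 : ∀ y : Space, (lower (fourVector t y) k : ℂ) *
          (packetJet ε₁ T (fourVector t y) l μ * packetJet ε T' (fourVector t y) l' μ') =
          packetJet ε₁ T (fourVector t y) l μ * wavePacket ε (positionAmplitude ε t k
            fun q => multiplier ε l' q * T' μ' q) (fourVector t y) := fun y => by
        rw [mul_left_comm]
        congr 1
        exact lower_mul_wavePacket (hm l' μ') hε (fourVector t y) k
      simp only [h1]
      exact hd.integral l μ _ ((hm l' μ').positionAmplitude ε t k))
  exact ⟨h.2.1, h.2.2⟩

lemma positionAmplitude_mul {m K : Space → ℂ} (hm : SmoothOffTip m) (hK : IsAmplitude K)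
    (ε t : ℝ) (l : Fin 4) {p : Space} (hp : p ≠ 0) :
    positionAmplitude ε t l (fun q => m q * K q) p =
      m p * positionAmplitude ε t l K p + -Complex.I * ε * momentumPartial l m p * K p := by
  simp only [positionAmplitude]
  rw [momentumPartial_mul (hm.differentiableAt hp) (hK.differentiable p)]
  ring

/-- The factor `1 + s` vanishes for equal frequencies and is `2` for opposite ones. -/
lemma jetFull_dual (hε : ε * ε = 1) (σ : Fin 4) (L T' : Index (n + 1) → Space → ℂ) (p : Space) :
    jetFull 0 σ (dualJet ε s L p) (momentumJet ε T' p) =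
      -((1 + s) * (1 + (if σ = 0 then s else 1 : ℝ))) *
        (lower (onShell p) 0 * lower (onShell p) σ) * ∑ μ, (raise μ : ℂ) * (L μ p * T' μ p) := by
  have hε' : (ε : ℂ) * ε = 1 := by exact_mod_cast hε
  have hI : Complex.I * ε * (Complex.I * ε) = -1 := by
    linear_combination (ε * ε : ℂ) * Complex.I_mul_I - hε'
  rw [jetFull, Finset.mul_sum]
  refine Finset.sum_congr rfl fun μ _ => ?_
  simp only [dualJet, momentumJet, dualMultiplier, multiplier, derivAmplitude, if_true]
  linear_combination ((1 + s) * (1 + (if σ = 0 then s else 1 : ℝ)) *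
    (lower (onShell p) 0 * lower (onShell p) σ) * ((raise μ : ℂ) * (L μ p * T' μ p))) * hI

/-- The derivative `∂_σ p_κ` on the light cone. -/
def coneDeriv (p : Space) (σ κ : Fin 4) : ℂ :=
  eta σ κ - (lower (onShell p) σ : ℂ) / (‖p‖ : ℂ) * eta 0 κ

lemma momentumPartial_multiplier_one (ε : ℝ) (σ κ : Fin 4) {p : Space} (hp : p ≠ 0) :
    momentumPartial σ (multiplier ε [κ]) p = -Complex.I * ε * coneDeriv p σ κ := by
  have h : multiplier ε [κ] = fun q => -Complex.I * ε * (lower (onShell q) κ : ℂ) := by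
    ext q; simp [multiplier, derivAmplitude]
  rw [h, momentumPartial_mul (differentiableAt_const _) ((smoothOffTip_lower κ).differentiableAt hp),
    momentumPartial_const, momentumPartial_lower σ κ hp, coneDeriv]
  ring

lemma momentumPartial_multiplier_two (ε : ℝ) (σ κ l : Fin 4) {p : Space} (hp : p ≠ 0) :
    momentumPartial σ (multiplier ε [κ, l]) p = -Complex.I * ε * (-Complex.I * ε) *
      (coneDeriv p σ κ * lower (onShell p) l + lower (onShell p) κ * coneDeriv p σ l) := by
  have h : multiplier ε [κ, l] = fun q => multiplier ε [κ] q * multiplier ε [l] q := by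
    ext q; simp [multiplier, derivAmplitude]
  rw [h, momentumPartial_mul ((smoothOffTip_multiplier ε _).differentiableAt hp)
    ((smoothOffTip_multiplier ε _).differentiableAt hp), momentumPartial_multiplier_one ε σ κ hp,
    momentumPartial_multiplier_one ε σ l hp]
  simp only [multiplier, derivAmplitude]
  ring

/-- As `jetFull_dual`, with a coordinate acting as a derivative on the second factor; the additional
terms are derivatives of the factors of momentum. For `s = -1` what remains is symmetric in `σ` and
`τ`. -/
lemma jetFull_dual_position (hε : ε * ε = 1) (hT' : ∀ μ, IsAmplitude (T' μ)) (σ τ : Fin 4)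
    (L : Index (n + 1) → Space → ℂ) {p : Space} (hp : p ≠ 0) :
    jetFull 0 τ (dualJet ε s L p) (positionJet ε t σ T' p) =
      ∑ μ, (raise μ : ℂ) * (L μ p *
        (-((1 + s) * (1 + (if τ = 0 then s else 1 : ℝ))) *
          (lower (onShell p) 0 * lower (onShell p) τ) * positionAmplitude ε t σ (T' μ) p
        + Complex.I * ε * ((1 + s) * (lower (onShell p) 0 * coneDeriv p σ τ)
          + (1 + (if τ = 0 then s else 1 : ℝ)) * (lower (onShell p) τ * coneDeriv p σ 0)) *
            T' μ p)) := by
  have hε' : (ε : ℂ) * ε = 1 := by exact_mod_cast hε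
  have hI : Complex.I * ε * (Complex.I * ε) = -1 := by
    linear_combination (ε * ε : ℂ) * Complex.I_mul_I - hε'
  rw [jetFull]
  refine Finset.sum_congr rfl fun μ _ => ?_
  have h0 : positionAmplitude ε t σ (fun q => multiplier ε [] q * T' μ q) p =
      positionAmplitude ε t σ (T' μ) p := by simp [multiplier]
  have h1 := fun κ => positionAmplitude_mul (smoothOffTip_multiplier ε [κ]) (hT' μ) ε t σ hp
  have h2 := positionAmplitude_mul (smoothOffTip_multiplier ε [0, τ]) (hT' μ) ε t σ hp
  simp only [dualJet, positionJet, h0, h1, h2, momentumPartial_multiplier_one ε σ _ hp,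
    momentumPartial_multiplier_two ε σ _ _ hp]
  simp only [dualMultiplier, multiplier, derivAmplitude, if_true]
  generalize positionAmplitude ε t σ (T' μ) p = X
  generalize ((if τ = 0 then s else 1 : ℝ) : ℂ) = w
  linear_combination (raise μ * L μ p * ((1 + s) * (1 + w) *
    (lower (onShell p) 0 * lower (onShell p) τ) * X
    - Complex.I * ε * ((1 + s) * (lower (onShell p) 0 * coneDeriv p σ τ)
          + (1 + w) * (lower (onShell p) τ * coneDeriv p σ 0)) * T' μ p) : ℂ) * hI

lemma jetSpin_dual (σ τ : Fin 4) (L T' : Index (n + 1) → Space → ℂ) (p : Space) :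
    jetSpin σ τ 0 (dualJet ε s L p) (momentumJet ε T' p) =
      -(Complex.I * ε * (1 + s) * lower (onShell p) 0) * ∑ ν : Index n, (raise ν : ℂ) *
        (L (Fin.cons σ ν) p * T' (Fin.cons τ ν) p - L (Fin.cons τ ν) p * T' (Fin.cons σ ν) p) := by
  rw [jetSpin, jetCurrent, jetCurrent, ← Finset.sum_sub_distrib, Finset.mul_sum]
  refine Finset.sum_congr rfl fun ν _ => ?_
  simp only [dualJet, momentumJet, dualMultiplier, multiplier, derivAmplitude, if_true]
  ring

end

end

section

/-! ### Contributions of equal and of opposite frequencies -/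

section

variable {n : ℕ} {T T' a b : Index (n + 1) → Space → ℂ} {ε t : ℝ}

/-- Two positive (or two negative) frequency parts do not contribute to the momentum. -/
lemma integral_jetMomentum_same (hT : ∀ μ, IsAmplitude (T μ)) (hT' : ∀ μ, IsAmplitude (T' μ))
    (hε : ε * ε = 1) (t : ℝ) (σ : Fin 4) :
    ∫ y : Space, jetMomentum σ (packetJet ε T (fourVector t y))
      (packetJet ε T' (fourVector t y)) = 0 := by
  rw [((isDual_same hT hε t).integral_form hT' hε (isJetForm_momentum σ)).2]
  simp [jetMomentum, jetFull_dual hε]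

lemma spinCharge_same (hT : ∀ μ, IsAmplitude (T μ)) (hT' : ∀ μ, IsAmplitude (T' μ))
    (hε : ε * ε = 1) (t : ℝ) (σ τ : Fin 4) : spinCharge ε ε t T T' σ τ 0 = 0 := by
  rw [spinCharge, ((isDual_same hT hε t).integral_form hT' hε (isJetForm_spin σ τ 0)).2]
  simp [jetSpin_dual]

/-- Two positive (or two negative) frequency parts do not contribute to the angular momentum. -/
lemma integral_jetLorentz_same (hT : ∀ μ, IsAmplitude (T μ)) (hT' : ∀ μ, IsAmplitude (T' μ))
    (hε : ε * ε = 1) (t : ℝ) (σ τ : Fin 4) :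
    ∫ y : Space, jetLorentz (fourVector t y) σ τ (packetJet ε T (fourVector t y))
      (packetJet ε T' (fourVector t y)) = 0 := by
  have hd := isDual_same hT hε t
  have h1 := hd.integral_lower_form hT' hε σ (isJetForm_momentum τ)
  have h2 := hd.integral_lower_form hT' hε τ (isJetForm_momentum σ)
  rw [integral_jetLorentz hT hT' hε, spinCharge_same hT hT' hε, h1.2, h2.2, mul_zero, sub_zero,
    sub_eq_zero]
  congr 1
  refine integral_congr_ae ?_
  filter_upwards [compl_mem_ae_iff.2 (measure_singleton (0 : Space))] with p hp
  have hp : p ≠ 0 := hp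
  -- the remaining coefficient is symmetric in `σ` and `τ`
  have h : ((1 + (if τ = 0 then (-1 : ℝ) else 1 : ℝ) : ℂ)) *
        (lower (onShell p) τ * coneDeriv p σ 0) =
      (1 + (if σ = 0 then (-1 : ℝ) else 1 : ℝ)) * (lower (onShell p) σ * coneDeriv p τ 0) := by
    have h0 : coneDeriv p 0 0 = 0 := by
      have : (‖p‖ : ℂ) ≠ 0 := by simpa using hp
      simp [coneDeriv, eta, metric, lower_onShell_zero, this]
    refine Fin.cases ?_ (fun i => ?_) σ <;> refine Fin.cases ?_ (fun j => ?_) τ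
    · rfl
    · simp [h0]
    · simp [h0]
    · simp only [coneDeriv, eta, Fin.succ_ne_zero, if_false]
      push_cast
      ring
  simp only [jetMomentum, jetFull_dual_position hε hT' _ _ _ hp]
  congr 2
  refine Finset.sum_congr rfl fun μ _ => ?_
  congr 2
  push_cast at h ⊢
  linear_combination (Complex.I * ε * T' μ p) * h

/-- The contraction of two tensor functions with the invariant measure: the scalar product without
its conjugation. -/
def pairing (a b : Index (n + 1) → Space → ℂ) : ℂ :=
  (-1) ^ (n + 1) * ∫ p : Space, (invariantDensity p : ℂ) *
    ∑ μ : Index (n + 1), (raise μ : ℂ) * (a μ p * b μ p)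

/-- The tensor `a` with the factor of the invariant measure. -/
def withDensity (a : Index (n + 1) → Space → ℂ) (μ : Index (n + 1)) (p : Space) : ℂ :=
  invariantDensity p * a μ p

lemma isAmplitude_withDensity (ha : ∀ μ, IsAmplitude (a μ)) (μ : Index (n + 1)) :
    IsAmplitude (withDensity a μ) := (ha μ).mul_left smoothOffTip_invariantDensity

/-- The one-particle generator of translations on tensor functions. -/
def momentumOp (σ : Fin 4) (b : Index (n + 1) → Space → ℂ) (μ : Index (n + 1)) (p : Space) : ℂ :=
  lower (onShell p) σ * b μ p

/-- The orbital part of the one-particle generator of Lorentz transformations. -/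
def orbitalOp (σ τ : Fin 4) (b : Index (n + 1) → Space → ℂ) (μ : Index (n + 1)) (p : Space) : ℂ :=
  Complex.I * (lower (onShell p) σ * momentumPartial τ (b μ) p
    - lower (onShell p) τ * momentumPartial σ (b μ) p)

/-- The spin part of the one-particle generator of Lorentz transformations. -/
def spinOp (σ τ : Fin 4) (b : Index (n + 1) → Space → ℂ) (μ : Index (n + 1)) (p : Space) : ℂ :=
  Complex.I * ∑ i, ((eta σ (μ i) : ℂ) * b (Function.update μ i τ) p
    - (eta τ (μ i) : ℂ) * b (Function.update μ i σ) p)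

lemma invariantDensity_mul {p : Space} (hp : p ≠ 0) :
    (2 * Real.pi : ℂ) ^ 3 * (‖p‖ * invariantDensity p) = 1 / 2 := by
  have h1 : (‖p‖ : ℂ) ≠ 0 := by simpa using hp
  have h2 : (Real.pi : ℂ) ≠ 0 := by exact_mod_cast Real.pi_ne_zero
  simp only [invariantDensity]
  push_cast
  field_simp

lemma integral_jetMomentum_opposite (ha : ∀ μ, IsAmplitude (a μ)) (hb : ∀ μ, IsAmplitude (b μ))
    (hε : ε * ε = 1) (t : ℝ) (σ : Fin 4) :
    ∫ y : Space, jetMomentum σ (packetJet (-ε) (withDensity a) (fourVector t y))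
      (packetJet ε (withDensity b) (fourVector t y)) = 1 / 2 * pairing a (momentumOp σ b) := by
  rw [((isDual_opposite (isAmplitude_withDensity ha) hε t).integral_form
    (isAmplitude_withDensity hb) hε (isJetForm_momentum σ)).2, pairing, ← integral_const_mul,
    ← integral_const_mul, ← integral_const_mul]
  refine integral_congr_ae ?_
  filter_upwards [compl_mem_ae_iff.2 (measure_singleton (0 : Space))] with p hp
  have h := invariantDensity_mul (p := p) hp
  simp only [jetMomentum, jetFull_dual hε, withDensity, momentumOp, lower_onShell_zero,
    Finset.mul_sum]
  refine Finset.sum_congr rfl fun μ _ => ?_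
  have hw : (if σ = 0 then 1 else 1 : ℝ) = 1 := by simp
  rw [hw]
  push_cast
  linear_combination ((-1) ^ (n + 1) * invariantDensity p * raise μ * lower (onShell p) σ *
    (a μ p * b μ p) : ℂ) * h

lemma momentumPartial_invariantDensity {p : Space} (hp : p ≠ 0) (l : Fin 4) :
    momentumPartial l (fun q => (invariantDensity q : ℂ)) p * ‖p‖ =
      -(invariantDensity p : ℂ) * coneDeriv p l 0 := by
  have hn := smoothOffTip_norm.differentiableAt hp
  have h := momentumPartial_mul (l := l) (smoothOffTip_invariantDensity.differentiableAt hp) hn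
  have h2 : momentumPartial l (fun q => (invariantDensity q : ℂ) * (‖q‖ : ℂ)) p = 0 := by
    have he : (fun q : Space => (invariantDensity q : ℂ) * (‖q‖ : ℂ)) =ᶠ[nhds p]
        fun _ => (2 * (2 * Real.pi : ℂ) ^ 3)⁻¹ := by
      filter_upwards [isOpen_ne.mem_nhds hp] with q hq
      have h3 := invariantDensity_mul (p := q) hq
      have h4 : (2 * Real.pi : ℂ) ^ 3 ≠ 0 := by
        have : (Real.pi : ℂ) ≠ 0 := by exact_mod_cast Real.pi_ne_zero
        exact pow_ne_zero _ (mul_ne_zero two_ne_zero this)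
      field_simp
      linear_combination 2 * h3
    refine Fin.cases rfl (fun j => ?_) l
    simp [momentumPartial, he.fderiv_eq]
  have h5 : momentumPartial l (fun q : Space => (‖q‖ : ℂ)) p = coneDeriv p l 0 := by
    have h6 := momentumPartial_lower l 0 hp
    simp only [lower_onShell_zero] at h6
    rw [h6, coneDeriv]
  rw [h2, h5] at h
  linear_combination -h

lemma coneDeriv_zero (p : Space) (l : Fin 4) :
    coneDeriv p l 0 = eta l 0 - (lower (onShell p) l : ℂ) / ‖p‖ := by
  simp [coneDeriv, eta, metric]

/-- The orbital part of the angular momentum. -/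
lemma integral_orbital_opposite (ha : ∀ μ, IsAmplitude (a μ)) (hb : ∀ μ, IsAmplitude (b μ))
    (hε : ε * ε = 1) (t : ℝ) (σ τ : Fin 4) :
    (∫ y : Space, (lower (fourVector t y) σ : ℂ) * jetMomentum τ
        (packetJet (-ε) (withDensity a) (fourVector t y))
        (packetJet ε (withDensity b) (fourVector t y)))
      - (∫ y : Space, (lower (fourVector t y) τ : ℂ) * jetMomentum σ
        (packetJet (-ε) (withDensity a) (fourVector t y))
        (packetJet ε (withDensity b) (fourVector t y))) =
      1 / 2 * ε * pairing a (orbitalOp σ τ b) := by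
  have hT' := isAmplitude_withDensity hb
  have hd := isDual_opposite (isAmplitude_withDensity ha) hε t
  have h1 := hd.integral_lower_form hT' hε σ (isJetForm_momentum τ)
  have h2 := hd.integral_lower_form hT' hε τ (isJetForm_momentum σ)
  rw [h1.2, h2.2, ← mul_sub, ← integral_sub h1.1 h2.1, pairing, ← integral_const_mul,
    ← integral_const_mul, ← integral_const_mul]
  refine integral_congr_ae ?_
  filter_upwards [compl_mem_ae_iff.2 (measure_singleton (0 : Space))] with p hp
  have hp : p ≠ 0 := hp
  have h := invariantDensity_mul (p := p) hp
  have hw : ∀ κ : Fin 4, (if κ = 0 then 1 else 1 : ℝ) = 1 := by simp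
  simp only [jetMomentum, jetFull_dual_position hε hT' _ _ _ hp, hw, orbitalOp]
  simp only [Finset.mul_sum, ← Finset.sum_sub_distrib]
  refine Finset.sum_congr rfl fun μ _ => ?_
  have hm : ∀ l, momentumPartial l (withDensity b μ) p =
      momentumPartial l (fun q => (invariantDensity q : ℂ)) p * b μ p
        + invariantDensity p * momentumPartial l (b μ) p := fun l =>
    momentumPartial_mul (smoothOffTip_invariantDensity.differentiableAt hp)
      ((hb μ).differentiable p) l
  have h3 := momentumPartial_invariantDensity hp
  have hn : (‖p‖ : ℂ) ≠ 0 := by simpa using hp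
  have h4 : (‖p‖ : ℂ) * coneDeriv p σ τ - ‖p‖ * coneDeriv p τ σ =
      lower (onShell p) τ * eta 0 σ - lower (onShell p) σ * eta 0 τ := by
    have : (eta σ τ : ℂ) = eta τ σ := by
      simp only [eta, eq_comm (a := σ)]
      split_ifs with h
      · rw [h]
      · rfl
    simp only [coneDeriv, this]
    field_simp
    ring
  have h5 : (lower (onShell p) τ : ℂ) * coneDeriv p σ 0 - lower (onShell p) σ * coneDeriv p τ 0 =
      lower (onShell p) τ * eta 0 σ - lower (onShell p) σ * eta 0 τ := by
    have : ∀ κ, (eta κ 0 : ℂ) = eta 0 κ := fun κ => by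
      simp only [eta, eq_comm (a := κ)]
      split_ifs with h
      · rw [h]
      · rfl
    simp only [coneDeriv_zero, this]
    ring
  have h6 : ∀ l, positionAmplitude ε t l (withDensity b μ) p * ‖p‖ =
      t * (lower (onShell p) l * withDensity b μ p) + -Complex.I * ε *
        (-(invariantDensity p : ℂ) * coneDeriv p l 0 * b μ p
          + ‖p‖ * invariantDensity p * momentumPartial l (b μ) p) := fun l => by
    rw [positionAmplitude, hm]
    field_simp
    linear_combination (-Complex.I * ε * b μ p) * h3 l
  have h7 : (lower (onShell p) τ : ℂ) * (positionAmplitude ε t σ (withDensity b μ) p * ‖p‖)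
      - lower (onShell p) σ * (positionAmplitude ε t τ (withDensity b μ) p * ‖p‖) =
      -Complex.I * ε * invariantDensity p * (-(lower (onShell p) τ * eta 0 σ
          - lower (onShell p) σ * eta 0 τ) * b μ p
        + ‖p‖ * (lower (onShell p) τ * momentumPartial σ (b μ) p
          - lower (onShell p) σ * momentumPartial τ (b μ) p)) := by
    rw [h6, h6]
    linear_combination (Complex.I * ε * invariantDensity p * b μ p) * h5
  simp only [lower_onShell_zero, Complex.ofReal_one]
  simp only [withDensity] at h7 ⊢
  linear_combination
    ((2 * Real.pi) ^ 3 * (-1) ^ (n + 1) * raise μ * invariantDensity p * a μ p : ℂ) * h7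
    - ((2 * Real.pi) ^ 3 * (-1) ^ (n + 1) / 2 * raise μ * invariantDensity p * a μ p *
      Complex.I * ε * invariantDensity p * b μ p : ℂ) * (h4 + h5)
    + ((-1) ^ (n + 1) * raise μ * invariantDensity p * a μ p * Complex.I * ε *
      (lower (onShell p) σ * momentumPartial τ (b μ) p
        - lower (onShell p) τ * momentumPartial σ (b μ) p) : ℂ) * h

end

end

section

/-! ### The spin part of the angular momentum -/

section

variable {n : ℕ} {a b : Index (n + 1) → Space → ℂ} {ε t : ℝ}

/-- Symmetric tensor functions. -/
def IsSymmetricTensor (a : Index (n + 1) → Space → ℂ) : Prop :=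
  ∀ (π : Equiv.Perm (Fin (n + 1))) (μ : Index (n + 1)), a (μ ∘ π) = a μ

lemma raise_comp_perm {k : ℕ} (π : Equiv.Perm (Fin k)) (μ : Index k) :
    raise (μ ∘ π) = raise μ := Equiv.prod_comp π fun i => metric (μ i)

lemma raise_cons (κ : Fin 4) (ν : Index n) :
    raise (Fin.cons κ ν : Index (n + 1)) = metric κ * raise ν := by
  simp [raise, Fin.prod_univ_succ]

/-- For symmetric tensors, all indices contribute equally to the spin. -/
lemma sum_eta_update (ha : IsSymmetricTensor a) (hb : IsSymmetricTensor b) (σ τ : Fin 4)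
    (i : Fin (n + 1)) (p : Space) :
    ∑ μ : Index (n + 1), (raise μ : ℂ) *
        (a μ p * ((eta σ (μ i) : ℂ) * b (Function.update μ i τ) p)) =
      ∑ ν : Index n, (raise ν : ℂ) * (a (Fin.cons σ ν) p * b (Fin.cons τ ν) p) := by
  have h1 : ∑ μ : Index (n + 1), (raise μ : ℂ) *
        (a μ p * ((eta σ (μ i) : ℂ) * b (Function.update μ i τ) p)) =
      ∑ μ : Index (n + 1), (raise μ : ℂ) *
        (a μ p * ((eta σ (μ 0) : ℂ) * b (Function.update μ 0 τ) p)) := by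
    rw [← Equiv.sum_comp (Equiv.arrowCongr (Equiv.swap 0 i) (Equiv.refl (Fin 4)))]
    refine Finset.sum_congr rfl fun μ _ => ?_
    have h2 : (Equiv.arrowCongr (Equiv.swap 0 i) (Equiv.refl (Fin 4))) μ = μ ∘ Equiv.swap 0 i := by
      ext j; simp [Equiv.arrowCongr]
    have h3 : Function.update (μ ∘ Equiv.swap 0 i) i τ =
        Function.update μ 0 τ ∘ Equiv.swap 0 i := by
      have := Function.update_comp_eq_of_injective μ (Equiv.swap 0 i).injective i τ
      rw [Equiv.swap_apply_right] at this
      exact this.symm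
    rw [h2, h3, raise_comp_perm, ha, hb, Function.comp_apply, Equiv.swap_apply_right]
  rw [h1, sum_cons, Finset.sum_comm]
  refine Finset.sum_congr rfl fun ν _ => ?_
  have hm : (metric σ : ℂ) * metric σ = 1 := by exact_mod_cast metric_mul_self σ
  simp only [raise_cons, Fin.cons_zero, Fin.update_cons_zero, eta,
    apply_ite (fun x : ℝ => (x : ℂ)), Complex.ofReal_zero, ite_mul, zero_mul, mul_ite, mul_zero,
    Finset.sum_ite_eq, Finset.mem_univ, if_true]
  push_cast
  linear_combination (raise ν * (a (Fin.cons σ ν) p * b (Fin.cons τ ν) p) : ℂ) * hm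

lemma sum_spinOp (ha : IsSymmetricTensor a) (hb : IsSymmetricTensor b) (σ τ : Fin 4) (p : Space) :
    ∑ μ : Index (n + 1), (raise μ : ℂ) * (a μ p * spinOp σ τ b μ p) =
      Complex.I * ((n + 1 : ℕ) : ℂ) * ∑ ν : Index n, (raise ν : ℂ) *
        (a (Fin.cons σ ν) p * b (Fin.cons τ ν) p - a (Fin.cons τ ν) p * b (Fin.cons σ ν) p) := by
  have h : ∀ μ : Index (n + 1), (raise μ : ℂ) * (a μ p * spinOp σ τ b μ p) =
      ∑ i, (Complex.I * ((raise μ : ℂ) *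
          (a μ p * ((eta σ (μ i) : ℂ) * b (Function.update μ i τ) p)))
        - Complex.I * ((raise μ : ℂ) *
          (a μ p * ((eta τ (μ i) : ℂ) * b (Function.update μ i σ) p)))) := fun μ => by
    rw [spinOp, Finset.mul_sum, Finset.mul_sum, Finset.mul_sum]
    exact Finset.sum_congr rfl fun i _ => by ring
  simp only [h]
  rw [Finset.sum_comm]
  simp only [Finset.sum_sub_distrib, ← Finset.mul_sum, sum_eta_update ha hb, mul_sub]
  simp only [Finset.sum_const, Finset.card_univ, Fintype.card_fin, nsmul_eq_mul]
  ring

/-- The one-particle generator of Lorentz transformations on tensor functions. -/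
def lorentzOp (σ τ : Fin 4) (b : Index (n + 1) → Space → ℂ) (μ : Index (n + 1)) (p : Space) : ℂ :=
  orbitalOp σ τ b μ p + spinOp σ τ b μ p

lemma isAmplitude_orbitalOp (hb : ∀ μ, IsAmplitude (b μ)) (σ τ : Fin 4) (μ : Index (n + 1)) :
    IsAmplitude (orbitalOp σ τ b μ) := by
  have h := fun σ τ => ((hb μ).momentumPartial τ).mul_left (smoothOffTip_lower σ)
  have h2 := ((h σ τ).add ((h τ σ).mul_left (smoothOffTip_const (-1)))).mul_left
    (smoothOffTip_const Complex.I)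
  refine (congrArg IsAmplitude (funext fun p => ?_)).mp h2
  rw [orbitalOp]
  ring

lemma isAmplitude_spinOp (hb : ∀ μ, IsAmplitude (b μ)) (σ τ : Fin 4) (μ : Index (n + 1)) :
    IsAmplitude (spinOp σ τ b μ) := by
  have h := fun σ τ i => (hb (Function.update μ i τ)).mul_left (smoothOffTip_const (eta σ (μ i)))
  have h2 := (IsAmplitude.sum (s := Finset.univ) fun i _ => (h σ τ i).add
    ((h τ σ i).mul_left (smoothOffTip_const (-1)))).mul_left (smoothOffTip_const Complex.I)
  refine (congrArg IsAmplitude (funext fun p => ?_)).mp h2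
  rw [spinOp]
  congr 1
  exact Finset.sum_congr rfl fun i _ => by ring

lemma integrable_pairing (ha : ∀ μ, IsAmplitude (a μ)) (hb : ∀ μ, IsAmplitude (b μ)) :
    Integrable fun p : Space => (invariantDensity p : ℂ) *
      ∑ μ : Index (n + 1), (raise μ : ℂ) * (a μ p * b μ p) :=
  IsAmplitude.integrable <| (IsAmplitude.sum fun μ _ => ((ha μ).mul (hb μ)).mul_left
    (smoothOffTip_const _)).mul_left smoothOffTip_invariantDensity

lemma pairing_add {b b' : Index (n + 1) → Space → ℂ} (ha : ∀ μ, IsAmplitude (a μ))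
    (hb : ∀ μ, IsAmplitude (b μ)) (hb' : ∀ μ, IsAmplitude (b' μ)) :
    pairing a (fun μ p => b μ p + b' μ p) = pairing a b + pairing a b' := by
  rw [pairing, pairing, pairing, ← mul_add,
    ← integral_add (integrable_pairing ha hb) (integrable_pairing ha hb')]
  simp only [mul_add, Finset.sum_add_distrib]

/-- The spin part of the angular momentum. -/
lemma spinCharge_opposite (ha : ∀ μ, IsAmplitude (a μ)) (hb : ∀ μ, IsAmplitude (b μ))
    (ha' : IsSymmetricTensor a) (hb' : IsSymmetricTensor b)
    (hε : ε * ε = 1) (t : ℝ) (σ τ : Fin 4) :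
    -(-1) ^ (n + 1) * ((n + 1 : ℕ) : ℂ) / 2 *
        spinCharge (-ε) ε t (withDensity a) (withDensity b) σ τ 0 =
      1 / 2 * ε * pairing a (spinOp σ τ b) := by
  rw [spinCharge, ((isDual_opposite (isAmplitude_withDensity ha) hε t).integral_form
    (isAmplitude_withDensity hb) hε (isJetForm_spin σ τ 0)).2, pairing, ← integral_const_mul,
    ← integral_const_mul, ← integral_const_mul, ← integral_const_mul]
  refine integral_congr_ae ?_
  filter_upwards [compl_mem_ae_iff.2 (measure_singleton (0 : Space))] with p hp
  have h := invariantDensity_mul (p := p) hp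
  have h2 : ∑ ν : Index n, (raise ν : ℂ) *
      (withDensity a (Fin.cons σ ν) p * withDensity b (Fin.cons τ ν) p
        - withDensity a (Fin.cons τ ν) p * withDensity b (Fin.cons σ ν) p) =
      (invariantDensity p : ℂ) ^ 2 * ∑ ν : Index n, (raise ν : ℂ) *
        (a (Fin.cons σ ν) p * b (Fin.cons τ ν) p - a (Fin.cons τ ν) p * b (Fin.cons σ ν) p) := by
    rw [Finset.mul_sum]
    exact Finset.sum_congr rfl fun ν _ => by simp only [withDensity]; ring
  simp only [jetSpin_dual, sum_spinOp ha' hb', h2, lower_onShell_zero, Complex.ofReal_one]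
  generalize ∑ ν : Index n, (raise ν : ℂ) *
        (a (Fin.cons σ ν) p * b (Fin.cons τ ν) p - a (Fin.cons τ ν) p * b (Fin.cons σ ν) p) = X
  linear_combination ((-1) ^ (n + 1) * ((n + 1 : ℕ) : ℂ) * Complex.I * ε * invariantDensity p * X) * h

/-- The angular momentum of a negative and a positive frequency part. -/
lemma integral_jetLorentz_opposite (ha : ∀ μ, IsAmplitude (a μ)) (hb : ∀ μ, IsAmplitude (b μ))
    (ha' : IsSymmetricTensor a) (hb' : IsSymmetricTensor b)
    (hε : ε * ε = 1) (t : ℝ) (σ τ : Fin 4) :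
    ∫ y : Space, jetLorentz (fourVector t y) σ τ
      (packetJet (-ε) (withDensity a) (fourVector t y))
      (packetJet ε (withDensity b) (fourVector t y)) =
      1 / 2 * ε * pairing a (lorentzOp σ τ b) := by
  have h := pairing_add ha (isAmplitude_orbitalOp hb σ τ) (isAmplitude_spinOp hb σ τ)
  have h2 := spinCharge_opposite ha hb ha' hb' hε t σ τ
  rw [integral_jetLorentz (isAmplitude_withDensity ha) (isAmplitude_withDensity hb) hε,
    integral_orbital_opposite ha hb hε]
  have h3 : lorentzOp σ τ b = fun μ p => orbitalOp σ τ b μ p + spinOp σ τ b μ p := rfl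
  rw [h3, h]
  linear_combination h2

lemma jetMomentum_comm (σ : Fin 4) (J J' : Jet n) : jetMomentum σ J J' = jetMomentum σ J' J := by
  rw [jetMomentum, jetMomentum, jetFull, jetFull]
  congr 2
  exact Finset.sum_congr rfl fun μ _ => by ring

lemma jetSpin_comm (α β σ : Fin 4) (J J' : Jet n) : jetSpin α β σ J J' = jetSpin α β σ J' J := by
  rw [jetSpin, jetSpin]
  simp only [jetCurrent, ← Finset.sum_sub_distrib]
  exact Finset.sum_congr rfl fun ν _ => by ring

lemma jetLorentz_comm (x : Spacetime) (σ τ : Fin 4) (J J' : Jet n) :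
    jetLorentz x σ τ J J' = jetLorentz x σ τ J' J := by
  rw [jetLorentz, jetLorentz, jetMomentum_comm σ, jetMomentum_comm τ, jetSpin_comm]

end

end

section

/-! ### Gauge invariance -/

section

variable {n : ℕ} {a b g : Index (n + 1) → Space → ℂ}

/-- Tensors which are transverse in every index. -/
def IsTransverse (a : Index (n + 1) → Space → ℂ) : Prop :=
  ∀ p i μ, ∑ κ, (onShell p κ : ℂ) * a (Function.update μ i κ) p = 0

/-- Tensors with a factor `p_{μᵢ}`. -/
def IsLongitudinal (i : Fin (n + 1)) (g : Index (n + 1) → Space → ℂ) : Prop :=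
  ∃ y : Index (n + 1) → Space → ℂ, (∀ μ, IsAmplitude (y μ)) ∧
    (∀ μ κ, y (Function.update μ i κ) = y μ) ∧ ∀ μ p, g μ p = lower (onShell p) (μ i) * y μ p

lemma sum_insertNth (i : Fin (n + 1)) (f : Index (n + 1) → ℂ) :
    ∑ μ, f μ = ∑ ν : Index n, ∑ κ : Fin 4, f (i.insertNth κ ν) := by
  rw [← (Fin.insertNthEquiv (fun _ : Fin (n + 1) => Fin 4) i).sum_comp, Fintype.sum_prod_type_right]
  rfl

lemma raise_insertNth (i : Fin (n + 1)) (κ : Fin 4) (ν : Index n) :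
    raise (i.insertNth κ ν : Index (n + 1)) = metric κ * raise ν := by
  simp [raise, Fin.prod_univ_succAbove _ i]

lemma metric_mul_lower (x : Spacetime) (κ : Fin 4) : (metric κ : ℂ) * lower x κ = x κ := by
  have h : (metric κ : ℂ) * metric κ = 1 := by exact_mod_cast metric_mul_self κ
  rw [lower]
  push_cast
  linear_combination (x κ : ℂ) * h

/-- Transverse and longitudinal tensors are orthogonal. -/
lemma IsTransverse.sum_longitudinal (ha : IsTransverse a) {i : Fin (n + 1)}
    (hg : IsLongitudinal i g) (p : Space) :
    ∑ μ : Index (n + 1), (raise μ : ℂ) * (a μ p * g μ p) = 0 := by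
  obtain ⟨y, -, hy, hgy⟩ := hg
  rw [sum_insertNth i]
  refine Finset.sum_eq_zero fun ν _ => ?_
  have hu : ∀ κ : Fin 4, (i.insertNth κ ν : Index (n + 1)) =
      Function.update (i.insertNth 0 ν : Index (n + 1)) i κ := fun κ => by simp
  have h := ha p i (i.insertNth 0 ν)
  calc _ = ∑ κ, (raise ν : ℂ) * y (i.insertNth 0 ν) p * ((onShell p κ : ℂ) *
          a (Function.update (i.insertNth 0 ν : Index (n + 1)) i κ) p) := by
        refine Finset.sum_congr rfl fun κ _ => ?_
        rw [hgy, raise_insertNth, Fin.insertNth_apply_same, hu κ, hy]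
        push_cast
        linear_combination (raise ν * y (i.insertNth 0 ν) p *
          a (Function.update (i.insertNth 0 ν : Index (n + 1)) i κ) p : ℂ) *
            metric_mul_lower (onShell p) κ
    _ = 0 := by rw [← Finset.mul_sum, h, mul_zero]

lemma isLongitudinal_momentumOp {i : Fin (n + 1)} (hg : IsLongitudinal i g) (σ : Fin 4) :
    IsLongitudinal i (momentumOp σ g) := by
  obtain ⟨y, hA, hy, hgy⟩ := hg
  refine ⟨momentumOp σ y, fun μ => (hA μ).mul_left (smoothOffTip_lower σ), fun μ κ => ?_,
    fun μ p => ?_⟩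
  · ext p
    simp only [momentumOp, hy]
  · simp only [momentumOp, hgy]
    ring

lemma lower_onShell_tip (κ : Fin 4) : lower (onShell 0) κ = 0 := by
  refine Fin.cases ?_ (fun j => ?_) κ <;> simp [lower, onShell, fourVector]

/-- The Lorentz generators respect the longitudinal tensors: the derivative of `p_{μᵢ}` cancels the
spin term of the index `μᵢ`. -/
lemma isLongitudinal_lorentzOp {i : Fin (n + 1)} (hg : IsLongitudinal i g) (σ τ : Fin 4) :
    IsLongitudinal i (lorentzOp σ τ g) := by
  obtain ⟨y, hA, hy, hgy⟩ := hg
  refine ⟨fun μ p => orbitalOp σ τ y μ p + Complex.I * ∑ j ∈ Finset.univ.erase i,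
      ((eta σ (μ j) : ℂ) * y (Function.update μ j τ) p
        - (eta τ (μ j) : ℂ) * y (Function.update μ j σ) p), fun μ => ?_, fun μ κ => ?_,
    fun μ p => ?_⟩
  · refine (isAmplitude_orbitalOp hA σ τ μ).add (IsAmplitude.mul_left (.sum fun j _ => ?_)
      (smoothOffTip_const _))
    have h := ((hA (Function.update μ j τ)).mul_left (smoothOffTip_const (eta σ (μ j)))).add
      ((hA (Function.update μ j σ)).mul_left (smoothOffTip_const (-eta τ (μ j))))
    refine (congrArg IsAmplitude (funext fun p => ?_)).mp h
    ring
  · ext p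
    simp only [orbitalOp, hy]
    congr 2
    refine Finset.sum_congr rfl fun j hj => ?_
    have hj : j ≠ i := Finset.ne_of_mem_erase hj
    rw [Function.update_of_ne hj, Function.update_comm hj.symm, Function.update_comm hj.symm, hy, hy]
  · by_cases hp : p = 0
    · subst hp
      have h0 : ∀ μ, g μ = fun p => lower (onShell p) (μ i) * y μ p := fun μ => funext (hgy μ)
      have hgA : ∀ μ, IsAmplitude (g μ) := fun μ => by
        rw [h0]; exact (hA μ).mul_left (smoothOffTip_lower _)
      have h1 : lower (onShell 0) (μ i) = 0 := lower_onShell_tip _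
      rw [lorentzOp, (isAmplitude_orbitalOp hgA σ τ μ).apply_zero,
        (isAmplitude_spinOp hgA σ τ μ).apply_zero, h1]
      simp
    have hd : ∀ l, momentumPartial l (g μ) p = coneDeriv p l (μ i) * y μ p +
        lower (onShell p) (μ i) * momentumPartial l (y μ) p := fun l => by
      rw [funext (hgy μ), momentumPartial_mul ((smoothOffTip_lower _).differentiableAt hp)
        ((hA μ).differentiable p), momentumPartial_lower l _ hp, coneDeriv]
    have hs : ∑ j, ((eta σ (μ j) : ℂ) * g (Function.update μ j τ) p
          - (eta τ (μ j) : ℂ) * g (Function.update μ j σ) p) =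
        ((eta σ (μ i) : ℂ) * lower (onShell p) τ - (eta τ (μ i) : ℂ) * lower (onShell p) σ) * y μ p
        + lower (onShell p) (μ i) * ∑ j ∈ Finset.univ.erase i,
          ((eta σ (μ j) : ℂ) * y (Function.update μ j τ) p
            - (eta τ (μ j) : ℂ) * y (Function.update μ j σ) p) := by
      rw [← Finset.add_sum_erase _ _ (Finset.mem_univ i), Finset.mul_sum]
      congr 1
      · simp only [hgy, hy, Function.update_self]
        ring
      · refine Finset.sum_congr rfl fun j hj => ?_
        have hj : i ≠ j := (Finset.ne_of_mem_erase hj).symm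
        simp only [hgy, Function.update_of_ne hj]
        ring
    rw [lorentzOp, spinOp, hs]
    simp only [orbitalOp, hd, coneDeriv]
    ring

end

end

section

/-! ### Longitudinal parts of the averaged potentials -/

section

variable {n : ℕ} {a b : Index (n + 1) → Space → ℂ} {c c' : Spacetime → ℂ}
  (φ ψ : WaveFunction (n + 1))

/-- The contribution of the set `S` of derivative indices `ν` in the expansion of the curls to the
averaged potential. -/
def stringTerm (c : Spacetime → ℂ) (φ : WaveFunction (n + 1)) (S : Finset (Fin (n + 1)))
    (μ : Index (n + 1)) (p : Space) : ℂ :=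
  ∑ ν : Index (n + 1), (-1) ^ S.card * (-Complex.I) ^ (n + 1) * (n.factorial : ℂ)⁻¹ *
    (directionMoment n (directionComponent c ν) p *
      ((∏ i, (lower (onShell p) (if i ∈ S then ν i else μ i) : ℂ)) *
        φ.toFun p (fun i => if i ∈ S then μ i else ν i)))

/-- The amplitude of the averaged potential with respect to the invariant measure. -/
def stringTensor (c : Spacetime → ℂ) (φ : WaveFunction (n + 1)) (μ : Index (n + 1)) (p : Space) : ℂ :=
  ∑ S, stringTerm c φ S μ p

/-- The product of the curls is expanded into the choices, for each index, of one of its two terms. -/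
lemma averagedAmplitude_eq (c : Spacetime → ℂ) (φ : WaveFunction (n + 1)) (μ : Index (n + 1)) :
    averagedAmplitude c φ μ = withDensity (stringTensor c φ) μ := by
  ext p
  simp only [averagedAmplitude, withDensity, stringTensor, stringTerm, curlAmplitude]
  rw [Finset.sum_comm, Finset.mul_sum]
  refine Finset.sum_congr rfl fun ν _ => ?_
  simp only [Finset.mul_sum]
  exact Finset.sum_congr rfl fun S _ => by ring

lemma isAmplitude_stringTerm (hc : IsBump c) (S : Finset (Fin (n + 1))) (μ : Index (n + 1)) :
    IsAmplitude (stringTerm c φ S μ) :=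
  .sum fun ν _ => (((φ.isAmplitude _).mul_left (.prod fun _ _ => smoothOffTip_lower _)).mul_left
    (smoothOffTip_directionMoment n (hc.directionComponent ν))).mul_left (smoothOffTip_const _)

lemma isAmplitude_stringTensor (hc : IsBump c) (μ : Index (n + 1)) :
    IsAmplitude (stringTensor c φ μ) := .sum fun S _ => isAmplitude_stringTerm φ hc S μ

/-- The term in which all derivatives are contracted with the string direction undoes the string
integrations. -/
lemma stringTerm_univ (hc : IsBump c) (μ : Index (n + 1)) (p : Space) :
    stringTerm c φ Finset.univ μ p = (∫ e, c e) * φ.toFun p μ := by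
  by_cases hp : p = 0
  · subst hp
    rw [(isAmplitude_stringTerm φ hc _ μ).apply_zero, (φ.isAmplitude μ).apply_zero, mul_zero]
  have h := sum_directionMoment hc n hp
  have hn : (n.factorial : ℂ) ≠ 0 := by exact_mod_cast n.factorial_ne_zero
  have hI : (-Complex.I) ^ (n + 1) * (-Complex.I) ^ (n + 1) = (-1) ^ (n + 1) := by
    rw [← mul_pow]; simp
  have h1 : (-1 : ℂ) ^ (n + 1) * (-1) ^ (n + 1) = 1 := by rw [← mul_pow]; simp
  simp only [stringTerm, Finset.mem_univ, if_true, Finset.card_univ, Fintype.card_fin]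
  calc _ = (-1) ^ (n + 1) * (-Complex.I) ^ (n + 1) * (n.factorial : ℂ)⁻¹ * φ.toFun p μ *
        ∑ ν : Index (n + 1), (∏ i, (lower (onShell p) (ν i) : ℂ)) *
          directionMoment n (directionComponent c ν) p := by
        rw [Finset.mul_sum]
        exact Finset.sum_congr rfl fun ν _ => by ring
    _ = ((-1 : ℂ) ^ (n + 1) * ((-Complex.I) ^ (n + 1) * (-Complex.I) ^ (n + 1))) *
        ((n.factorial : ℂ)⁻¹ * n.factorial) * ((∫ e, c e) * φ.toFun p μ) := by rw [h]; ring
    _ = _ := by rw [hI, h1, inv_mul_cancel₀ hn]; ring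

/-- An index outside `S` is carried by a factor of momentum. -/
lemma exists_isLongitudinal_stringTerm (hc : IsBump c) {S : Finset (Fin (n + 1))}
    (hS : S ≠ Finset.univ) : ∃ i, IsLongitudinal i (stringTerm c φ S) := by
  obtain ⟨i, hi⟩ : ∃ i, i ∉ S := by
    by_contra! h
    exact hS (Finset.eq_univ_iff_forall.2 h)
  refine ⟨i, fun μ p => ∑ ν : Index (n + 1),
    (-1) ^ S.card * (-Complex.I) ^ (n + 1) * (n.factorial : ℂ)⁻¹ *
    (directionMoment n (directionComponent c ν) p *
      ((∏ j ∈ Finset.univ.erase i, (lower (onShell p) (if j ∈ S then ν j else μ j) : ℂ)) *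
        φ.toFun p (fun j => if j ∈ S then μ j else ν j))), fun μ => ?_, fun μ κ => ?_,
    fun μ p => ?_⟩
  · exact .sum fun ν _ => (((φ.isAmplitude _).mul_left
      (.prod fun _ _ => smoothOffTip_lower _)).mul_left
      (smoothOffTip_directionMoment n (hc.directionComponent ν))).mul_left (smoothOffTip_const _)
  · ext p
    refine Finset.sum_congr rfl fun ν _ => ?_
    congr 3
    · refine Finset.prod_congr rfl fun j hj => ?_
      rw [Function.update_of_ne (Finset.ne_of_mem_erase hj)]
    · refine congrArg _ (funext fun j => ?_)
      by_cases hj : j ∈ S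
      · rw [if_pos hj, if_pos hj, Function.update_of_ne (show j ≠ i from fun h => hi (h ▸ hj))]
      · rw [if_neg hj, if_neg hj]
  · rw [stringTerm, Finset.mul_sum]
    refine Finset.sum_congr rfl fun ν _ => ?_
    rw [← Finset.mul_prod_erase Finset.univ _ (Finset.mem_univ i), if_neg hi]
    ring

lemma sum_onShell_mul_lower (p : Space) :
    ∑ κ, (onShell p κ : ℂ) * lower (onShell p) κ = 0 := by
  rw [← onShell_sq p]
  refine Finset.sum_congr rfl fun κ _ => ?_
  rw [← metric_mul_lower (onShell p) κ]
  ring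

/-- Two sources of transversality: the wave function is transverse, and `p² = 0` on the cone. -/
lemma isTransverse_stringTensor (c : Spacetime → ℂ) : IsTransverse (stringTensor c φ) := by
  intro p i μ
  simp only [stringTensor, Finset.mul_sum]
  rw [Finset.sum_comm]
  refine Finset.sum_eq_zero fun S _ => ?_
  simp only [stringTerm, Finset.mul_sum]
  rw [Finset.sum_comm]
  refine Finset.sum_eq_zero fun ν _ => ?_
  set k : ℂ := (-1) ^ S.card * (-Complex.I) ^ (n + 1) * (n.factorial : ℂ)⁻¹
  by_cases hi : i ∈ S
  · -- the wave function is transverse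
    have h1 : ∀ κ j, (if j ∈ S then ν j else Function.update μ i κ j) =
        if j ∈ S then ν j else μ j := fun κ j => by
      by_cases hj : j ∈ S
      · rw [if_pos hj, if_pos hj]
      · rw [if_neg hj, if_neg hj, Function.update_of_ne (show j ≠ i from fun h => hj (h ▸ hi))]
    have h2 : ∀ κ, (fun j => if j ∈ S then Function.update μ i κ j else ν j) =
        Function.update (fun j => if j ∈ S then μ j else ν j) i κ := fun κ => by
      funext j
      by_cases hj : j = i
      · subst hj; simp [hi]
      · simp [hj]
    have h3 := φ.transverse p i fun j => if j ∈ S then μ j else ν j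
    simp only [h1, h2]
    calc _ = k * directionMoment n (directionComponent c ν) p *
          (∏ j, (lower (onShell p) (if j ∈ S then ν j else μ j) : ℂ)) *
          ∑ κ, (onShell p κ : ℂ) * φ.toFun p
            (Function.update (fun j => if j ∈ S then μ j else ν j) i κ) := by
          rw [Finset.mul_sum]
          exact Finset.sum_congr rfl fun κ _ => by ring
      _ = 0 := by rw [h3, mul_zero]
  · -- the momentum is light-like
    have h1 : ∀ κ, (∏ j, (lower (onShell p) (if j ∈ S then ν j else Function.update μ i κ j) : ℂ)) =
        lower (onShell p) κ * ∏ j ∈ Finset.univ.erase i,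
          (lower (onShell p) (if j ∈ S then ν j else μ j) : ℂ) := fun κ => by
      rw [← Finset.mul_prod_erase Finset.univ _ (Finset.mem_univ i), if_neg hi,
        Function.update_self]
      congr 1
      refine Finset.prod_congr rfl fun j hj => ?_
      rw [Function.update_of_ne (Finset.ne_of_mem_erase hj)]
    have h2 : ∀ κ, (fun j => if j ∈ S then Function.update μ i κ j else ν j) =
        fun j => if j ∈ S then μ j else ν j := fun κ => by
      funext j
      by_cases hj : j ∈ S
      · rw [if_pos hj, if_pos hj, Function.update_of_ne (show j ≠ i from fun h => hi (h ▸ hj))]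
      · rw [if_neg hj, if_neg hj]
    simp only [h1, h2]
    calc _ = k * directionMoment n (directionComponent c ν) p *
          (∏ j ∈ Finset.univ.erase i, (lower (onShell p) (if j ∈ S then ν j else μ j) : ℂ)) *
          φ.toFun p (fun j => if j ∈ S then μ j else ν j) *
          ∑ κ, (onShell p κ : ℂ) * lower (onShell p) κ := by
          rw [Finset.mul_sum]
          exact Finset.sum_congr rfl fun κ _ => by ring
      _ = 0 := by rw [sum_onShell_mul_lower, mul_zero]

lemma directionComponent_comp_perm (c : Spacetime → ℂ) (π : Equiv.Perm (Fin (n + 1)))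
    (ν : Index (n + 1)) : directionComponent c (ν ∘ π) = directionComponent c ν := by
  ext e
  rw [directionComponent, directionComponent]
  congr 1
  exact Equiv.prod_comp π fun i => (e (ν i) : ℂ)

lemma isSymmetricTensor_stringTensor (c : Spacetime → ℂ) : IsSymmetricTensor (stringTensor c φ) := by
  intro π μ
  ext p
  simp only [stringTensor]
  rw [← Equiv.sum_comp (Equiv.finsetCongr π.symm)]
  refine Finset.sum_congr rfl fun S _ => ?_
  simp only [stringTerm]
  rw [← Equiv.sum_comp (Equiv.arrowCongr π.symm (Equiv.refl (Fin 4)))]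
  refine Finset.sum_congr rfl fun ν _ => ?_
  have h1 : (Equiv.arrowCongr π.symm (Equiv.refl (Fin 4))) ν = ν ∘ π := by
    ext j; simp [Equiv.arrowCongr]
  have h2 : ∀ i, i ∈ Equiv.finsetCongr π.symm S ↔ π i ∈ S := fun i => by simp
  have h3 : (Equiv.finsetCongr π.symm S).card = S.card := by simp
  rw [h1, directionComponent_comp_perm, h3]
  simp only [h2, Function.comp_apply]
  congr 3
  · exact Equiv.prod_comp π fun i => (lower (onShell p) (if i ∈ S then ν i else μ i) : ℂ)
  · exact φ.symm p π fun i => if i ∈ S then μ i else ν i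

/-! ### Contractions of the averaged potentials -/

lemma sum_stringTerms (p : Space) (ha : IsTransverse a)
    {G : Finset (Fin (n + 1)) → Index (n + 1) → Space → ℂ}
    (hG : ∀ S, S ≠ Finset.univ → ∃ i, IsLongitudinal i (G S)) :
    ∑ μ : Index (n + 1), (raise μ : ℂ) * (a μ p * ∑ S, G S μ p) =
      ∑ μ : Index (n + 1), (raise μ : ℂ) * (a μ p * G Finset.univ μ p) := by
  simp only [Finset.mul_sum]
  rw [Finset.sum_comm, Finset.sum_eq_single_of_mem Finset.univ (Finset.mem_univ _)]
  intro S _ hS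
  obtain ⟨i, hi⟩ := hG S hS
  exact ha.sum_longitudinal hi p

lemma sum_stringTensor (hc : IsBump c) (ha : IsTransverse a) (p : Space) :
    ∑ μ : Index (n + 1), (raise μ : ℂ) * (a μ p * stringTensor c φ μ p) =
      (∫ e, c e) * ∑ μ : Index (n + 1), (raise μ : ℂ) * (a μ p * φ.toFun p μ) := by
  simp only [stringTensor]
  rw [sum_stringTerms p ha fun S hS => exists_isLongitudinal_stringTerm φ hc hS, Finset.mul_sum]
  exact Finset.sum_congr rfl fun μ _ => by rw [stringTerm_univ φ hc]; ring

lemma sum_momentumOp_stringTensor (hc : IsBump c) (ha : IsTransverse a) (σ : Fin 4) (p : Space) :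
    ∑ μ : Index (n + 1), (raise μ : ℂ) * (a μ p * momentumOp σ (stringTensor c φ) μ p) =
      (∫ e, c e) * ∑ μ : Index (n + 1), (raise μ : ℂ) * (a μ p * (momentum σ φ).toFun p μ) := by
  have h : ∀ μ, momentumOp σ (stringTensor c φ) μ p =
      ∑ S, momentumOp σ (stringTerm c φ S) μ p := fun μ => Finset.mul_sum _ _ _
  simp only [h]
  rw [sum_stringTerms p ha, Finset.mul_sum]
  · refine Finset.sum_congr rfl fun μ _ => ?_
    rw [momentumOp, stringTerm_univ φ hc, momentum]
    ring
  · intro S hS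
    obtain ⟨i, hi⟩ := exists_isLongitudinal_stringTerm φ hc hS
    exact ⟨i, isLongitudinal_momentumOp hi σ⟩

lemma lorentzOp_sum {ι : Type*} [Fintype ι] {G : ι → Index (n + 1) → Space → ℂ}
    (hG : ∀ S μ, IsAmplitude (G S μ)) (σ τ : Fin 4) (μ : Index (n + 1)) (p : Space) :
    lorentzOp σ τ (fun μ p => ∑ S, G S μ p) μ p = ∑ S, lorentzOp σ τ (G S) μ p := by
  have h := fun l => momentumPartial_sum (s := Finset.univ) (l := l)
    fun S _ => (hG S μ).differentiable p
  simp only [lorentzOp, orbitalOp, spinOp, Finset.sum_add_distrib]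
  rw [h, h]
  congr 1
  · simp only [Finset.mul_sum, ← Finset.sum_sub_distrib]
  · rw [← Finset.mul_sum, Finset.sum_comm]
    simp only [Finset.mul_sum, ← Finset.sum_sub_distrib]

lemma lorentzOp_const_mul (C : ℂ) (σ τ : Fin 4) (μ : Index (n + 1)) (p : Space) :
    lorentzOp σ τ (fun μ p => C * φ.toFun p μ) μ p = C * (lorentz σ τ φ).toFun p μ := by
  have h : ∀ l, momentumPartial l (fun p => C * φ.toFun p μ) p = C * momentumDeriv φ l p μ := by
    intro l
    rw [momentumPartial_mul (differentiableAt_const _) ((φ.isAmplitude μ).differentiable p),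
      momentumPartial_const, zero_mul, zero_add]
    rfl
  show _ = C * lorentzFun σ τ φ p μ
  simp only [lorentzOp, orbitalOp, spinOp, lorentzFun, h, mul_add]
  congr 1
  · ring
  · simp only [Finset.mul_sum]
    exact Finset.sum_congr rfl fun i _ => by ring

lemma sum_lorentzOp_stringTensor (hc : IsBump c) (ha : IsTransverse a) (σ τ : Fin 4) (p : Space) :
    ∑ μ : Index (n + 1), (raise μ : ℂ) * (a μ p * lorentzOp σ τ (stringTensor c φ) μ p) =
      (∫ e, c e) * ∑ μ : Index (n + 1), (raise μ : ℂ) * (a μ p * (lorentz σ τ φ).toFun p μ) := by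
  have h : ∀ μ, lorentzOp σ τ (stringTensor c φ) μ p =
      ∑ S, lorentzOp σ τ (stringTerm c φ S) μ p := fun μ =>
    lorentzOp_sum (isAmplitude_stringTerm φ hc) σ τ μ p
  simp only [h]
  rw [sum_stringTerms p ha, Finset.mul_sum]
  · refine Finset.sum_congr rfl fun μ _ => ?_
    rw [funext fun μ => funext fun p => stringTerm_univ φ hc μ p, lorentzOp_const_mul]
    ring
  · intro S hS
    obtain ⟨i, hi⟩ := exists_isLongitudinal_stringTerm φ hc hS
    exact ⟨i, isLongitudinal_lorentzOp hi σ τ⟩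

lemma WaveFunction.isTransverse_conj (χ : WaveFunction (n + 1)) :
    IsTransverse fun μ p => conj (χ.toFun p μ) := by
  intro p i μ
  have h := congrArg (starRingEnd ℂ) (χ.transverse p i μ)
  simpa using h

/-- The complex conjugate of the averaged potential, averaged with the conjugate function. -/
def conjTensor (c : Spacetime → ℂ) (φ : WaveFunction (n + 1)) (μ : Index (n + 1)) (p : Space) : ℂ :=
  conj (stringTensor (fun e => conj (c e)) φ μ p)

lemma isTransverse_conjTensor (c : Spacetime → ℂ) : IsTransverse (conjTensor c φ) := by
  intro p i μ
  have h := congrArg (starRingEnd ℂ) (isTransverse_stringTensor φ (fun e => conj (c e)) p i μ)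
  simpa [conjTensor] using h

lemma sum_conjTensor (hc : IsStringTest c) (χ : WaveFunction (n + 1)) (p : Space) :
    ∑ μ : Index (n + 1), (raise μ : ℂ) * (conjTensor c φ μ p * χ.toFun p μ) =
      (∫ e, c e) * ∑ μ : Index (n + 1), (raise μ : ℂ) * (conj (φ.toFun p μ) * χ.toFun p μ) := by
  have h := congrArg (starRingEnd ℂ)
    (sum_stringTensor φ hc.conj.isBump χ.isTransverse_conj p)
  rw [map_mul, ← integral_conj] at h
  simp only [map_sum, map_mul, Complex.conj_conj, Complex.conj_ofReal] at h
  calc _ = ∑ μ : Index (n + 1), (raise μ : ℂ) * (χ.toFun p μ *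
        conj (stringTensor (fun e => conj (c e)) φ μ p)) :=
        Finset.sum_congr rfl fun μ _ => by rw [conjTensor]; ring
    _ = _ := by
        rw [h]
        congr 1
        exact Finset.sum_congr rfl fun μ _ => by ring

/-- The averaged potentials reproduce the one-particle matrix elements: the longitudinal parts by
which they differ from the wave functions do not contribute. -/
lemma pairing_eq_oneParticleInner (hc : IsStringTest c) {M : Index (n + 1) → Space → ℂ} {C : ℂ}
    {χ : WaveFunction (n + 1)}
    (hM : ∀ {a : Index (n + 1) → Space → ℂ}, IsTransverse a → ∀ p,
      ∑ μ : Index (n + 1), (raise μ : ℂ) * (a μ p * M μ p) =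
        C * ∑ μ : Index (n + 1), (raise μ : ℂ) * (a μ p * χ.toFun p μ)) :
    pairing (conjTensor c φ) M = (∫ e, c e) * C * oneParticleInner φ χ := by
  rw [pairing, oneParticleInner, mul_left_comm ((∫ e, c e) * C)]
  congr 1
  rw [← integral_const_mul]
  refine integral_congr_ae (.of_forall fun p => ?_)
  simp only [hM (isTransverse_conjTensor φ c), sum_conjTensor φ hc]
  ring

lemma isAmplitude_conjTensor (hc : IsStringTest c) (μ : Index (n + 1)) :
    IsAmplitude (conjTensor c φ μ) := (isAmplitude_stringTensor φ hc.conj.isBump μ).conj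

lemma isSymmetricTensor_conjTensor (c : Spacetime → ℂ) : IsSymmetricTensor (conjTensor c φ) := by
  intro π μ
  ext p
  rw [conjTensor, isSymmetricTensor_stringTensor φ _ π μ, conjTensor]

lemma averagedTensor_true (c : Spacetime → ℂ) (φ : WaveFunction (n + 1)) :
    averagedTensor c (true, φ) = withDensity (conjTensor c φ) := by
  ext μ p
  simp [averagedTensor, averagedAmplitude_eq, withDensity, conjTensor]

lemma averagedTensor_false (c : Spacetime → ℂ) (φ : WaveFunction (n + 1)) :
    averagedTensor c (false, φ) = withDensity (stringTensor c φ) := by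
  ext μ p
  simp [averagedTensor, averagedAmplitude_eq]

end

end

section

/-! ### The generators on Fock space -/

section

variable {n : ℕ} {c c' : Spacetime → ℂ}

/-- A Wick bilinear whose mixed terms are matrix elements of a one-particle operator, and whose
other terms vanish, is the second quantisation of the operator. -/
lemma sum_wickCoeff_mul (Ψ Φ : Fock (n + 1)) {f : WickIndex (n + 1) → ℂ} {C : ℂ}
    {L : WaveFunction (n + 1) → WaveFunction (n + 1)}
    (h1 : ∀ φ ψ, f ((false, φ), (false, ψ)) = 0) (h2 : ∀ φ ψ, f ((true, φ), (true, ψ)) = 0)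
    (h3 : ∀ φ ψ, f ((true, φ), (false, ψ)) = 1 / 2 * (C * oneParticleInner φ (L ψ)))
    (h4 : ∀ φ ψ, f ((false, ψ), (true, φ)) = 1 / 2 * (C * oneParticleInner φ (L ψ))) :
    ∑ i ∈ wickIndices Ψ Φ, wickCoeff Ψ Φ i * f i = C * fockInner Ψ (secondQuantize L Φ) := by
  rw [sum_wickIndices, fockInner_secondQuantize, Finset.mul_sum]
  refine Finset.sum_congr rfl fun φ _ => ?_
  rw [Finset.mul_sum]
  refine Finset.sum_congr rfl fun ψ _ => ?_
  rw [h1, h2, h3, h4]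
  simp only [wickCoeff]
  ring

lemma frequency_mul_self (b : Bool) : frequency b * frequency b = 1 := by
  cases b <;> simp [frequency]

lemma integral_averagedForm_momentum_mixed (hc : IsStringTest c) (hc' : IsStringTest c')
    (φ ψ : WaveFunction (n + 1)) (t : ℝ) (σ : Fin 4) :
    ∫ y : Space, averagedForm c c' (jetMomentum σ) ((true, φ), (false, ψ)) (fourVector t y) =
      1 / 2 * ((∫ e, c e) * (∫ e, c' e) * oneParticleInner φ (momentum σ ψ)) := by
  have h := integral_jetMomentum_opposite (isAmplitude_conjTensor φ hc)
    (isAmplitude_stringTensor ψ hc'.isBump) (ε := 1) (by norm_num) t σ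
  rw [pairing_eq_oneParticleInner φ hc fun ha p =>
    sum_momentumOp_stringTensor ψ hc'.isBump ha σ p] at h
  simpa only [averagedForm, averagedTensor_true, averagedTensor_false, frequency, if_true,
    Bool.false_eq_true, if_false] using h

lemma integral_averagedForm_lorentz_mixed (hc : IsStringTest c) (hc' : IsStringTest c')
    (φ ψ : WaveFunction (n + 1)) (t : ℝ) (σ τ : Fin 4) :
    ∫ y : Space, averagedForm c c' (jetLorentz (fourVector t y) σ τ) ((true, φ), (false, ψ))
        (fourVector t y) =
      1 / 2 * ((∫ e, c e) * (∫ e, c' e) * oneParticleInner φ (lorentz σ τ ψ)) := by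
  have h := integral_jetLorentz_opposite (isAmplitude_conjTensor φ hc)
    (isAmplitude_stringTensor ψ hc'.isBump) (isSymmetricTensor_conjTensor φ c)
    (isSymmetricTensor_stringTensor ψ c') (ε := 1) (by norm_num) t σ τ
  rw [pairing_eq_oneParticleInner φ hc fun ha p =>
    sum_lorentzOp_stringTensor ψ hc'.isBump ha σ τ p, Complex.ofReal_one, mul_one] at h
  simpa only [averagedForm, averagedTensor_true, averagedTensor_false, frequency, if_true,
    Bool.false_eq_true, if_false] using h

lemma integrable_averagedForm (hc : IsStringTest c) (hc' : IsStringTest c') (t : ℝ)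
    {B : Jet n → Jet n → ℂ} (hB : IsJetForm B) (i : WickIndex (n + 1)) :
    Integrable fun y : Space => averagedForm c c' B i (fourVector t y) :=
  hB.integrable_slice (isAmplitude_averagedTensor hc i.1) (isAmplitude_averagedTensor hc' i.2)
    (frequency_mul_self _) t

lemma integrable_lower_mul_averagedForm (hc : IsStringTest c) (hc' : IsStringTest c') (t : ℝ)
    {B : Jet n → Jet n → ℂ} (hB : IsJetForm B) (l : Fin 4) (i : WickIndex (n + 1)) :
    Integrable fun y : Space => (lower (fourVector t y) l : ℂ) *
      averagedForm c c' B i (fourVector t y) :=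
  hB.integrable_lower_slice (isAmplitude_averagedTensor hc i.1) (isAmplitude_averagedTensor hc' i.2)
    (frequency_mul_self _) t l

lemma integrable_averagedForm_lorentz (hc : IsStringTest c) (hc' : IsStringTest c') (t : ℝ)
    (σ τ : Fin 4) (i : WickIndex (n + 1)) :
    Integrable fun y : Space =>
      averagedForm c c' (jetLorentz (fourVector t y) σ τ) i (fourVector t y) :=
  integrable_jetLorentz (isAmplitude_averagedTensor hc i.1) (isAmplitude_averagedTensor hc' i.2)
    (frequency_mul_self _) t σ τ

/-- The averaged densities of momentum integrate to the generators of translations. -/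
lemma integral_averagedMomentumDensity (hc : IsStringTest c) (hc' : IsStringTest c')
    (Ψ Φ : Fock (n + 1)) (t : ℝ) (σ : Fin 4) :
    ∫ y : Space, averagedMomentumDensity c c' σ Ψ Φ (fourVector t y) =
      (∫ e, c e) * (∫ e', c' e') * fockInner Ψ (secondQuantize (momentum σ) Φ) := by
  simp only [averagedMomentumDensity_eq Ψ Φ _ hc hc']
  rw [integral_finsetSum _ fun i _ =>
    (integrable_averagedForm hc hc' t (isJetForm_momentum σ) i).const_mul _]
  simp only [integral_const_mul]
  have hT := isAmplitude_averagedTensor (n := n) hc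
  have hT' := isAmplitude_averagedTensor (n := n) hc'
  refine sum_wickCoeff_mul Ψ Φ (fun φ ψ => ?_) (fun φ ψ => ?_)
    (fun φ ψ => integral_averagedForm_momentum_mixed hc hc' φ ψ t σ) (fun φ ψ => ?_)
  · exact integral_jetMomentum_same (hT _) (hT' _) (frequency_mul_self _) t σ
  · exact integral_jetMomentum_same (hT _) (hT' _) (frequency_mul_self _) t σ
  · have h := integral_averagedForm_momentum_mixed hc' hc φ ψ t σ
    simp only [averagedForm, jetMomentum_comm σ (packetJet (frequency true) _ _)] at h
    simp only [averagedForm]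
    rw [h, mul_comm (∫ e, c' e)]

/-- The averaged densities of angular momentum integrate to the Lorentz generators. -/
lemma integral_averagedLorentzDensity (hc : IsStringTest c) (hc' : IsStringTest c')
    (Ψ Φ : Fock (n + 1)) (t : ℝ) (σ τ : Fin 4) :
    ∫ y : Space, averagedLorentzDensity c c' σ τ Ψ Φ (fourVector t y) =
      (∫ e, c e) * (∫ e', c' e') * fockInner Ψ (secondQuantize (lorentz σ τ) Φ) := by
  simp only [averagedLorentzDensity_eq Ψ Φ _ hc hc']
  rw [integral_finsetSum _ fun i _ =>
    (integrable_averagedForm_lorentz hc hc' t σ τ i).const_mul _]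
  simp only [integral_const_mul]
  have hT := isAmplitude_averagedTensor (n := n) hc
  have hT' := isAmplitude_averagedTensor (n := n) hc'
  refine sum_wickCoeff_mul Ψ Φ (fun φ ψ => ?_) (fun φ ψ => ?_)
    (fun φ ψ => integral_averagedForm_lorentz_mixed hc hc' φ ψ t σ τ) (fun φ ψ => ?_)
  · exact integral_jetLorentz_same (hT _) (hT' _) (frequency_mul_self _) t σ τ
  · exact integral_jetLorentz_same (hT _) (hT' _) (frequency_mul_self _) t σ τ
  · have h := integral_averagedForm_lorentz_mixed hc' hc φ ψ t σ τ
    simp only [averagedForm, jetLorentz_comm _ σ τ (packetJet (frequency true) _ _)] at h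
    simp only [averagedForm]
    rw [h, mul_comm (∫ e, c' e)]

/-- The improvement term drops out of the total momentum. -/
lemma integral_averagedStressTensor (hc : IsStringTest c) (hc' : IsStringTest c')
    (Ψ Φ : Fock (n + 1)) (t : ℝ) (σ : Fin 4) :
    ∫ y : Space, averagedStressTensor c c' 0 σ Ψ Φ (fourVector t y) =
      ∫ y : Space, averagedMomentumDensity c c' σ Ψ Φ (fourVector t y) := by
  simp only [averagedMomentumDensity_eq Ψ Φ _ hc hc', averagedStressTensor_eq Ψ Φ _ hc hc']
  rw [integral_finsetSum _ fun i _ =>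
    (integrable_averagedForm hc hc' t (isJetForm_momentum σ) i).const_mul _,
    integral_finsetSum _ fun i _ =>
    (integrable_averagedForm hc hc' t (isJetForm_stress 0 σ) i).const_mul _]
  simp only [integral_const_mul]
  refine Finset.sum_congr rfl fun i _ => ?_
  congr 1
  exact integral_jetStress (isAmplitude_averagedTensor hc i.1) (isAmplitude_averagedTensor hc' i.2)
    (frequency_mul_self _) t σ

lemma integrable_lower_mul_averagedStressTensor (hc : IsStringTest c) (hc' : IsStringTest c')
    (Ψ Φ : Fock (n + 1)) (t : ℝ) (σ τ : Fin 4) :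
    Integrable fun y : Space => (lower (fourVector t y) σ : ℂ) *
      averagedStressTensor c c' 0 τ Ψ Φ (fourVector t y) := by
  simp only [averagedStressTensor_eq Ψ Φ _ hc hc', Finset.mul_sum, mul_left_comm (lower _ _ : ℂ)]
  exact integrable_finsetSum _ fun i _ =>
    (integrable_lower_mul_averagedForm hc hc' t (isJetForm_stress 0 τ) σ i).const_mul _

/-- In the angular momentum, the improvement term becomes the spin density. -/
lemma integral_moment_averagedStressTensor (hc : IsStringTest c) (hc' : IsStringTest c')
    (Ψ Φ : Fock (n + 1)) (t : ℝ) (σ τ : Fin 4) :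
    ∫ y : Space, ((lower (fourVector t y) σ : ℂ) *
          averagedStressTensor c c' 0 τ Ψ Φ (fourVector t y)
        - (lower (fourVector t y) τ : ℂ) * averagedStressTensor c c' 0 σ Ψ Φ (fourVector t y)) =
      ∫ y : Space, averagedLorentzDensity c c' σ τ Ψ Φ (fourVector t y) := by
  have h : ∀ y : Space, (lower (fourVector t y) σ : ℂ) *
          averagedStressTensor c c' 0 τ Ψ Φ (fourVector t y)
        - (lower (fourVector t y) τ : ℂ) * averagedStressTensor c c' 0 σ Ψ Φ (fourVector t y) =
      ∑ i ∈ wickIndices Ψ Φ, wickCoeff Ψ Φ i *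
        averagedForm c c' (jetMoment (fourVector t y) σ τ) i (fourVector t y) := fun y => by
    simp only [averagedStressTensor_eq Ψ Φ _ hc hc', Finset.mul_sum, ← Finset.sum_sub_distrib]
    exact Finset.sum_congr rfl fun i _ => by simp only [averagedForm, jetMoment]; ring
  have hi : ∀ i : WickIndex (n + 1), Integrable fun y : Space =>
      averagedForm c c' (jetMoment (fourVector t y) σ τ) i (fourVector t y) := fun i =>
    (integrable_lower_mul_averagedForm hc hc' t (isJetForm_stress 0 τ) σ i).sub
      (integrable_lower_mul_averagedForm hc hc' t (isJetForm_stress 0 σ) τ i)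
  simp only [h, averagedLorentzDensity_eq Ψ Φ _ hc hc']
  rw [integral_finsetSum _ fun i _ => (hi i).const_mul _,
    integral_finsetSum _ fun i _ =>
    (integrable_averagedForm_lorentz hc hc' t σ τ i).const_mul _]
  simp only [integral_const_mul]
  refine Finset.sum_congr rfl fun i _ => ?_
  congr 1
  exact integral_jetMoment (isAmplitude_averagedTensor hc i.1) (isAmplitude_averagedTensor hc' i.2)
    (frequency_mul_self _) t σ τ

end

end

end StringField

end

open MeasureTheory Set
open scoped ContDiff ComplexConjugate
open StringField
theorem propositionp (n : ℕ) :
    -- the string integrals converge, and the potentials are smooth in the point and the string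
    (∀ (φ : WaveFunction (n + 1)) (e : Spacetime), e ∈ spacelike → ∀ (μ : Index (n + 1)) (k : ℕ)
        (x : Spacetime), IntegrableOn
          (fun s : ℝ => (stringIntegral e)^[k] (contractedFieldStrength φ e μ) (x + s • e))
          (Ioi 0)) ∧
    (∀ (φ : WaveFunction (n + 1)) (μ : Index (n + 1)),
        ContDiffOn ℝ ∞ (fun z : Spacetime × Spacetime => potential z.2 μ z.1 φ)
          {z | z.2 ∈ spacelike}) ∧
    -- the stress-energy tensor is smooth, symmetric and conserved
    (∀ (Ψ Φ : Fock (n + 1)) (ρ σ : Fin 4), ContDiffOn ℝ ∞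
        (fun z : Spacetime × Spacetime × Spacetime => stressTensor z.2.1 z.2.2 ρ σ Ψ Φ z.1)
          {z | z.2.1 ∈ spacelike ∧ z.2.2 ∈ spacelike}) ∧
    (∀ e ∈ spacelike, ∀ e' ∈ spacelike, ∀ (Ψ Φ : Fock (n + 1)) (x : Spacetime),
        (∀ ρ σ, stressTensor e e' ρ σ Ψ Φ x = stressTensor e e' σ ρ Ψ Φ x) ∧
        (∀ σ, ∑ ρ, (metric ρ : ℂ) * partialDeriv ρ (stressTensor e e' ρ σ Ψ Φ) x = 0)) ∧
    -- its moments are the generators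
    (∀ c c' : Spacetime → ℂ, IsStringTest c → IsStringTest c' →
      ∀ (Ψ Φ : Fock (n + 1)) (t : ℝ),
        (∀ σ,
          Integrable (fun x : Space => averagedStressTensor c c' 0 σ Ψ Φ (fourVector t x)) ∧
          Integrable (fun x : Space => averagedMomentumDensity c c' σ Ψ Φ (fourVector t x)) ∧
          ∫ x : Space, averagedStressTensor c c' 0 σ Ψ Φ (fourVector t x) =
            ∫ x : Space, averagedMomentumDensity c c' σ Ψ Φ (fourVector t x) ∧
          ∫ x : Space, averagedMomentumDensity c c' σ Ψ Φ (fourVector t x) =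
            (∫ e, c e) * (∫ e', c' e') * fockInner Ψ (secondQuantize (momentum σ) Φ)) ∧
        (∀ σ τ,
          Integrable (fun x : Space => (lower (fourVector t x) σ : ℂ) *
            averagedStressTensor c c' 0 τ Ψ Φ (fourVector t x)) ∧
          Integrable (fun x : Space => averagedLorentzDensity c c' σ τ Ψ Φ (fourVector t x)) ∧
          ∫ x : Space, ((lower (fourVector t x) σ : ℂ) *
                averagedStressTensor c c' 0 τ Ψ Φ (fourVector t x)
              - (lower (fourVector t x) τ : ℂ) *
                averagedStressTensor c c' 0 σ Ψ Φ (fourVector t x)) =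
            ∫ x : Space, averagedLorentzDensity c c' σ τ Ψ Φ (fourVector t x) ∧
          ∫ x : Space, averagedLorentzDensity c c' σ τ Ψ Φ (fourVector t x) =
            (∫ e, c e) * (∫ e', c' e') * fockInner Ψ (secondQuantize (lorentz σ τ) Φ))) := by
  refine ⟨fun φ e he μ k x => ?_, fun φ μ => ?_, fun Ψ Φ ρ σ => contDiffOn_stressTensor Ψ Φ ρ σ,
    fun e he e' he' Ψ Φ x => ⟨fun ρ σ => stressTensor_symm he he' ρ σ Ψ Φ x,
      fun σ => stressTensor_conserved he he' σ Ψ Φ x⟩,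
    fun c c' hc hc' Ψ Φ t => ⟨fun σ => ⟨?_, ?_, ?_, ?_⟩, fun σ τ => ⟨?_, ?_, ?_, ?_⟩⟩⟩
  · rw [contractedFieldStrength_eq]
    exact integrableOn_iterate_stringIntegral (isAmplitude_contracted φ e μ) he k x
  · refine (contDiffOn_multiplierPotential (smoothOffTip_const 1) μ φ).congr fun z hz => ?_
    rw [potential_eq hz]
  · simp only [averagedStressTensor_eq Ψ Φ _ hc hc']
    exact integrable_finsetSum _ fun i _ =>
      (integrable_averagedForm hc hc' t (isJetForm_stress 0 σ) i).const_mul _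
  · simp only [averagedMomentumDensity_eq Ψ Φ _ hc hc']
    exact integrable_finsetSum _ fun i _ =>
      (integrable_averagedForm hc hc' t (isJetForm_momentum σ) i).const_mul _
  · exact integral_averagedStressTensor hc hc' Ψ Φ t σ
  · exact integral_averagedMomentumDensity hc hc' Ψ Φ t σ
  · exact integrable_lower_mul_averagedStressTensor hc hc' Ψ Φ t σ τ
  · simp only [averagedLorentzDensity_eq Ψ Φ _ hc hc']
    exact integrable_finsetSum _ fun i _ =>
      (integrable_averagedForm_lorentz hc hc' t σ τ i).const_mul _
  · exact integral_moment_averagedStressTensor hc hc' Ψ Φ t σ τ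
  · exact integral_averagedLorentzDensity hc hc' Ψ Φ t σ τ
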